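/- **Setting.** Let $Q\subset\mathbb R^n$ ($n\ge1$) be closed and convex, $\mu_0>0$, and let $Q_{\mu_0}$ be the closed Euclidean $\mu_0$-neighbourhood of $Q$. At step $k=1,2,\dots$ an adversary, who knows the whole past (all $\xi^j,e^j,x^j$, losses and noises of steps $j<k$, and $x^k$), chooses a random loss $f_k(x,\xi)$ and its noisy version $\tilde f_k(x,\xi)$. Then $\xi^k$ and $e^k$ are drawn, independently of the past and of each other; the $\xi^k$ have a common law, and $e^k$ is uniform on the Euclidean unit sphere. Put $f_k(x)=E_\xi f_k(x,\xi)$; these functions are convex on $Q_{\mu_0}$. All random functions are measurable. The following conditions on $f_k,\tilde f_k$ are for all $k$, all pasts and all points of $Q_{\mu_0}$. * (N) $|\tilde f_k(x,\xi)-f_k(x,\xi)|\le\delta$ and $E_\xi\tilde f_k(x,\xi)^2\le B^2$, with $B>0$. This is always assumed. * (Lip$_r$) $|f_k(x,\xi)-f_k(y,\xi)|\le M_r(\xi)\|x-y\|_r$ with $E M_r(\xi)^2\le M_r^2$, $M_r>0$. * (Sm) $f_k(\cdot,\xi)$ is differentiable and $\|\nabla f_k(x,\xi)-\nabla f_k(y,\xi)\|_2\le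 L_2(\xi)\|x-y\|_2$ with $E L_2(\xi)^2\le L_2^2$, $L_2>0$. **Method.** Let $1\le p\le2$, $1/p+1/q=1$, and let $d$ be continuous on $Q$ and strongly convex on $Q$ with constant $1$ in the $l_p$-norm. Put $V_x(y)=d(y)-d(x)-\langle\nabla d(x),y-x\rangle$. Start at $x^1=\arg\min_Qd$ and set $$x^{k+1}=\arg\min_{y\in Q}\{\langle\alpha_kg_k,y-x^k\rangle+V_{x^k}(y)\}$$ ($d$ is assumed differentiable at $x^1,x^2,\dots$), where, with $0<\mu\le\mu_0$, $$g_k=\tfrac n\mu\tilde f_k(x^k+\mu e^k,\xi^k)e^k\quad(m=1),\qquad g_k=\tfrac n\mu\bigl(\tilde f_k(x^k+\mu e^k,\xi^k)-\tilde f_k(x^k,\xi^k)\bigr)e^k\quad(m=2).$$ Let $D>0$ satisfy $V_{x^1}(y)\le D^2$ for all $y\in Q$. **Regret.** Put $$\mathrm{Regret}_N=\frac1N\sum_{k=1}^Nf_k(x^k)-\min_{x\in Q}\frac1N\sum_{k=1}^Nf_k(x),\qquad \overline{\mathrm{Regret}}_N=E\frac1N\sum_{k=1}^Nf_k(x^k)-\min_{x\in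 Q}E\frac1N\sum_{k=1}^Nf_k(x).$$ **Theorem.** For every $K\ge1$ there is a constant $C>0$, depending only on $K$, such that the following holds for all data as above, all $\varepsilon>0$ and all $N\in\mathbb N$. Assume $\delta\le\frac{\varepsilon\mu}{8D\sqrt n}$ if $m=1$ and $\delta\le\frac{\varepsilon\mu}{16D\sqrt n}$ if $m=2$. *(A) Convex losses.* Let $R>0$, $M>0$ and $\alpha_k\equiv\frac RM\sqrt{2/N}$, where $M^2$ lies between $M_0^2/K$ and $K(1+\ln n)M_0^2$. Suppose that $N\ge C(1+\ln n)^2T$. In the four cases $M_0^2$, $T$ and the further conditions are: 1. $m=1$, (Lip$_2$), $\frac1K\cdot\frac{\varepsilon}{2M_2}\le\mu\le\frac{\varepsilon}{2M_2}$: $M_0^2=\frac{n^{1+2/q}B^2}{\mu^2}$, $T=\frac{B^2M_2^2R^2n^{1+2/q}}{\varepsilon^4}$; 2. $m=1$, (Sm), $\frac1K\sqrt{\varepsilon/L_2}\le\mu\le\sqrt{\varepsilon/L_2}$: $M_0^2=\frac{n^{1+2/q}B^2}{\mu^2}$, $T=\frac{B^2L_2R^2n^{1+2/q}}{\varepsilon^3}$;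 3. $m=2$, (Lip$_2$) and (Lip$_p$), $\mu\le\frac{\varepsilon}{2M_2}$: $M_0^2=n^2M_p^2$, $T=\frac{M_p^2R^2n^2}{\varepsilon^2}$; 4. $m=2$, (Lip$_2$) and (Sm), $\mu\le\min\Bigl\{\max\Bigl\{\frac{\varepsilon}{2M_2},\sqrt{\frac{\varepsilon}{L_2}}\Bigr\},\frac{M_2}{L_2}\sqrt{\frac4{3n}}\Bigr\}$, $\delta\le\frac{M_2\mu}{\sqrt{12n}}$: $M_0^2=n^{2/q}M_2^2$, $T=\frac{M_2^2R^2n^{2/q}}{\varepsilon^2}$. Then $E[\mathrm{Regret}_N]\le\varepsilon$ whenever, for every realization, some minimizer $x_*\in Q$ of $\frac1N\sum_{k\le N}f_k$ has $V_{x^1}(x_*)\le R^2$. Also $\overline{\mathrm{Regret}}_N\le\varepsilon$ whenever some minimizer $x_*\in Q$ of $E\frac1N\sum_{k\le N}f_k$ has $V_{x^1}(x_*)\le R^2$. *(B) Strongly convex losses.* Let the $f_k$ be $\gamma_2$-strongly convex on $Q_{\mu_0}$ in $l_2$, $\gamma_2>0$, $p=2$, $d(x)=\frac12\|x-c\|_2^2$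 for some $c\in\mathbb R^n$, and $\alpha_k=(\gamma_2k)^{-1}$. Suppose that $N\ge C(1+\ln N)T$, where under the conditions on $\mu$, $\delta$ and the losses of the cases 1–4 (with $p=2$) $T$ is, respectively, $$\frac{B^2M_2^2n^2}{\gamma_2\varepsilon^3},\qquad\frac{B^2L_2n^2}{\gamma_2\varepsilon^2},\qquad\frac{M_2^2n^2}{\gamma_2\varepsilon},\qquad\frac{M_2^2n}{\gamma_2\varepsilon}.$$ Then $\overline{\mathrm{Regret}}_N\le\varepsilon$; if moreover the functions $f_k(x)$ do not depend on the past, then $E[\mathrm{Regret}_N]\le\varepsilon$. -/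

import Mathlib

open MeasureTheory ProbabilityTheory Set

noncomputable section

namespace BanditMD

/-- `ℝⁿ`; the norm and the inner product of this type are the Euclidean ones. -/
abbrev Vec (n : ℕ) : Type := EuclideanSpace ℝ (Fin n)

/-- The `l_r`-norm on `ℝⁿ` for a finite exponent `r ≥ 1`. -/
def lNorm {n : ℕ} (r : ℝ) (x : Vec n) : ℝ := (∑ i, |x i| ^ r) ^ (1 / r)

/-- The number `2 / q`, where `1 / p + 1 / q = 1` (it is `0` for `p = 1`, i.e. `q = ∞`). -/
def twoDivQ (p : ℝ) : ℝ := 2 * (1 - 1 / p)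

/-- The uniform probability distribution on the Euclidean unit sphere of `ℝⁿ` (for `n ≥ 1`),
as a measure on `ℝⁿ`: the normalized surface measure. -/
def sphereUniform (n : ℕ) : Measure (Vec n) :=
  ((volume : Measure (Vec n)).toSphere univ)⁻¹ •
    ((volume : Measure (Vec n)).toSphere).map Subtype.val

/-- A prox-function on `Q` for the `l_p`-norm: continuous on `Q` and strongly convex on `Q` with
constant (at least) `1` with respect to this norm. -/
structure IsProx {n : ℕ} (p : ℝ) (Q : Set (Vec n)) (d : Vec n → ℝ) : Prop where
  continuousOn : ContinuousOn d Q
  strongConvex : ∀ x ∈ Q, ∀ y ∈ Q, ∀ t ∈ Icc (0 : ℝ) 1,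
    d (t • x + (1 - t) • y) ≤
      t * d x + (1 - t) * d y - t * (1 - t) / 2 * lNorm p (x - y) ^ 2

/-- The Euclidean prox-function with centre `c`. -/
def euclideanProx {n : ℕ} (c : Vec n) (x : Vec n) : ℝ := ‖x - c‖ ^ 2 / 2

/-- The Bregman divergence `V_x(y) = d(y) - d(x) - ⟨∇d(x), y - x⟩`. -/
def bregman {n : ℕ} (d : Vec n → ℝ) (x y : Vec n) : ℝ :=
  d y - d x - fderiv ℝ d x (y - x)

/-- `z = Mirr_x(g)`: `z` minimizes `⟨g, y - x⟩ + V_x(y)` over `y ∈ Q`. -/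
def IsMirr {n : ℕ} (Q : Set (Vec n)) (d : Vec n → ℝ) (x g z : Vec n) : Prop :=
  z ∈ Q ∧ IsMinOn (fun y => inner ℝ g (y - x) + bregman d x y) Q z

/-- The data of a stochastic online optimization problem with zeroth-order noisy feedback.
Steps are numbered `0, 1, 2, …`. -/
structure Game (n : ℕ) (Ω Ξ : Type*) [MeasurableSpace Ω] [MeasurableSpace Ξ] where
  /-- the underlying probability -/
  P : Measure Ω
  /-- the common distribution of the random variables `ξ k` -/
  law : Measure Ξ
  /-- `ℱ k` is what is known before step `k` (to the adversary) -/
  ℱ : Filtration ℕ (inferInstance : MeasurableSpace Ω)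
  /-- the random directions of the method -/
  e : ℕ → Ω → Vec n
  /-- the randomness of the losses -/
  ξ : ℕ → Ω → Ξ
  /-- the feasible set -/
  Q : Set (Vec n)
  /-- the losses are considered on the `μ₀`-neighbourhood of `Q` -/
  μ₀ : ℝ
  /-- `f k ω x z` is the value `f_k(x, z)` of the loss chosen at step `k`; the argument `ω` is
  there because the choice may depend on the past -/
  f : ℕ → Ω → Vec n → Ξ → ℝ
  /-- the noisy values of the loss -/
  fNoisy : ℕ → Ω → Vec n → Ξ → ℝ

namespace Game

variable {n : ℕ} {Ω Ξ : Type*} [MeasurableSpace Ω] [MeasurableSpace Ξ] (G : Game n Ω Ξ)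

/-- The closed (Euclidean) `μ₀`-neighbourhood of `Q`. -/
def nbhd : Set (Vec n) := Metric.cthickening G.μ₀ G.Q

/-- The loss `f_k(x) = E_ξ f_k(x, ξ)`, for the choice made at `ω`. -/
def loss (k : ℕ) (ω : Ω) (x : Vec n) : ℝ := ∫ z, G.f k ω x z ∂G.law

/-- The standing assumptions. The adversary chooses the loss and the noise of step `k` knowing
the whole past (which includes `e j` and `ξ j` for `j < k`), but `e k` and `ξ k` are independent
of that past and of each other, `e k` is uniform on the unit sphere, and `ξ k` has law `law`.
The losses `f_k` are convex. -/
structure Valid : Prop where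
  isProb : IsProbabilityMeasure G.P
  isProb_law : IsProbabilityMeasure G.law
  measurable_e : ∀ k, Measurable[G.ℱ (k + 1)] (G.e k)
  measurable_ξ : ∀ k, Measurable[G.ℱ (k + 1)] (G.ξ k)
  map_eq : ∀ k, G.P.map (fun ω => (G.e k ω, G.ξ k ω)) = (sphereUniform n).prod G.law
  indep : ∀ k, Indep
    (MeasurableSpace.comap (fun ω => (G.e k ω, G.ξ k ω)) inferInstance) (G.ℱ k) G.P
  isClosed : IsClosed G.Q
  convex : Convex ℝ G.Q
  measurable_f : ∀ k, Measurable[@Prod.instMeasurableSpace Ω (Vec n × Ξ) (G.ℱ k) inferInstance]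
    (fun t : Ω × (Vec n × Ξ) => G.f k t.1 t.2.1 t.2.2)
  measurable_fNoisy : ∀ k,
    Measurable[@Prod.instMeasurableSpace Ω (Vec n × Ξ) (G.ℱ k) inferInstance]
    (fun t : Ω × (Vec n × Ξ) => G.fNoisy k t.1 t.2.1 t.2.2)
  convexOn_loss : ∀ k ω, ConvexOn ℝ G.nbhd (G.loss k ω)

/-- The losses are `γ`-strongly convex in the Euclidean norm. -/
def StronglyConvex (γ : ℝ) : Prop :=
  ∀ k ω, StrongConvexOn G.nbhd γ (G.loss k ω)

/-- Noise level `δ` and second moment of the observed values at most `B ^ 2`. -/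
structure NoiseBound (δ B : ℝ) : Prop where
  noise : ∀ k ω, ∀ x ∈ G.nbhd, ∀ z, |G.fNoisy k ω x z - G.f k ω x z| ≤ δ
  memLp : ∀ k ω, ∀ x ∈ G.nbhd, MemLp (G.fNoisy k ω x) 2 G.law
  moment : ∀ k ω, ∀ x ∈ G.nbhd, ∫ z, G.fNoisy k ω x z ^ 2 ∂G.law ≤ B ^ 2

/-- `|f_k(x, ξ) - f_k(y, ξ)| ≤ M_r(ξ) ‖x - y‖_r` with `E M_r(ξ)² ≤ M²`. -/
def LipschitzLoss (r M : ℝ) : Prop :=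
  ∀ k ω, ∃ m : Ξ → ℝ, MemLp m 2 G.law ∧ ∫ z, m z ^ 2 ∂G.law ≤ M ^ 2 ∧
    ∀ z, ∀ x ∈ G.nbhd, ∀ y ∈ G.nbhd, |G.f k ω x z - G.f k ω y z| ≤ m z * lNorm r (x - y)

/-- `f_k(·, ξ)` is differentiable, with `‖∇f_k(x, ξ) - ∇f_k(y, ξ)‖₂ ≤ L₂(ξ) ‖x - y‖₂` and
`E L₂(ξ)² ≤ L²`. -/
def SmoothLoss (L : ℝ) : Prop :=
  ∀ k ω, ∃ l : Ξ → ℝ, MemLp l 2 G.law ∧ ∫ z, l z ^ 2 ∂G.law ≤ L ^ 2 ∧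
    ∀ z, ∃ grad : Vec n → Vec n,
      (∀ x ∈ G.nbhd, HasGradientWithinAt (fun y => G.f k ω y z) (grad x) G.nbhd x) ∧
      ∀ x ∈ G.nbhd, ∀ y ∈ G.nbhd, ‖grad x - grad y‖ ≤ l z * ‖x - y‖

/-- The one-point gradient estimate with smoothing radius `μ`, at the point `x`. -/
def onePoint (μ : ℝ) (k : ℕ) (ω : Ω) (x : Vec n) : Vec n :=
  ((n : ℝ) / μ * G.fNoisy k ω (x + μ • G.e k ω) (G.ξ k ω)) • G.e k ω

/-- The two-point gradient estimate with smoothing radius `μ`, at the point `x`. -/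
def twoPoint (μ : ℝ) (k : ℕ) (ω : Ω) (x : Vec n) : Vec n :=
  ((n : ℝ) / μ * (G.fNoisy k ω (x + μ • G.e k ω) (G.ξ k ω) - G.fNoisy k ω x (G.ξ k ω))) •
    G.e k ω

/-- `x` is the (random) sequence produced by mirror descent with prox-function `d`, gradient
estimate `g` and step sizes `α`, started at the minimizer `x₁` of `d` on `Q`. The Bregman
divergences `V_{x k}` have to make sense, so `d` is differentiable at the iterates. -/
structure IsMirrorDescent (d : Vec n → ℝ) (g : ℕ → Ω → Vec n → Vec n) (α : ℕ → ℝ)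
    (x₁ : Vec n) (x : ℕ → Ω → Vec n) : Prop where
  start_mem : x₁ ∈ G.Q
  start_min : IsMinOn d G.Q x₁
  start : ∀ ω, x 0 ω = x₁
  step : ∀ k ω, IsMirr G.Q d (x k ω) (α k • g k ω (x k ω)) (x (k + 1) ω)
  differentiable : ∀ k ω, DifferentiableAt ℝ d (x k ω)

/-- The average `(1 / N) ∑ f_k(y)` of the first `N` losses. -/
def avgLoss (N : ℕ) (ω : Ω) (y : Vec n) : ℝ :=
  (1 / (N : ℝ)) * ∑ k ∈ Finset.range N, G.loss k ω y

/-- The average `(1 / N) ∑ f_k(x^k)` of the losses incurred in the first `N` steps. -/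
def incurred (x : ℕ → Ω → Vec n) (N : ℕ) (ω : Ω) : ℝ :=
  (1 / (N : ℝ)) * ∑ k ∈ Finset.range N, G.loss k ω (x k ω)

/-- `Regret_N = (1 / N) ∑ f_k(x^k) - min_{y ∈ Q} (1 / N) ∑ f_k(y)`, a random variable. -/
def regret (x : ℕ → Ω → Vec n) (N : ℕ) (ω : Ω) : ℝ :=
  G.incurred x N ω - sInf (G.avgLoss N ω '' G.Q)

/-- `E Regret_N ≤ ε` (the expectation exists). -/
def RegretBound (x : ℕ → Ω → Vec n) (N : ℕ) (ε : ℝ) : Prop :=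
  Integrable (G.regret x N) G.P ∧ ∫ ω, G.regret x N ω ∂G.P ≤ ε

/-- The expected average loss of a fixed decision `y`. -/
def expAvgLoss (N : ℕ) (y : Vec n) : ℝ := ∫ ω, G.avgLoss N ω y ∂G.P

/-- `E[(1 / N) ∑ f_k(x^k)] - min_{y ∈ Q} E[(1 / N) ∑ f_k(y)] ≤ ε` (the expectations exist). -/
def PseudoRegretBound (x : ℕ → Ω → Vec n) (N : ℕ) (ε : ℝ) : Prop :=
  Integrable (G.incurred x N) G.P ∧
  (∀ y ∈ G.Q, Integrable (fun ω => G.avgLoss N ω y) G.P) ∧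
  ∫ ω, G.incurred x N ω ∂G.P - sInf (G.expAvgLoss N '' G.Q) ≤ ε

/-- The conclusion for convex losses. If the best decision in hindsight `x_*` (which depends on
the realized losses) satisfies `V_{x₁}(x_*) ≤ R²`, then `E Regret_N ≤ ε`; if the best fixed
decision `x_*` for the expected losses does, then the pseudo-regret is at most `ε`. -/
def ConvexConclusion (d : Vec n → ℝ) (x₁ : Vec n) (R : ℝ) (x : ℕ → Ω → Vec n) (N : ℕ)
    (ε : ℝ) : Prop :=
  ((∀ ω, ∃ xs ∈ G.Q, IsMinOn (G.avgLoss N ω) G.Q xs ∧ bregman d x₁ xs ≤ R ^ 2) →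
    G.RegretBound x N ε) ∧
  ((∃ xs ∈ G.Q, IsMinOn (G.expAvgLoss N) G.Q xs ∧ bregman d x₁ xs ≤ R ^ 2) →
    G.PseudoRegretBound x N ε)

/-- The conclusion for strongly convex losses: the pseudo-regret is at most `ε`; if the losses
do not depend on the past, this is also true of the expected regret. -/
def StronglyConvexConclusion (x : ℕ → Ω → Vec n) (N : ℕ) (ε : ℝ) : Prop :=
  G.PseudoRegretBound x N ε ∧
  ((∀ k ω ω', G.loss k ω = G.loss k ω') → G.RegretBound x N ε)

end Game

end BanditMD

end

open BanditMD

noncomputable section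

namespace BanditMD

open scoped Pointwise ENNReal

variable {n : ℕ}

/-! ### The uniform distribution on the sphere -/

/-! Two facts about the estimate `(n / μ) f(x + μ e) e` drive the theorem.

Its mean is nearly a subgradient. By the divergence theorem it is the gradient at `x` of the average
of `f` over the ball of radius `μ`, so convexity gives the subgradient inequality against every `y`
with a defect `b`, the amount by which averaging can raise `f` at `y` (`smoothing_inequality`). The
hypotheses on `μ` make `b ≤ ε / 2`. Noise adds a bias of at most `(n / μ) δ E|⟨e, y - x⟩|`; a
coordinate of `e` has root mean square `1 / √n`, so this is `√n δ / μ` times the diameter bound `2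
√2 D`, hence at most `0.36 ε`. The value subtracted in two-point feedback does not depend on `e`,
which has mean zero, so both feedbacks have the same mean. There remains `0.14 ε` for the
optimization error.

Its second moment is governed by the sphere. The dual `l_q`-norm is replaced by the larger `n ^ (1 /
q) ‖·‖_∞`, and a union bound over `2 n` caps gives `E ‖e‖_∞² ≤ 8 (1 + log n) / n`
(`integral_supNorm_sq_le`), the source of the logarithm of `n`. For smooth losses the two-point
difference is close to `μ ⟨∇f, e⟩`, and invariance of the law of `e` under permutations and sign
changes of coordinates gives `E[⟨s, e⟩² ‖e‖_∞²] = (‖s‖² / n) E ‖e‖_∞²`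
(`SymmWeight.integral_inner_sq`), a further factor `1 / n`.

Mirror descent turns these facts into regret. In the convex case the best decision in hindsight
depends on the whole future, so the martingale differences `Δ_k` (estimate minus conditional mean)
cannot be averaged against it. They are played instead against a second, predictable sequence `y_k`,
the regularized leader fed with the `Δ_k` (`inner_sum_le_of_argmin`). Pathwise this leaves a prox
term, second moments and `∑ ⟨Δ_k, y_k - x_k⟩`, which has mean zero. The resulting majorant is the
same for all comparators with `V ≤ R²` and settles both kinds of regret at once. A leader is used
rather than a second mirror descent because `d` need not be differentiable at its iterates. In the
strongly convex case the comparator is fixed, the `Δ_k` have mean zero against it, and the quadratic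
term makes the Bregman terms telescope.

Conditional expectations never appear: the pair `(e_k, ξ_k)` is independent of the past, and
integrals are computed on a product of laws (`integral_freeze`). -/

theorem nontrivial_vec (hn : 1 ≤ n) : Nontrivial (Vec n) := by
  have : Nonempty (Fin n) := ⟨⟨0, hn⟩⟩
  infer_instance

/-- Surface measure is `n` times the volume of the cone over a set, and the factor `n` cancels in
the normalization. Invariance and cap estimates thereby become statements about volumes. -/
theorem sphereUniform_apply (hn : 1 ≤ n) {s : Set (Vec n)} (hs : MeasurableSet s) :
    sphereUniform n s = (volume (Metric.ball (0 : Vec n) 1))⁻¹ *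
      volume (Ioo (0 : ℝ) 1 • (Metric.sphere (0 : Vec n) 1 ∩ s)) := by
  have := nontrivial_vec hn
  rw [sphereUniform, Measure.smul_apply, Measure.map_apply measurable_subtype_coe hs,
    Measure.toSphere_apply_univ, Measure.toSphere_apply' _ (measurable_subtype_coe hs),
    Subtype.image_preimage_coe, smul_eq_mul, finrank_euclideanSpace_fin]
  have h0 : (n : ℝ≥0∞) ≠ 0 := by simp; omega
  rw [ENNReal.mul_inv (Or.inl h0) (Or.inl (by simp))]
  rw [mul_comm (n : ℝ≥0∞)⁻¹, mul_assoc, ← mul_assoc _ (n : ℝ≥0∞), ENNReal.inv_mul_cancel h0 (by simp),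
    one_mul]

theorem isProbabilityMeasure_sphereUniform (hn : 1 ≤ n) :
    IsProbabilityMeasure (sphereUniform n) := by
  have := nontrivial_vec hn
  constructor
  rw [sphereUniform, Measure.smul_apply, Measure.map_apply measurable_subtype_coe .univ,
    preimage_univ, smul_eq_mul]
  refine ENNReal.inv_mul_cancel ?_ (measure_ne_top _ _)
  rw [Measure.measure_univ_ne_zero]
  exact Measure.toSphere_ne_zero _

theorem ae_norm_eq_one : ∀ᵐ e ∂sphereUniform n, ‖e‖ = 1 := by
  refine Measure.ae_smul_measure ?_ _
  rw [ae_map_iff measurable_subtype_coe.aemeasurable (measurableSet_eq_fun (by fun_prop) (by fun_prop))]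
  exact .of_forall fun x => by simp

/-- A linear isometry carries cones over subsets of the sphere to such cones and preserves volume.
-/
theorem sphereUniform_map (hn : 1 ≤ n) (A : Vec n ≃ₗᵢ[ℝ] Vec n) :
    (sphereUniform n).map A = sphereUniform n := by
  ext s hs
  have hA : Measurable A := A.continuous.measurable
  rw [Measure.map_apply hA hs, sphereUniform_apply hn (hA hs), sphereUniform_apply hn hs]
  congr 1
  rw [← A.measurePreserving.measure_preimage_emb A.toHomeomorph.measurableEmbedding
    (Ioo (0 : ℝ) 1 • (Metric.sphere (0 : Vec n) 1 ∩ s))]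
  congr 1
  ext u
  simp only [mem_smul, mem_inter_iff, mem_preimage, mem_sphere_iff_norm, sub_zero]
  constructor
  · rintro ⟨r, hr, y, ⟨hy, hys⟩, rfl⟩
    exact ⟨r, hr, A y, ⟨by simpa using hy, hys⟩, by simp⟩
  · rintro ⟨r, hr, y, ⟨hy, hys⟩, h⟩
    refine ⟨r, hr, A.symm y, ⟨by simpa using hy, by simpa using hys⟩, ?_⟩
    apply A.injective
    simp [← h]

theorem integral_sphereUniform_comp (hn : 1 ≤ n) (A : Vec n ≃ₗᵢ[ℝ] Vec n) (F : Vec n → ℝ) :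
    ∫ e, F (A e) ∂sphereUniform n = ∫ e, F e ∂sphereUniform n := by
  conv_rhs => rw [← sphereUniform_map hn A]
  exact (A.toHomeomorph.measurableEmbedding.integral_map _).symm

theorem integral_sphereUniform (G : Vec n → ℝ) :
    ∫ e, G e ∂sphereUniform n = ((volume : Measure (Vec n)).toSphere.real univ)⁻¹ *
      ∫ e, G e ∂(volume : Measure (Vec n)).toSphere := by
  rw [sphereUniform, integral_smul_measure,
    (MeasurableEmbedding.subtype_coe Metric.isClosed_sphere.measurableSet).integral_map]
  simp [measureReal_def]

/-- Polar coordinates for the product of a radial and an angular function. -/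
theorem integral_radial_mul_angular (hn : 1 ≤ n) (φ : ℝ → ℝ) (G : Vec n → ℝ) :
    ∫ u : Vec n, φ ‖u‖ * G (‖u‖⁻¹ • u) =
      (∫ u : Vec n, φ ‖u‖) * ∫ e, G e ∂sphereUniform n := by
  have := nontrivial_vec hn
  have key : ∀ H : Vec n → ℝ, ∫ u : Vec n, φ ‖u‖ * H (‖u‖⁻¹ • u) =
      (∫ e, H e ∂(volume : Measure (Vec n)).toSphere) *
        ∫ r : Ioi (0 : ℝ), φ r ∂(Measure.volumeIoiPow (Module.finrank ℝ (Vec n) - 1)) := by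
    intro H
    calc
      _ = ∫ x : ({(0)}ᶜ : Set (Vec n)), φ ‖x.1‖ * H (‖x.1‖⁻¹ • x.1) ∂(volume.comap Subtype.val) := by
        rw [integral_subtype_comap (measurableSet_singleton _).compl
          fun x : Vec n ↦ φ ‖x‖ * H (‖x‖⁻¹ • x), restrict_compl_singleton]
      _ = ∫ x, H x.1 * φ x.2 ∂(volume : Measure (Vec n)).toSphere.prod
            (.volumeIoiPow (Module.finrank ℝ (Vec n) - 1)) := by
        rw [← (volume : Measure (Vec n)).measurePreserving_homeomorphUnitSphereProd.integral_comp
          (Homeomorph.measurableEmbedding _)]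
        simp [mul_comm]
      _ = _ := integral_prod_mul (fun e : Metric.sphere (0 : Vec n) 1 => H e)
          (fun r : Ioi (0 : ℝ) => φ r)
  -- The radial integral in `key` is never evaluated: the case `H = 1` identifies it with `∫ φ ‖u‖`
  -- up to the total surface.
  have h1 := key fun _ => 1
  simp only [mul_one, integral_const, smul_eq_mul] at h1
  rw [key, h1, integral_sphereUniform]
  have : (volume : Measure (Vec n)).toSphere.real univ ≠ 0 := by
    rw [Measure.toSphere_real_apply_univ, measureReal_def]
    refine mul_ne_zero (by simp; omega) ?_
    exact (ENNReal.toReal_pos (Metric.measure_ball_pos _ _ one_pos).ne' measure_ball_lt_top.ne).ne'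
  field_simp

/-- A weight on `ℝⁿ` is symmetric if it is invariant under permutations and sign changes of the
coordinates. -/
structure SymmWeight (h : Vec n → ℝ) : Prop where
  measurable : Measurable h
  swap : ∀ i j e, h (LinearIsometryEquiv.piLpCongrLeft 2 ℝ ℝ (Equiv.swap i j) e) = h e
  neg : ∀ i e, h (LinearIsometryEquiv.piLpCongrRight 2
    (fun j => if j = i then LinearIsometryEquiv.neg ℝ else LinearIsometryEquiv.refl ℝ ℝ) e) = h e
  bound : ∃ c, ∀ e, ‖e‖ = 1 → |h e| ≤ c

theorem integrable_sphereUniform (hn : 1 ≤ n) {F : Vec n → ℝ} (hF : Measurable F) {c : ℝ}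
    (hc : ∀ e, ‖e‖ = 1 → |F e| ≤ c) : Integrable F (sphereUniform n) := by
  have := isProbabilityMeasure_sphereUniform hn
  refine Integrable.of_bound hF.aestronglyMeasurable c ?_
  filter_upwards [ae_norm_eq_one] with e he using hc e he

theorem abs_coord_le_norm (e : Vec n) (i : Fin n) : |e i| ≤ ‖e‖ := by
  simpa using PiLp.norm_apply_le e i

theorem SymmWeight.integrable_coord_mul (hn : 1 ≤ n) {h : Vec n → ℝ} (hh : SymmWeight h)
    (i j : Fin n) : Integrable (fun e => e i * e j * h e) (sphereUniform n) := by
  obtain ⟨c, hc⟩ := hh.bound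
  have := hh.measurable
  refine integrable_sphereUniform hn (by fun_prop) (c := c) fun e he => ?_
  have hi := abs_coord_le_norm e i
  have hj := abs_coord_le_norm e j
  rw [abs_mul, abs_mul]
  rw [he] at hi hj
  have := hc e he
  calc |e i| * |e j| * |h e| ≤ 1 * 1 * c := by gcongr
    _ = c := by ring

/-- Expand the square in coordinates. Sign changes kill the mixed moments, transpositions make the
diagonal ones equal, and these add up to the mean of `h` because `‖e‖ = 1` almost surely. -/
theorem SymmWeight.integral_inner_sq (hn : 1 ≤ n) {h : Vec n → ℝ} (hh : SymmWeight h) (s : Vec n) :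
    ∫ e, inner ℝ s e ^ 2 * h e ∂sphereUniform n =
      ‖s‖ ^ 2 / n * ∫ e, h e ∂sphereUniform n := by
  have hoff : ∀ i j, i ≠ j → ∫ e, e i * e j * h e ∂sphereUniform n = 0 := by
    intro i j hij
    have := integral_sphereUniform_comp hn (LinearIsometryEquiv.piLpCongrRight 2
      (fun j => if j = i then LinearIsometryEquiv.neg ℝ else LinearIsometryEquiv.refl ℝ ℝ))
      (fun e => e i * e j * h e)
    simp only [hh.neg] at this
    simp [Ne.symm hij, integral_neg] at this
    linarith
  have hdiag : ∀ i j, ∫ e, e i * e i * h e ∂sphereUniform n =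
      ∫ e, e j * e j * h e ∂sphereUniform n := by
    intro i j
    have := integral_sphereUniform_comp hn
      (LinearIsometryEquiv.piLpCongrLeft 2 ℝ ℝ (Equiv.swap i j)) (fun e => e j * e j * h e)
    simp only [hh.swap] at this
    rw [← this]
    simp [LinearIsometryEquiv.piLpCongrLeft_apply, Equiv.piCongrLeft']
  have hd : ∀ i : Fin n, ∫ e, e i * e i * h e ∂sphereUniform n =
      (1 / n) * ∫ e, h e ∂sphereUniform n := by
    intro i
    have h1 : ∫ e, h e ∂sphereUniform n = ∑ j : Fin n, ∫ e, e j * e j * h e ∂sphereUniform n := by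
      rw [← integral_finsetSum _ fun j _ => hh.integrable_coord_mul hn j j]
      refine integral_congr_ae ?_
      filter_upwards [ae_norm_eq_one] with e he
      have : ∑ j, e j * e j = 1 := by
        have := EuclideanSpace.real_norm_sq_eq e
        rw [he] at this
        simpa [sq] using this.symm
      rw [← Finset.sum_mul, this, one_mul]
    rw [h1, Finset.sum_congr rfl fun j _ => hdiag j i]
    have : (n : ℝ) ≠ 0 := by simp; omega
    simp
    field_simp
  have hexp : ∀ e : Vec n, inner ℝ s e ^ 2 * h e =
      ∑ i, ∑ j, s i * s j * (e i * e j * h e) := by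
    intro e
    rw [PiLp.inner_apply, sq, Finset.sum_mul_sum, Finset.sum_mul]
    refine Finset.sum_congr rfl fun i _ => ?_
    rw [Finset.sum_mul]
    refine Finset.sum_congr rfl fun j _ => ?_
    simp
    ring
  simp_rw [hexp]
  rw [integral_finsetSum _ fun i _ => integrable_finsetSum _ fun j _ =>
    (hh.integrable_coord_mul hn i j).const_mul _]
  have : ∀ i, ∫ e, ∑ j, s i * s j * (e i * e j * h e) ∂sphereUniform n =
      s i * s i * ((1 / n) * ∫ e, h e ∂sphereUniform n) := by
    intro i
    rw [integral_finsetSum _ fun j _ => (hh.integrable_coord_mul hn i j).const_mul _,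
      Finset.sum_eq_single i]
    · rw [integral_const_mul, hd]
    · intro j _ hji
      rw [integral_const_mul, hoff i j hji.symm, mul_zero]
    · simp
  rw [Finset.sum_congr rfl fun i _ => this i, ← Finset.sum_mul, EuclideanSpace.real_norm_sq_eq]
  simp [sq]
  ring

theorem symmWeight_one : SymmWeight (fun _ : Vec n => (1 : ℝ)) :=
  ⟨measurable_const, fun _ _ _ => rfl, fun _ _ => rfl, 1, by simp⟩

/-- The `l_∞`-norm. -/
def supNorm (x : Vec n) : ℝ := ‖WithLp.ofLp x‖

theorem abs_coord_le_supNorm (x : Vec n) (i : Fin n) : |x i| ≤ supNorm x := by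
  simpa [supNorm] using norm_le_pi_norm (WithLp.ofLp x) i

theorem supNorm_nonneg (x : Vec n) : 0 ≤ supNorm x := norm_nonneg _

theorem supNorm_le {x : Vec n} {c : ℝ} (hc : 0 ≤ c) (h : ∀ i, |x i| ≤ c) : supNorm x ≤ c := by
  rw [supNorm, pi_norm_le_iff_of_nonneg hc]
  simpa using h

theorem supNorm_le_norm (x : Vec n) : supNorm x ≤ ‖x‖ :=
  supNorm_le (norm_nonneg _) (abs_coord_le_norm x)

theorem supNorm_smul (t : ℝ) (x : Vec n) : supNorm (t • x) = |t| * supNorm x := by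
  simp [supNorm, norm_smul]

theorem supNorm_add_le (x y : Vec n) : supNorm (x + y) ≤ supNorm x + supNorm y := by
  simpa [supNorm] using norm_add_le (WithLp.ofLp x) (WithLp.ofLp y)

@[fun_prop]
theorem continuous_supNorm : Continuous (supNorm : Vec n → ℝ) := by
  unfold supNorm; fun_prop

theorem symmWeight_supNorm_sq (a : ℝ) : SymmWeight (fun e : Vec n => a * supNorm e ^ 2) where
  measurable := by
    have := (continuous_supNorm (n := n)).measurable
    fun_prop
  swap i j e := by
    congr 2
    apply le_antisymm
    · refine supNorm_le (supNorm_nonneg _) fun k => ?_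
      simpa [LinearIsometryEquiv.piLpCongrLeft_apply, Equiv.piCongrLeft'] using
        abs_coord_le_supNorm e _
    · refine supNorm_le (supNorm_nonneg _) fun k => ?_
      have := abs_coord_le_supNorm
        (LinearIsometryEquiv.piLpCongrLeft 2 ℝ ℝ (Equiv.swap i j) e) (Equiv.swap i j k)
      simpa [LinearIsometryEquiv.piLpCongrLeft_apply, Equiv.piCongrLeft'] using this
  neg i e := by
    congr 2
    have h : ∀ k, |(LinearIsometryEquiv.piLpCongrRight 2
      (fun j => if j = i then LinearIsometryEquiv.neg ℝ else LinearIsometryEquiv.refl ℝ ℝ) e) k| =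
        |e k| := by
      intro k
      by_cases hk : k = i <;> simp [hk]
    apply le_antisymm
    · refine supNorm_le (supNorm_nonneg _) fun k => ?_
      rw [h]
      exact abs_coord_le_supNorm e k
    · refine supNorm_le (supNorm_nonneg _) fun k => ?_
      rw [← h k]
      exact abs_coord_le_supNorm _ k
  bound := by
    refine ⟨|a|, fun e he => ?_⟩
    have h1 := supNorm_le_norm e
    have h0 := supNorm_nonneg e
    rw [he] at h1
    rw [abs_mul, abs_of_nonneg (sq_nonneg (supNorm e))]
    have : supNorm e ^ 2 ≤ 1 := by nlinarith
    nlinarith [abs_nonneg a]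

theorem integral_inner_sq (hn : 1 ≤ n) (s : Vec n) :
    ∫ e, inner ℝ s e ^ 2 ∂sphereUniform n = ‖s‖ ^ 2 / n := by
  have := isProbabilityMeasure_sphereUniform hn
  simpa using symmWeight_one.integral_inner_sq hn s

/-- A spherical cap is small. -/
theorem sphereUniform_cap_le (hn : 1 ≤ n) {w : Vec n} (hw : ‖w‖ = 1) {t : ℝ} (ht : 0 ≤ t)
    (ht2 : t ^ 2 ≤ 1 / 2) :
    sphereUniform n {e | t ≤ inner ℝ w e} ≤ ENNReal.ofReal (Real.exp (-(n * t ^ 2 / 2))) := by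
  have := nontrivial_vec hn
  have hm : MeasurableSet {e : Vec n | t ≤ inner ℝ w e} := measurableSet_le (by fun_prop) (by fun_prop)
  rw [sphereUniform_apply hn hm]
  -- For `0 < r < 1` and `e` in the cap, `‖r e - t w‖² ≤ r² - 2 r t² + t²`, and `1 - t²` exceeds the
  -- right side by `(1 - r)(1 + r - 2 t²) ≥ 0`. So the cone over the cap fits into a ball of radius
  -- `√(1 - t²)`.
  have hsub : Ioo (0 : ℝ) 1 • (Metric.sphere (0 : Vec n) 1 ∩ {e | t ≤ inner ℝ w e}) ⊆
      Metric.closedBall (t • w) √(1 - t ^ 2) := by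
    rintro _ ⟨r, ⟨hr0, hr1⟩, e, ⟨he, het⟩, rfl⟩
    simp only [mem_sphere_iff_norm, sub_zero, mem_ofPred_eq] at he het
    rw [mem_closedBall_iff_norm]
    apply Real.le_sqrt_of_sq_le
    have : ‖r • e - t • w‖ ^ 2 = r ^ 2 - 2 * (r * t * inner ℝ w e) + t ^ 2 := by
      rw [norm_sub_sq_real, norm_smul, norm_smul, he, hw, inner_smul_left, inner_smul_right,
        real_inner_comm, mul_pow, mul_pow]
      simp
      ring
    change ‖r • e - t • w‖ ^ 2 ≤ _
    rw [this]
    have h1 : r * t * t ≤ r * t * inner ℝ w e := by gcongr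
    nlinarith [mul_nonneg hr0.le (sub_nonneg.2 hr1.le), mul_nonneg (sub_nonneg.2 hr1.le) (sub_nonneg.2 ht2)]
  have hball := Metric.measure_ball_pos (volume : Measure (Vec n)) 0 one_pos
  calc (volume (Metric.ball (0 : Vec n) 1))⁻¹ *
        volume (Ioo (0 : ℝ) 1 • (Metric.sphere (0 : Vec n) 1 ∩ {e | t ≤ inner ℝ w e}))
      ≤ (volume (Metric.ball (0 : Vec n) 1))⁻¹ *
        volume (Metric.closedBall (t • w) √(1 - t ^ 2)) := by gcongr
    _ = ENNReal.ofReal (√(1 - t ^ 2) ^ n) := by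
        rw [Measure.addHaar_closedBall _ _ (Real.sqrt_nonneg _), finrank_euclideanSpace_fin,
          mul_comm, mul_assoc, ENNReal.mul_inv_cancel hball.ne' measure_ball_lt_top.ne, mul_one]
    _ ≤ _ := by
        apply ENNReal.ofReal_le_ofReal
        have h1 : √(1 - t ^ 2) ≤ Real.exp (-(t ^ 2 / 2)) := by
          apply Real.sqrt_le_iff.2 ⟨(Real.exp_pos _).le, ?_⟩
          rw [← Real.exp_nat_mul]
          have := Real.add_one_le_exp (-t ^ 2)
          calc 1 - t ^ 2 ≤ Real.exp (-t ^ 2) := by linarith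
            _ = _ := by congr 1; push_cast; ring
        calc √(1 - t ^ 2) ^ n ≤ Real.exp (-(t ^ 2 / 2)) ^ n := by gcongr
          _ = _ := by rw [← Real.exp_nat_mul]; congr 1; ring

/-- At level `t² = 4 log n / n` each of the `2 n` coordinate caps has measure at most `n⁻²`, and off
their union `‖e‖_∞ ≤ t`. Hence the mean is at most `t² + 2 / n`. -/
theorem integral_supNorm_sq_le (hn : 1 ≤ n) :
    ∫ e, supNorm e ^ 2 ∂sphereUniform n ≤ 8 * (1 + Real.log n) / n := by
  have := isProbabilityMeasure_sphereUniform hn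
  have hn' : (1 : ℝ) ≤ n := by exact_mod_cast hn
  have hlog : 0 ≤ Real.log n := Real.log_nonneg hn'
  have hms : Measurable (supNorm : Vec n → ℝ) := continuous_supNorm.measurable
  have hle1 : ∀ e : Vec n, ‖e‖ = 1 → supNorm e ^ 2 ≤ 1 := fun e he => by
    have h1 := supNorm_le_norm e
    have h0 := supNorm_nonneg e
    rw [he] at h1
    nlinarith
  have hint : Integrable (fun e : Vec n => supNorm e ^ 2) (sphereUniform n) :=
    integrable_sphereUniform hn (by fun_prop) (c := 1) fun e he => by
      rw [abs_of_nonneg (sq_nonneg _)]; exact hle1 e he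
  -- The cap bound requires `t² ≤ 1 / 2`. If this fails, `8 log n / n > 1` and `‖e‖_∞ ≤ 1` suffices.
  by_cases hcase : 4 * Real.log n / n ≤ 1 / 2
  swap
  · calc ∫ e, supNorm e ^ 2 ∂sphereUniform n ≤ ∫ e, (1 : ℝ) ∂sphereUniform n := by
          refine integral_mono_ae hint (integrable_const _) ?_
          filter_upwards [ae_norm_eq_one] with e he using hle1 e he
      _ = 1 := by simp
      _ ≤ _ := by
        rw [not_le, div_lt_div_iff₀ (by norm_num) (by linarith)] at hcase
        rw [le_div_iff₀ (by linarith)]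
        linarith
  set t := √(4 * Real.log n / n) with ht
  have htsq : t ^ 2 = 4 * Real.log n / n := Real.sq_sqrt (by positivity)
  have ht0 : 0 ≤ t := Real.sqrt_nonneg _
  set cap : Fin n × Bool → Set (Vec n) := fun i =>
    {e | t ≤ inner ℝ (if i.2 then EuclideanSpace.single i.1 (1 : ℝ)
      else -EuclideanSpace.single i.1 (1 : ℝ)) e} with hcap
  have hcapm : ∀ i, MeasurableSet (cap i) := fun i =>
    measurableSet_le (by fun_prop) (by fun_prop)
  have hmeas : ∀ i, (sphereUniform n).real (cap i) ≤ 1 / (n : ℝ) ^ 2 := by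
    intro i
    have h := sphereUniform_cap_le hn (w := if i.2 then EuclideanSpace.single i.1 (1 : ℝ)
      else -EuclideanSpace.single i.1 (1 : ℝ)) (by split_ifs <;> simp) ht0 (htsq ▸ hcase)
    have h2 := ENNReal.toReal_le_of_le_ofReal (Real.exp_pos _).le h
    refine h2.trans (le_of_eq ?_)
    rw [htsq, show -((n : ℝ) * (4 * Real.log n / n) / 2) = -(Real.log n + Real.log n) by
      field_simp; ring, Real.exp_neg, Real.exp_add, Real.exp_log (by linarith)]
    field_simp
  have hpt : ∀ e : Vec n, ‖e‖ = 1 →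
      supNorm e ^ 2 ≤ t ^ 2 + ∑ i, (cap i).indicator (fun _ => (1 : ℝ)) e := by
    intro e he
    by_cases h : ∃ i, e ∈ cap i
    · obtain ⟨i, hi⟩ := h
      have h1 : (1 : ℝ) ≤ ∑ i, (cap i).indicator (fun _ => (1 : ℝ)) e := by
        refine le_trans ?_ (Finset.single_le_sum (f := fun i => (cap i).indicator (fun _ => (1 : ℝ)) e)
          (fun j _ => indicator_nonneg (by simp) _) (Finset.mem_univ i))
        simp [hi]
      nlinarith [hle1 e he, sq_nonneg t]
    · push Not at h
      have h1 : supNorm e ≤ t := by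
        refine supNorm_le ht0 fun i => ?_
        have ha := h (i, true)
        have hb := h (i, false)
        simp [hcap, EuclideanSpace.inner_single_left] at ha hb
        rw [abs_le]
        constructor <;> linarith
      have h2 : 0 ≤ ∑ i, (cap i).indicator (fun _ => (1 : ℝ)) e :=
        Finset.sum_nonneg fun j _ => indicator_nonneg (by simp) _
      have := supNorm_nonneg e
      nlinarith
  calc ∫ e, supNorm e ^ 2 ∂sphereUniform n
      ≤ ∫ e, (t ^ 2 + ∑ i, (cap i).indicator (fun _ => (1 : ℝ)) e) ∂sphereUniform n := by
        refine integral_mono_ae hint ((integrable_const _).add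
          (integrable_finsetSum _ fun i _ => (integrable_const _).indicator (hcapm i))) ?_
        filter_upwards [ae_norm_eq_one] with e he using hpt e he
    _ = t ^ 2 + ∑ i, (sphereUniform n).real (cap i) := by
        rw [integral_add (integrable_const _)
          (integrable_finsetSum _ fun i _ => (integrable_const _).indicator (hcapm i)),
          integral_finsetSum _ fun i _ => (integrable_const _).indicator (hcapm i)]
        simp [integral_indicator, hcapm]
    _ ≤ t ^ 2 + ∑ i : Fin n × Bool, 1 / (n : ℝ) ^ 2 := by
        gcongr with i _
        exact hmeas i
    _ = (4 * Real.log n + 2) / n := by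
        rw [htsq]
        simp
        field_simp
    _ ≤ _ := by
        gcongr
        linarith

/-! ### Smoothing of convex functions over balls -/
section Smoothing
open Filter Topology NNReal

/-- The Lipschitz cutoff that is `1` for `‖u‖ ≤ 1 - h` and `0` for `1 ≤ ‖u‖`. -/
def bump (h : ℝ) (u : Vec n) : ℝ := min 1 (max 0 ((1 - ‖u‖) / h))

theorem bump_nonneg (h : ℝ) (u : Vec n) : 0 ≤ bump h u := le_min zero_le_one (le_max_left _ _)

theorem bump_le_one (h : ℝ) (u : Vec n) : bump h u ≤ 1 := min_le_left _ _

theorem bump_neg (h : ℝ) (u : Vec n) : bump h (-u) = bump h u := by simp [bump]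

theorem bump_eq_zero {h : ℝ} (hh : 0 < h) {u : Vec n} (hu : 1 ≤ ‖u‖) : bump h u = 0 := by
  have : (1 - ‖u‖) / h ≤ 0 := div_nonpos_of_nonpos_of_nonneg (by linarith) hh.le
  simp [bump, max_eq_left this]

theorem bump_eq_one {h : ℝ} (hh : 0 < h) {u : Vec n} (hu : ‖u‖ ≤ 1 - h) : bump h u = 1 := by
  have : 1 ≤ (1 - ‖u‖) / h := by rw [le_div_iff₀ hh]; linarith
  simp [bump, this]

theorem bump_eq_of_mem {h : ℝ} (hh : 0 < h) {u : Vec n} (hu : ‖u‖ ∈ Ioo (1 - h) 1) :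
    bump h u = (1 - ‖u‖) / h := by
  have h1 : (1 - ‖u‖) / h ≤ 1 := by rw [div_le_one hh]; linarith [hu.1]
  have h2 : 0 ≤ (1 - ‖u‖) / h := div_nonneg (by linarith [hu.2]) hh.le
  simp [bump, h1, h2]

@[fun_prop]
theorem continuous_bump (h : ℝ) : Continuous (bump h : Vec n → ℝ) := by unfold bump; fun_prop

theorem hasCompactSupport_bump {h : ℝ} (hh : 0 < h) : HasCompactSupport (bump h : Vec n → ℝ) := by
  refine HasCompactSupport.of_support_subset_isCompact (isCompact_closedBall (0 : Vec n) 1) ?_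
  intro u hu
  by_contra hc
  simp only [Metric.mem_closedBall, dist_zero_right, not_le] at hc
  exact hu (bump_eq_zero hh hc.le)

theorem integrable_bump {h : ℝ} (hh : 0 < h) : Integrable (bump h : Vec n → ℝ) :=
  (continuous_bump h).integrable_of_hasCompactSupport (hasCompactSupport_bump hh)

theorem lipschitzWith_bump {h : ℝ} (hh : 0 < h) :
    LipschitzWith (Real.toNNReal h⁻¹) (bump h : Vec n → ℝ) := by
  refine LipschitzWith.of_dist_le_mul fun x y => ?_
  rw [Real.coe_toNNReal _ (inv_nonneg.2 hh.le), Real.dist_eq, bump, bump]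
  calc _ ≤ |max 0 ((1 - ‖x‖) / h) - max 0 ((1 - ‖y‖) / h)| := by
        simpa using abs_min_sub_min_le_max 1 (max 0 ((1 - ‖x‖) / h)) 1 (max 0 ((1 - ‖y‖) / h))
    _ ≤ |(1 - ‖x‖) / h - (1 - ‖y‖) / h| := by
        simpa using abs_max_sub_max_le_max 0 ((1 - ‖x‖) / h) 0 ((1 - ‖y‖) / h)
    _ = h⁻¹ * |‖y‖ - ‖x‖| := by
        rw [show (1 - ‖x‖) / h - (1 - ‖y‖) / h = h⁻¹ * (‖y‖ - ‖x‖) by ring, abs_mul,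
          abs_of_pos (inv_pos.2 hh)]
    _ ≤ h⁻¹ * dist x y := by
        rw [dist_comm, dist_eq_norm]
        gcongr
        exact abs_norm_sub_norm_le y x

/-- The indicator of the shell `1 - h < r < 1`. -/
def shell (h r : ℝ) : ℝ := (Ioo (1 - h) 1).indicator (fun _ => 1) r

/-- The cutoff falls linearly in `‖u‖` across the shell, where its gradient is `-u / (h ‖u‖)`, and
is locally constant elsewhere. The two bounding spheres are null sets. The direction `-v` is the one
that integration by parts produces. -/
theorem lineDeriv_bump {h : ℝ} (hh : 0 < h) (hh1 : h < 1) {u : Vec n} (h1 : ‖u‖ ≠ 1)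
    (h2 : ‖u‖ ≠ 1 - h) (v : Vec n) :
    lineDeriv ℝ (bump h) u (-v) = h⁻¹ * (shell h ‖u‖ * inner ℝ (‖u‖⁻¹ • u) v) := by
  rcases lt_or_gt_of_ne h2 with hlt | hgt
  · have : bump h =ᶠ[𝓝 u] fun _ => (1 : ℝ) := by
      filter_upwards [continuous_norm.continuousAt.eventually_lt_const hlt] with x hx
      exact bump_eq_one hh hx.le
    rw [this.lineDeriv_eq]
    simp only [lineDeriv, deriv_const]
    simp [shell, indicator, not_lt.2 hlt.le]
  rcases lt_or_gt_of_ne h1 with hlt1 | hgt1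
  swap
  · have : bump h =ᶠ[𝓝 u] fun _ => (0 : ℝ) := by
      filter_upwards [continuous_norm.continuousAt.eventually_const_lt hgt1] with x hx
      exact bump_eq_zero hh hx.le
    rw [this.lineDeriv_eq]
    simp only [lineDeriv, deriv_const]
    simp [shell, indicator, not_lt.2 hgt1.le]
  have hu0 : 0 < ‖u‖ := by linarith
  have : bump h =ᶠ[𝓝 u] fun x => (1 - ‖x‖) / h := by
    filter_upwards [continuous_norm.continuousAt.eventually_lt_const hlt1,
      continuous_norm.continuousAt.eventually_const_lt hgt] with x hx hx'
    exact bump_eq_of_mem hh ⟨hx', hx⟩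
  rw [this.lineDeriv_eq]
  have hd : HasLineDerivAt ℝ (fun x : Vec n => (1 - ‖x‖) / h)
      (h⁻¹ * (shell h ‖u‖ * inner ℝ (‖u‖⁻¹ • u) v)) u (-v) := by
    have hl : HasDerivAt (fun t : ℝ => u + t • (-v)) (-v) 0 := by
      simpa using ((hasDerivAt_id (0 : ℝ)).smul_const (-v)).const_add u
    have hs := hl.norm_sq.sqrt (by simpa using hu0.ne')
    simp only [Real.sqrt_sq (norm_nonneg _)] at hs
    have := (hs.const_sub 1).div_const h
    unfold HasLineDerivAt
    refine this.congr_deriv ?_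
    have hsh : shell h ‖u‖ = 1 := by simp [shell, hgt, hlt1]
    rw [hsh]
    simp [inner_smul_left]
    field_simp
  exact hd.lineDeriv

/-- Integration by parts against the cutoff. As `h → 0` the right side becomes the flux of `g v`
through the unit sphere, so this replaces the divergence theorem for functions that are merely
Lipschitz. -/
theorem integral_lineDeriv_mul_bump (hn : 1 ≤ n) {h : ℝ} (hh : 0 < h) (hh1 : h < 1)
    {g : Vec n → ℝ} {L : ℝ≥0} (hg : LipschitzWith L g) (v : Vec n) :
    ∫ u, lineDeriv ℝ g u v * bump h u =
      h⁻¹ * ∫ u, shell h ‖u‖ * (inner ℝ (‖u‖⁻¹ • u) v * g u) := by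
  have := nontrivial_vec hn
  rw [hg.integral_lineDeriv_mul_eq (lipschitzWith_bump hh) (hasCompactSupport_bump hh) v,
    ← integral_const_mul]
  refine integral_congr_ae ?_
  have e1 : ∀ᵐ u : Vec n, u ∉ Metric.sphere (0 : Vec n) 1 :=
    measure_eq_zero_iff_ae_notMem.1 (Measure.addHaar_sphere _ _ _)
  have e2 : ∀ᵐ u : Vec n, u ∉ Metric.sphere (0 : Vec n) (1 - h) :=
    measure_eq_zero_iff_ae_notMem.1 (Measure.addHaar_sphere _ _ _)
  filter_upwards [e1, e2] with u h1 h2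
  simp only [mem_sphere_iff_norm, sub_zero] at h1 h2
  rw [lineDeriv_bump hh hh1 h1 h2]
  ring

theorem integral_shell {h : ℝ} (hh : 0 < h) (hh1 : h < 1) :
    ∫ u : Vec n, shell h ‖u‖ =
      volume.real (Metric.ball (0 : Vec n) 1) * (1 - (1 - h) ^ n) := by
  have hs : ∀ u : Vec n, shell h ‖u‖ =
      (Metric.ball (0 : Vec n) 1 \ Metric.closedBall (0 : Vec n) (1 - h)).indicator
        (fun _ => (1 : ℝ)) u := by
    intro u
    simp [shell, indicator, and_comm]
  simp_rw [hs]
  rw [integral_indicator_const _ (measurableSet_ball.diff measurableSet_closedBall), smul_eq_mul,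
    mul_one, measureReal_sdiff (Metric.closedBall_subset_ball (by linarith)) measurableSet_closedBall
      measure_ball_lt_top.ne, Measure.addHaar_real_closedBall _ _ (by linarith),
    finrank_euclideanSpace_fin]
  ring

theorem shell_nonneg (h r : ℝ) : 0 ≤ shell h r := indicator_nonneg (by simp) _

@[fun_prop]
theorem measurable_shell (h : ℝ) : Measurable (shell h) :=
  measurable_const.indicator measurableSet_Ioo

theorem integrable_shell (h : ℝ) : Integrable (fun u : Vec n => shell h ‖u‖) := by
  have hs : ∀ u : Vec n, shell h ‖u‖ =
      (Metric.ball (0 : Vec n) 1 \ Metric.closedBall (0 : Vec n) (1 - h)).indicator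
        (fun _ => (1 : ℝ)) u := by
    intro u
    simp [shell, indicator, and_comm]
  simp_rw [hs]
  refine (integrable_indicator_iff (measurableSet_ball.diff measurableSet_closedBall)).2 ?_
  refine (integrableOn_const_iff).2 (Or.inr ?_)
  exact (measure_mono sdiff_subset).trans_lt measure_ball_lt_top

theorem integral_bump_bounds {h : ℝ} (hh : 0 < h) (hh1 : h < 1) :
    volume.real (Metric.ball (0 : Vec n) 1) * (1 - h) ^ n ≤ ∫ u : Vec n, bump h u ∧
      ∫ u : Vec n, bump h u ≤ volume.real (Metric.ball (0 : Vec n) 1) := by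
  constructor
  · calc _ = ∫ u : Vec n, (Metric.closedBall (0 : Vec n) (1 - h)).indicator (fun _ => (1 : ℝ)) u := by
          rw [integral_indicator_const _ measurableSet_closedBall, smul_eq_mul, mul_one,
            Measure.addHaar_real_closedBall _ _ (by linarith), finrank_euclideanSpace_fin]
          ring
      _ ≤ _ := by
          refine integral_mono ?_ (integrable_bump hh) fun u => ?_
          · refine (integrable_indicator_iff measurableSet_closedBall).2 ?_
            exact (integrableOn_const_iff).2 (Or.inr measure_closedBall_lt_top)
          · refine indicator_le' (fun x hx => ?_) (fun x _ => bump_nonneg h x) u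
            rw [bump_eq_one hh (by simpa using hx)]
  · calc _ ≤ ∫ u : Vec n, (Metric.ball (0 : Vec n) 1).indicator (fun _ => (1 : ℝ)) u := by
          refine integral_mono (integrable_bump hh) ?_ fun u => ?_
          · refine (integrable_indicator_iff measurableSet_ball).2 ?_
            exact (integrableOn_const_iff).2 (Or.inr measure_ball_lt_top)
          · by_cases hu : u ∈ Metric.ball (0 : Vec n) 1
            · simp [hu, bump_le_one]
            · rw [bump_eq_zero hh (by simpa using hu)]
              simp [hu]
      _ = _ := by
          rw [integral_indicator_const _ measurableSet_ball, smul_eq_mul, mul_one]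

/-- If the derivative of a Lipschitz function in the direction `v` is bounded above by `w` in the
unit ball and the mean of `w` over balls is at most `β`, then so is the flux `n E [g(e) ⟨e, v⟩]`. -/
theorem sphere_flux_le (hn : 1 ≤ n) {g : Vec n → ℝ} {L : ℝ≥0} (hg : LipschitzWith L g)
    (v : Vec n) {w : Vec n → ℝ} (hw : Continuous w) {β κ : ℝ}
    (hβ : ∀ u ∈ Metric.ball (0 : Vec n) 1, w u + w (-u) ≤ 2 * β)
    (hderiv : ∀ u ∈ Metric.ball (0 : Vec n) 1, ∀ t ∈ Ioo (0 : ℝ) 1,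
      u + t • v ∈ Metric.ball (0 : Vec n) 1 → g (u + t • v) ≤ g u + t * w u + t ^ 2 * κ) :
    n * ∫ e, g e * inner ℝ e v ∂sphereUniform n ≤ β := by
  have := nontrivial_vec hn
  set c := ∫ e, g e * inner ℝ e v ∂sphereUniform n with hc
  set V := volume.real (Metric.ball (0 : Vec n) 1) with hV
  have hVpos : 0 < V :=
    ENNReal.toReal_pos (Metric.measure_ball_pos _ _ one_pos).ne' measure_ball_lt_top.ne
  -- The finite-step hypothesis is divided by `t`; the term with `κ` disappears as `t → 0`.
  have hlin : ∀ u ∈ Metric.ball (0 : Vec n) 1, LineDifferentiableAt ℝ g u v →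
      lineDeriv ℝ g u v ≤ w u := by
    intro u hu hd
    have h1 := hd.hasLineDerivAt.tendsto_slope_zero_right
    have h2 : Tendsto (fun t : ℝ => w u + t * κ) (𝓝[>] 0) (𝓝 (w u + 0 * κ)) :=
      (((continuous_id.mul continuous_const).const_add (w u)).tendsto 0).mono_left
        nhdsWithin_le_nhds
    rw [zero_mul, add_zero] at h2
    refine le_of_tendsto_of_tendsto h1 h2 ?_
    have hball : ∀ᶠ t : ℝ in 𝓝[>] 0, u + t • v ∈ Metric.ball (0 : Vec n) 1 := by
      have : ContinuousAt (fun t : ℝ => u + t • v) 0 := by fun_prop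
      exact (this.eventually_mem (Metric.isOpen_ball.mem_nhds (by simpa using hu))).filter_mono
        nhdsWithin_le_nhds
    filter_upwards [hball, Ioo_mem_nhdsGT (zero_lt_one (α := ℝ))] with t ht ht1
    have := hderiv u hu t ht1 ht
    have htpos := ht1.1
    rw [smul_eq_mul, inv_mul_le_iff₀ htpos]
    nlinarith
  have hineq : ∀ h ∈ Ioo (0 : ℝ) 1, V * (h⁻¹ * (1 - (1 - h) ^ n)) * (c - L * h * ‖v‖) ≤
      β * ∫ u : Vec n, bump h u := by
    intro h ⟨hh, hh1⟩
    have hA : ∫ u, lineDeriv ℝ g u v * bump h u ≤ β * ∫ u : Vec n, bump h u := by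
      have hwint : Integrable (fun u => w u * bump h u) :=
        (hw.mul (continuous_bump h)).integrable_of_hasCompactSupport
          (hasCompactSupport_bump hh).mul_left
      have h1 : ∫ u, lineDeriv ℝ g u v * bump h u ≤ ∫ u, w u * bump h u := by
        refine integral_mono_ae ?_ hwint ?_
        · exact (integrable_bump hh).bdd_mul (hg.memLp_lineDeriv v).1
            (.of_forall fun u => norm_lineDeriv_le_of_lipschitz ℝ hg)
        · filter_upwards [hg.ae_lineDifferentiableAt (μ := volume) v] with u hu
          by_cases hub : u ∈ Metric.ball (0 : Vec n) 1
          · exact mul_le_mul_of_nonneg_right (hlin u hub hu) (bump_nonneg h u)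
          · rw [bump_eq_zero hh (by simpa using hub)]
            simp
      -- Since the cutoff is even, only the even part of `w` counts. This is why `hβ` bounds `w u +
      -- w (-u)` and not `w u`.
      have h2 : ∫ u, w (-u) * bump h u = ∫ u, w u * bump h u := by
        rw [← integral_neg_eq_self (fun u => w u * bump h u)]
        simp [bump_neg]
      have hwint' : Integrable (fun u => w (-u) * bump h u) :=
        ((hw.comp continuous_neg).mul (continuous_bump h)).integrable_of_hasCompactSupport
          (hasCompactSupport_bump hh).mul_left
      have h3 : ∫ u, w u * bump h u + w (-u) * bump h u ≤ ∫ u : Vec n, 2 * β * bump h u := by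
        refine integral_mono (hwint.add hwint') ((integrable_bump hh).const_mul _) fun u => ?_
        by_cases hub : u ∈ Metric.ball (0 : Vec n) 1
        · have := hβ u hub
          have := bump_nonneg h u
          simp only
          nlinarith
        · simp [bump_eq_zero hh (show 1 ≤ ‖u‖ by simpa using hub)]
      rw [integral_add hwint hwint', h2, integral_const_mul] at h3
      linarith
    rw [integral_lineDeriv_mul_bump hn hh hh1 hg] at hA
    have hpol := integral_radial_mul_angular hn (shell h) (fun e => g e * inner ℝ e v)
    rw [integral_shell hh hh1, ← hc, ← hV] at hpol
    have hcont1 : Measurable fun u : Vec n => g (‖u‖⁻¹ • u) :=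
      hg.continuous.measurable.comp (by fun_prop)
    have hcs : ∀ u : Vec n, |inner ℝ (‖u‖⁻¹ • u) v| ≤ ‖v‖ := by
      intro u
      refine (abs_real_inner_le_norm _ _).trans ?_
      have : ‖‖u‖⁻¹ • u‖ ≤ 1 := by
        rw [norm_smul, norm_inv, norm_norm]
        exact inv_mul_le_one
      nlinarith [norm_nonneg v]
    have hgl : ∀ x y, |g x - g y| ≤ L * ‖x - y‖ := fun x y => by
      simpa [Real.dist_eq, dist_eq_norm] using hg.dist_le_mul x y
    have hub : ∀ u : Vec n, shell h ‖u‖ * |g u| ≤ shell h ‖u‖ * (|g 0| + L) := by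
      intro u
      by_cases hu : ‖u‖ ∈ Ioo (1 - h) 1
      · refine mul_le_mul_of_nonneg_left ?_ (shell_nonneg _ _)
        have h1 := hgl u 0
        rw [sub_zero] at h1
        have h2 : (L : ℝ) * ‖u‖ ≤ L := mul_le_of_le_one_right L.2 hu.2.le
        have := abs_sub_abs_le_abs_sub (g u) (g 0)
        linarith
      · simp [shell, hu]
    -- Inside the shell, `u` and `u / ‖u‖` are within distance `h`. Passing from `g u` to an angular
    -- function costs `L h ‖v‖`, which vanishes in the limit.
    have hd : ∀ u : Vec n, shell h ‖u‖ * (g (‖u‖⁻¹ • u) * inner ℝ (‖u‖⁻¹ • u) v) -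
        shell h ‖u‖ * (L * h * ‖v‖) ≤ shell h ‖u‖ * (inner ℝ (‖u‖⁻¹ • u) v * g u) := by
      intro u
      by_cases hu : ‖u‖ ∈ Ioo (1 - h) 1
      · have h1 := hgl (‖u‖⁻¹ • u) u
        have hu0 : 0 < ‖u‖ := by linarith [hu.1]
        have h2 : ‖‖u‖⁻¹ • u - u‖ ≤ h := by
          have : ‖u‖⁻¹ • u - u = (‖u‖⁻¹ - 1) • u := by rw [sub_smul, one_smul]
          rw [this, norm_smul, Real.norm_eq_abs, abs_of_nonneg, sub_mul, inv_mul_cancel₀ hu0.ne']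
          · linarith [hu.1]
          · rw [sub_nonneg]; exact (one_le_inv₀ hu0).2 hu.2.le
        have h3 : |g (‖u‖⁻¹ • u) - g u| * |inner ℝ (‖u‖⁻¹ • u) v| ≤ L * h * ‖v‖ := by
          refine mul_le_mul (h1.trans ?_) (hcs u) (abs_nonneg _) (by positivity)
          gcongr
        rw [← abs_mul] at h3
        have h4 := le_of_abs_le h3
        rw [sub_mul] at h4
        simp only [shell, hu, indicator_of_mem, one_mul]
        linarith
      · simp [shell, hu]
    have hint1 : Integrable (fun u : Vec n => shell h ‖u‖ * (inner ℝ (‖u‖⁻¹ • u) v * g u)) := by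
      have hgm := hg.continuous.measurable
      refine Integrable.mono' ((integrable_shell h).mul_const ((|g 0| + L) * ‖v‖))
        (Measurable.aestronglyMeasurable (by fun_prop)) (.of_forall fun u => ?_)
      rw [Real.norm_eq_abs, abs_mul, abs_mul, abs_of_nonneg (shell_nonneg _ _)]
      have h1 := hub u
      have h2 := mul_le_mul h1 (hcs u) (abs_nonneg _)
        (mul_nonneg (shell_nonneg _ _) (by positivity))
      nlinarith
    have hcp : ∀ u : Vec n, |g (‖u‖⁻¹ • u)| ≤ |g 0| + L := by
      intro u
      have h1 := hgl (‖u‖⁻¹ • u) 0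
      rw [sub_zero] at h1
      have : ‖‖u‖⁻¹ • u‖ ≤ 1 := by
        rw [norm_smul, norm_inv, norm_norm]
        exact inv_mul_le_one
      have h2 : (L : ℝ) * ‖‖u‖⁻¹ • u‖ ≤ L := mul_le_of_le_one_right L.2 this
      have := abs_sub_abs_le_abs_sub (g (‖u‖⁻¹ • u)) (g 0)
      linarith
    have hint2 : Integrable (fun u : Vec n =>
        shell h ‖u‖ * (g (‖u‖⁻¹ • u) * inner ℝ (‖u‖⁻¹ • u) v)) := by
      refine Integrable.mono' ((integrable_shell h).mul_const ((|g 0| + L) * ‖v‖))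
        (((measurable_shell h).comp measurable_norm).mul
          (hcont1.mul (by fun_prop))).aestronglyMeasurable (.of_forall fun u => ?_)
      rw [Real.norm_eq_abs, abs_mul, abs_mul, abs_of_nonneg (shell_nonneg _ _)]
      have h2 := mul_le_mul (hcp u) (hcs u) (abs_nonneg _) (by positivity)
      exact mul_le_mul_of_nonneg_left h2 (shell_nonneg _ _)
    have hint3 := (integrable_shell (n := n) h).mul_const (L * h * ‖v‖)
    have hmono := integral_mono (hint2.sub hint3) hint1 hd
    simp only [Pi.sub_apply] at hmono
    rw [integral_sub hint2 hint3, hpol, integral_mul_const, integral_shell hh hh1, ← hV] at hmono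
    calc _ = h⁻¹ * (V * (1 - (1 - h) ^ n) * c - V * (1 - (1 - h) ^ n) * (L * h * ‖v‖)) := by ring
      _ ≤ _ := mul_le_mul_of_nonneg_left hmono (inv_nonneg.2 hh.le)
      _ ≤ _ := hA
  have hX : Tendsto (fun h : ℝ => ∫ u : Vec n, bump h u) (𝓝[>] 0) (𝓝 V) := by
    have h1 : Tendsto (fun h : ℝ => V * (1 - h) ^ n) (𝓝[>] 0) (𝓝 V) := by
      have : Continuous (fun h : ℝ => V * (1 - h) ^ n) := by fun_prop
      simpa using (this.tendsto 0).mono_left nhdsWithin_le_nhds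
    refine tendsto_of_tendsto_of_tendsto_of_le_of_le' h1 tendsto_const_nhds ?_ ?_
    · filter_upwards [Ioo_mem_nhdsGT (zero_lt_one (α := ℝ))] with h hh
      exact (integral_bump_bounds hh.1 hh.2).1
    · filter_upwards [Ioo_mem_nhdsGT (zero_lt_one (α := ℝ))] with h hh
      exact (integral_bump_bounds hh.1 hh.2).2
  -- The shell has volume `V (1 - (1 - h) ^ n)`. Divided by `h` it tends to `n V`, the surface of
  -- the sphere; this is the factor `n` in the conclusion.
  have hI : Tendsto (fun h : ℝ => h⁻¹ * (1 - (1 - h) ^ n)) (𝓝[>] 0) (𝓝 n) := by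
    have h1 : HasDerivAt (fun h : ℝ => 1 - (1 - h) ^ n) (n : ℝ) 0 := by
      have := (((hasDerivAt_id (0 : ℝ)).const_sub 1).pow n).const_sub 1
      simpa using this
    have := h1.tendsto_slope_zero_right
    simpa using this
  have hJ : Tendsto (fun h : ℝ => c - L * h * ‖v‖) (𝓝[>] 0) (𝓝 c) := by
    have : Continuous (fun h : ℝ => c - L * h * ‖v‖) := by fun_prop
    simpa using (this.tendsto 0).mono_left nhdsWithin_le_nhds
  have hfin := le_of_tendsto_of_tendsto ((hI.const_mul V).mul hJ) (hX.const_mul β)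
    (by filter_upwards [Ioo_mem_nhdsGT (zero_lt_one (α := ℝ))] with h hh using hineq h hh)
  have : V * (n * c) ≤ V * β := by linarith
  exact le_of_mul_le_mul_left this hVpos

/-- The spherical average of `(n / μ) f(x + μ e) e` is an approximate subgradient of a (strongly)
convex function `f` at `x`. -/
theorem smoothing_inequality (hn : 1 ≤ n) {S : Set (Vec n)} {f : Vec n → ℝ} {γ : ℝ}
    (hγ : 0 ≤ γ) (hf : StrongConvexOn S γ f) {x y : Vec n} {μ : ℝ} (hμ : 0 < μ)
    (hx : Metric.closedBall x μ ⊆ S) (hy : Metric.closedBall y μ ⊆ S) {Lx Ly : ℝ≥0}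
    (hLx : LipschitzOnWith Lx f (Metric.closedBall x μ))
    (hLy : LipschitzOnWith Ly f (Metric.closedBall y μ)) {b : ℝ}
    (hb : ∀ u : Vec n, ‖u‖ ≤ 1 → f (y + μ • u) + f (y + μ • (-u)) ≤ 2 * (f y + b)) :
    n / μ * ∫ e, f (x + μ • e) * inner ℝ e (y - x) ∂sphereUniform n ≤
      f y - f x + b - γ / 2 * ‖y - x‖ ^ 2 := by
  have hconv : ∀ z ∈ S, ∀ z' ∈ S, ∀ s t : ℝ, 0 ≤ s → 0 ≤ t → s + t = 1 →
      f (s • z + t • z') ≤ s * f z + t * f z' - s * t * (γ / 2 * ‖z - z'‖ ^ 2) :=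
    fun z hz z' hz' s t hs ht hst => And.right hf hz hz' hs ht hst
  -- `f` is Lipschitz only on the two balls, while `sphere_flux_le` takes globally Lipschitz
  -- functions. Extensions do, since only values on the balls enter.
  obtain ⟨gx, hgx, hgxe⟩ := hLx.extend_real
  obtain ⟨gy, hgy, hgye⟩ := hLy.extend_real
  have hmem : ∀ z u : Vec n, ‖u‖ ≤ 1 → z + μ • u ∈ Metric.closedBall z μ := by
    intro z u hu
    rw [mem_closedBall_iff_norm, add_sub_cancel_left, norm_smul, Real.norm_of_nonneg hμ.le]
    nlinarith
  have hgx' : ∀ u, ‖u‖ ≤ 1 → gx (x + μ • u) = f (x + μ • u) := fun u hu =>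
    (hgxe (hmem x u hu)).symm
  have hgy' : ∀ u, ‖u‖ ≤ 1 → gy (y + μ • u) = f (y + μ • u) := fun u hu =>
    (hgye (hmem y u hu)).symm
  have hsub : LipschitzWith (Real.toNNReal μ) (fun u : Vec n => x + μ • u) := by
    refine LipschitzWith.of_dist_le_mul fun u v => ?_
    rw [dist_add_left, dist_smul₀, Real.norm_eq_abs, abs_of_pos hμ, Real.coe_toNNReal _ hμ.le]
  -- Moving `u` by `t v` with `v = (y - x) / μ` moves `x + μ u` the fraction `t` of the way to `y +
  -- μ u`. Strong convexity along this segment supplies `w`, and `κ` is what remains of `t (1 - t) =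
  -- t - t²`.
  have h := sphere_flux_le hn (hgx.comp hsub) (μ⁻¹ • (y - x))
    (w := fun u => gy (y + μ • u) - gx (x + μ • u) - γ / 2 * ‖y - x‖ ^ 2)
    (by have := hgx.continuous; have := hgy.continuous; fun_prop)
    (β := f y - f x + b - γ / 2 * ‖y - x‖ ^ 2) (κ := γ / 2 * ‖y - x‖ ^ 2) ?_ ?_
  · have e1 : ∫ e, (gx ∘ fun u => x + μ • u) e * inner ℝ e (μ⁻¹ • (y - x)) ∂sphereUniform n =
        μ⁻¹ * ∫ e, f (x + μ • e) * inner ℝ e (y - x) ∂sphereUniform n := by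
      rw [← integral_const_mul]
      refine integral_congr_ae ?_
      filter_upwards [ae_norm_eq_one] with e he
      rw [Function.comp_apply, hgx' e he.le, inner_smul_right]
      ring
    rw [e1, ← mul_assoc] at h
    exact h
  · intro u hu
    have hu1 : ‖u‖ ≤ 1 := by simpa using (mem_ball_zero_iff.1 hu).le
    have hu2 : ‖-u‖ ≤ 1 := by rwa [norm_neg]
    simp only [hgx' u hu1, hgx' _ hu2, hgy' u hu1, hgy' _ hu2]
    have h1 := hb u hu1
    -- Midpoint convexity: averaging cannot lower `f` at `x`, so the defect `b` arises at `y` only.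
    have h2 := hconv _ (hx (hmem x u hu1)) _ (hx (hmem x _ hu2)) (1 / 2) (1 / 2)
      (by norm_num) (by norm_num) (by norm_num)
    have h3 : (1 / 2 : ℝ) • (x + μ • u) + (1 / 2 : ℝ) • (x + μ • (-u)) = x := by module
    rw [h3] at h2
    have h4 : 0 ≤ γ / 2 * ‖x + μ • u - (x + μ • (-u))‖ ^ 2 := by positivity
    linarith
  · intro u hu t ht hut
    have hu1 : ‖u‖ ≤ 1 := (mem_ball_zero_iff.1 hu).le
    have hut1 := (mem_ball_zero_iff.1 hut).le
    simp only [Function.comp_apply, hgx' u hu1, hgx' _ hut1, hgy' u hu1]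
    have h2 := hconv _ (hx (hmem x u hu1)) _ (hy (hmem y u hu1)) (1 - t) t
      (by linarith [ht.2]) ht.1.le (by ring)
    have h3 : (1 - t) • (x + μ • u) + t • (y + μ • u) = x + μ • (u + t • μ⁻¹ • (y - x)) := by
      have : μ • (t • μ⁻¹ • (y - x)) = t • (y - x) := by
        rw [smul_comm μ t, smul_smul μ, mul_inv_cancel₀ hμ.ne', one_smul]
      rw [smul_add μ u, this]
      module
    have h5 : ‖x + μ • u - (y + μ • u)‖ = ‖y - x‖ := by
      rw [add_sub_add_right_eq_sub, norm_sub_rev]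
    rw [h3, h5] at h2
    nlinarith

end Smoothing

/-! ### `l_p`-norms -/

theorem lNorm_nonneg (p : ℝ) (x : Vec n) : 0 ≤ lNorm p x :=
  Real.rpow_nonneg (Finset.sum_nonneg fun _ _ => Real.rpow_nonneg (abs_nonneg _) _) _

theorem lNorm_two (x : Vec n) : lNorm 2 x = ‖x‖ := by
  rw [lNorm, EuclideanSpace.norm_eq, Real.sqrt_eq_rpow]
  simp

theorem lNorm_sub_comm (p : ℝ) (x y : Vec n) : lNorm p (x - y) = lNorm p (y - x) := by
  simp [lNorm, abs_sub_comm]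

theorem lNorm_smul {p : ℝ} (hp : 1 ≤ p) (t : ℝ) (x : Vec n) :
    lNorm p (t • x) = |t| * lNorm p x := by
  have : ∀ i, |(t • x) i| ^ p = |t| ^ p * |x i| ^ p := fun i => by
    rw [PiLp.smul_apply, smul_eq_mul, abs_mul, Real.mul_rpow (abs_nonneg _) (abs_nonneg _)]
  rw [lNorm, Finset.sum_congr rfl fun i _ => this i, ← Finset.mul_sum,
    Real.mul_rpow (by positivity) (Finset.sum_nonneg fun i _ => by positivity), ← Real.rpow_mul
    (abs_nonneg _), mul_one_div_cancel (by linarith), Real.rpow_one, lNorm]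

/-- Each `|x i|` is at most `‖x‖_p`, hence `x i ^ 2 ≤ |x i| ^ p ‖x‖_p ^ (2 - p)`, and one sums over
`i`. -/
theorem norm_le_lNorm {p : ℝ} (hp : 1 ≤ p) (hp2 : p ≤ 2) (x : Vec n) : ‖x‖ ≤ lNorm p x := by
  have hp0 : 0 < p := by linarith
  set s := ∑ i, |x i| ^ p with hs
  have hs0 : 0 ≤ s := Finset.sum_nonneg fun i _ => by positivity
  have hi : ∀ i, |x i| ≤ s ^ (1 / p) := by
    intro i
    have : |x i| ^ p ≤ s := Finset.single_le_sum (f := fun i => |x i| ^ p)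
      (fun j _ => by positivity) (Finset.mem_univ i)
    calc |x i| = (|x i| ^ p) ^ (1 / p) := by
          rw [← Real.rpow_mul (abs_nonneg _), mul_one_div_cancel hp0.ne', Real.rpow_one]
      _ ≤ _ := Real.rpow_le_rpow (by positivity) this (by positivity)
  apply le_of_sq_le_sq _ (lNorm_nonneg p x)
  calc ‖x‖ ^ 2 = ∑ i, |x i| ^ p * |x i| ^ (2 - p) := by
        rw [EuclideanSpace.real_norm_sq_eq]
        refine Finset.sum_congr rfl fun i _ => ?_
        rcases eq_or_ne (x i) 0 with h | h
        · simp [h, hp0.ne']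
        · rw [← Real.rpow_add (abs_pos.2 h)]
          simp
    _ ≤ ∑ i, |x i| ^ p * (s ^ (1 / p)) ^ (2 - p) := by
        refine Finset.sum_le_sum fun i _ => ?_
        have := Real.rpow_le_rpow (abs_nonneg _) (hi i) (show 0 ≤ 2 - p by linarith)
        gcongr
    _ = s * (s ^ (1 / p)) ^ (2 - p) := by rw [← Finset.sum_mul]
    _ = (s ^ (1 / p)) ^ p * (s ^ (1 / p)) ^ (2 - p) := by
        rw [← Real.rpow_mul hs0 (1 / p) p, one_div_mul_cancel hp0.ne', Real.rpow_one]
    _ = lNorm p x ^ 2 := by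
        rw [← Real.rpow_add' (by positivity) (by norm_num)]
        simp [lNorm, hs]

/-- The power mean inequality with exponent `2 / p` for the numbers `|x i| ^ p`. -/
theorem lNorm_sq_le {p : ℝ} (hp : 1 ≤ p) (hp2 : p ≤ 2) (x : Vec n) :
    lNorm p x ^ 2 ≤ (n : ℝ) ^ (2 / p - 1) * ‖x‖ ^ 2 := by
  have hp0 : 0 < p := by linarith
  have h := Real.rpow_sum_le_const_mul_sum_rpow Finset.univ (fun i => |x i| ^ p)
    (show 1 ≤ 2 / p by rw [le_div_iff₀ hp0]; linarith)
  have hab : ∀ i, |(|x i| ^ p)| = |x i| ^ p := fun i => abs_of_nonneg (by positivity)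
  simp only [hab] at h
  have h2 : ∀ i, (|x i| ^ p) ^ (2 / p) = x i ^ 2 := fun i => by
    rw [← Real.rpow_mul (abs_nonneg _), mul_div_cancel₀ _ hp0.ne']
    simp
  simp only [h2, Finset.card_univ, Fintype.card_fin] at h
  rw [EuclideanSpace.real_norm_sq_eq]
  refine le_trans (le_of_eq ?_) h
  rw [lNorm, ← Real.rpow_natCast, ← Real.rpow_mul (Finset.sum_nonneg fun i _ => by positivity)]
  congr 1
  push_cast; ring

/-- A bound for the norm dual to the `l_p`-norm. -/
def dualBound (p : ℝ) (g : Vec n) : ℝ := (n : ℝ) ^ (1 - 1 / p) * supNorm g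

theorem dualBound_nonneg (p : ℝ) (g : Vec n) : 0 ≤ dualBound p g :=
  mul_nonneg (by positivity) (supNorm_nonneg g)

/-- Hölder for the pair `(∞, 1)`, followed by the power mean bound `‖x‖_1 ≤ n ^ (1 - 1 / p) ‖x‖_p`.
-/
theorem inner_le_dualBound {p : ℝ} (hp : 1 ≤ p) (g x : Vec n) :
    inner ℝ g x ≤ dualBound p g * lNorm p x := by
  have hp0 : 0 < p := by linarith
  have h := Real.rpow_sum_le_const_mul_sum_rpow Finset.univ (fun i => x i) hp
  simp only [Finset.card_univ, Fintype.card_fin] at h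
  have hs0 : 0 ≤ ∑ i, |x i| := Finset.sum_nonneg fun i _ => abs_nonneg _
  have h1 : ∑ i, |x i| ≤ (n : ℝ) ^ (1 - 1 / p) * lNorm p x := by
    calc ∑ i, |x i| = ((∑ i, |x i|) ^ p) ^ (1 / p) := by
          rw [← Real.rpow_mul hs0, mul_one_div_cancel hp0.ne', Real.rpow_one]
      _ ≤ ((n : ℝ) ^ (p - 1) * ∑ i, |x i| ^ p) ^ (1 / p) :=
          Real.rpow_le_rpow (by positivity) h (by positivity)
      _ = _ := by
          rw [Real.mul_rpow (by positivity) (Finset.sum_nonneg fun i _ => by positivity), lNorm,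
            ← Real.rpow_mul (by positivity)]
          congr 2
          field_simp
  calc inner ℝ g x = ∑ i, x i * g i := by simp [PiLp.inner_apply]
    _ ≤ ∑ i, supNorm g * |x i| := by
        refine Finset.sum_le_sum fun i _ => ?_
        refine (le_abs_self _).trans ?_
        rw [abs_mul, mul_comm]
        gcongr
        exact abs_coord_le_supNorm g i
    _ = supNorm g * ∑ i, |x i| := by rw [Finset.mul_sum]
    _ ≤ supNorm g * ((n : ℝ) ^ (1 - 1 / p) * lNorm p x) := by
        gcongr
        exact supNorm_nonneg g
    _ = _ := by rw [dualBound]; ring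

theorem dualBound_smul (p t : ℝ) (x : Vec n) : dualBound p (t • x) = |t| * dualBound p x := by
  rw [dualBound, supNorm_smul, dualBound]; ring

theorem dualBound_sub_sq_le (p : ℝ) (x y : Vec n) :
    dualBound p (x - y) ^ 2 ≤ 2 * dualBound p x ^ 2 + 2 * dualBound p y ^ 2 := by
  have h : dualBound p (x - y) ≤ dualBound p x + dualBound p y := by
    have h1 := supNorm_add_le x ((-1 : ℝ) • y)
    rw [supNorm_smul, neg_one_smul, ← sub_eq_add_neg] at h1
    simp only [abs_neg, abs_one, one_mul] at h1
    rw [dualBound, dualBound, dualBound, ← mul_add]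
    gcongr
  have := dualBound_nonneg p (x - y)
  nlinarith [sq_nonneg (dualBound p x - dualBound p y)]

@[fun_prop]
theorem continuous_dualBound (p : ℝ) : Continuous (dualBound p : Vec n → ℝ) := by
  unfold dualBound; fun_prop

theorem dualBound_sq (p : ℝ) (x : Vec n) :
    dualBound p x ^ 2 = (n : ℝ) ^ twoDivQ p * supNorm x ^ 2 := by
  rw [dualBound, mul_pow, ← Real.rpow_natCast, ← Real.rpow_mul (by positivity), twoDivQ]
  congr 2
  push_cast; ring

/-! ### Prox-functions -/

/-- Letting `t → 0` in an inequality between quadratic polynomials. -/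
theorem le_of_forall_small_mul_le {a b : ℝ} (h : ∀ t ∈ Ioo (0 : ℝ) 1, (1 - t) * a ≤ b) : a ≤ b := by
  have h1 : Filter.Tendsto (fun t : ℝ => (1 - t) * a) (nhdsWithin 0 (Ioi 0)) (nhds a) := by
    have : Continuous fun t : ℝ => (1 - t) * a := by fun_prop
    simpa using (this.tendsto 0).mono_left nhdsWithin_le_nhds
  refine le_of_tendsto h1 ?_
  filter_upwards [Ioo_mem_nhdsGT (zero_lt_one (α := ℝ))] with t ht using h t ht

variable {p : ℝ} {Q : Set (Vec n)} {d : Vec n → ℝ}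

theorem tendsto_slope_of_differentiableAt {x : Vec n} (hd : DifferentiableAt ℝ d x) (v : Vec n) :
    Filter.Tendsto (fun t : ℝ => t⁻¹ * (d (x + t • v) - d x)) (nhdsWithin 0 (Ioi 0))
      (nhds (fderiv ℝ d x v)) := by
  have hl : HasDerivAt (fun t : ℝ => x + t • v) v 0 := by
    simpa using ((hasDerivAt_id (0 : ℝ)).smul_const v).const_add x
  have hd' : HasFDerivAt d (fderiv ℝ d x) (x + (0 : ℝ) • v) := by simpa using hd.hasFDerivAt
  have := (hd'.comp_hasDerivAt (0 : ℝ) hl).tendsto_slope_zero_right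
  simpa using this

theorem IsProx.half_sq_le_bregman (hd : IsProx p Q d) {x y : Vec n} (hx : x ∈ Q) (hy : y ∈ Q)
    (hdx : DifferentiableAt ℝ d x) : lNorm p (y - x) ^ 2 / 2 ≤ bregman d x y := by
  have h1 : Filter.Tendsto (fun t : ℝ => (d y - d x) - (1 - t) * (lNorm p (y - x) ^ 2 / 2))
      (nhdsWithin 0 (Ioi 0)) (nhds ((d y - d x) - lNorm p (y - x) ^ 2 / 2)) := by
    have : Continuous fun t : ℝ => (d y - d x) - (1 - t) * (lNorm p (y - x) ^ 2 / 2) := by fun_prop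
    simpa using (this.tendsto 0).mono_left nhdsWithin_le_nhds
  have h2 : fderiv ℝ d x (y - x) ≤ (d y - d x) - lNorm p (y - x) ^ 2 / 2 := by
    refine le_of_tendsto_of_tendsto (tendsto_slope_of_differentiableAt hdx (y - x)) h1 ?_
    filter_upwards [Ioo_mem_nhdsGT (zero_lt_one (α := ℝ))] with t ht
    have h := hd.strongConvex y hy x hx t ⟨ht.1.le, ht.2.le⟩
    rw [show t • y + (1 - t) • x = x + t • (y - x) by module] at h
    rw [inv_mul_le_iff₀ ht.1]
    linarith
  rw [bregman]; linarith

/-- One step of mirror descent. -/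
theorem IsProx.mirror_step (hQ : Convex ℝ Q) (hd : IsProx p Q d) {x z g u : Vec n}
    (hx : x ∈ Q) (hdx : DifferentiableAt ℝ d x) (hdz : DifferentiableAt ℝ d z)
    (hz : IsMirr Q d x g z) (hu : u ∈ Q) {a : ℝ} (ha : ∀ v, inner ℝ g v ≤ a * lNorm p v) :
    inner ℝ g (x - u) ≤ bregman d x u - bregman d z u + a ^ 2 / 2 := by
  -- First-order optimality of `z` on the convex set `Q`. This is where differentiability of `d` at
  -- the new point is used.
  have hopt : 0 ≤ inner ℝ g (u - z) - fderiv ℝ d x (u - z) + fderiv ℝ d z (u - z) := by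
    have h1 := (tendsto_slope_of_differentiableAt hdz (u - z)).const_add
      (inner ℝ g (u - z) - fderiv ℝ d x (u - z))
    refine ge_of_tendsto h1 ?_
    filter_upwards [Ioo_mem_nhdsGT (zero_lt_one (α := ℝ))] with t ht
    have hm : z + t • (u - z) ∈ Q := hQ.add_smul_sub_mem hz.1 hu ⟨ht.1.le, ht.2.le⟩
    have h := hz.2 hm
    simp only [mem_ofPred_eq, bregman] at h
    rw [show z + t • (u - z) - x = (z - x) + t • (u - z) by module, inner_add_right,
      inner_smul_right, map_add, map_smul, smul_eq_mul] at h
    have : 0 ≤ t * (inner ℝ g (u - z) - fderiv ℝ d x (u - z)) + (d (z + t • (u - z)) - d z) := by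
      linarith
    have h2 := mul_nonneg (inv_nonneg.2 ht.1.le) this
    rw [mul_add, inv_mul_cancel_left₀ ht.1.ne'] at h2
    exact h2
  have hV := hd.half_sq_le_bregman hx hz.1 hdx
  have h1 := ha (x - z)
  rw [lNorm_sub_comm] at h1
  have e1 : inner ℝ g (x - u) = inner ℝ g (x - z) - inner ℝ g (u - z) := by
    rw [← inner_sub_right]; congr 1; abel
  have e2 : fderiv ℝ d x (u - x) = fderiv ℝ d x (u - z) + fderiv ℝ d x (z - x) := by
    rw [← map_add]; congr 1; abel
  rw [e1]
  simp only [bregman] at hV ⊢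
  rw [e2]
  -- With `r = ‖z - x‖_p`, the displacement is paid for by strong convexity: `a r - r² / 2 ≤ a² /
  -- 2`.
  nlinarith [sq_nonneg (a - lNorm p (z - x))]

theorem IsProx.sub_linear (hd : IsProx p Q d) (l : Vec n →L[ℝ] ℝ) (c : ℝ) :
    IsProx p Q (fun y => d y - l y + c) where
  continuousOn := (hd.continuousOn.sub l.continuous.continuousOn).add continuousOn_const
  strongConvex x hx y hy t ht := by
    have := hd.strongConvex x hx y hy t ht
    rw [map_add, map_smul, map_smul, smul_eq_mul, smul_eq_mul]
    linarith

theorem IsProx.bregman (hd : IsProx p Q d) (x : Vec n) : IsProx p Q (bregman d x) := by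
  have := hd.sub_linear (fderiv ℝ d x) (fderiv ℝ d x x - d x)
  refine (congrArg (IsProx p Q) ?_).mp this
  funext y
  rw [BanditMD.bregman, map_sub]
  ring

/-- Quadratic growth at the minimizer of a linear perturbation of a prox-function. -/
theorem IsProx.growth (hQ : Convex ℝ Q) (hd : IsProx p Q d) {s y u : Vec n} (hy : y ∈ Q)
    (hmin : ∀ z ∈ Q, d y - inner ℝ s y ≤ d z - inner ℝ s z) (hu : u ∈ Q) :
    d y - inner ℝ s y + lNorm p (u - y) ^ 2 / 2 ≤ d u - inner ℝ s u := by
  have : lNorm p (u - y) ^ 2 / 2 ≤ (d u - inner ℝ s u) - (d y - inner ℝ s y) := by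
    refine le_of_forall_small_mul_le fun t ht => ?_
    have hm : t • u + (1 - t) • y ∈ Q :=
      hQ hu hy ht.1.le (by linarith [ht.2]) (by ring)
    have h1 := hmin _ hm
    have h2 := hd.strongConvex u hu y hy t ⟨ht.1.le, ht.2.le⟩
    rw [inner_add_right, inner_smul_right, inner_smul_right] at h1
    have h3 : t * ((1 - t) * (lNorm p (u - y) ^ 2 / 2)) ≤
      t * ((d u - inner ℝ s u) - (d y - inner ℝ s y)) := by linarith
    exact le_of_mul_le_mul_left h3 ht.1
  linarith

/-- The minimizers of linear perturbations of a prox-function depend continuously on the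
perturbation. -/
theorem IsProx.exists_argmin (hp : 1 ≤ p) (hp2 : p ≤ 2) (hQ : Convex ℝ Q) (hQc : IsCompact Q)
    (hQn : Q.Nonempty) (hd : IsProx p Q d) :
    ∃ Y : Vec n → Vec n, Continuous Y ∧ (∀ s, Y s ∈ Q) ∧
      (∀ s, ∀ u ∈ Q, d (Y s) - inner ℝ s (Y s) + lNorm p (u - Y s) ^ 2 / 2 ≤ d u - inner ℝ s u) ∧
      ∀ s, ∀ y ∈ Q, (∀ z ∈ Q, d y - inner ℝ s y ≤ d z - inner ℝ s z) → y = Y s := by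
  have hex : ∀ s, ∃ y ∈ Q, ∀ z ∈ Q, d y - inner ℝ s y ≤ d z - inner ℝ s z := by
    intro s
    obtain ⟨y, hy, hmin⟩ := hQc.exists_isMinOn hQn
      (f := fun y => d y - inner ℝ s y) (hd.continuousOn.sub (by fun_prop))
    exact ⟨y, hy, fun z hz => hmin hz⟩
  choose Y hYQ hYmin using hex
  have hgrow : ∀ s, ∀ u ∈ Q, d (Y s) - inner ℝ s (Y s) + lNorm p (u - Y s) ^ 2 / 2 ≤
      d u - inner ℝ s u := fun s u hu => hd.growth hQ (hYQ s) (hYmin s) hu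
  -- Adding the growth inequalities for `s` and `s'` gives `‖y - Y s'‖_p² ≤ ⟨s - s', y - Y s'⟩`.
  -- Here `y` is an arbitrary minimizer for `s`, so that the case `s' = s` also yields uniqueness.
  have hlip : ∀ s s', ∀ y ∈ Q, (∀ z ∈ Q, d y - inner ℝ s y ≤ d z - inner ℝ s z) →
      ‖y - Y s'‖ ≤ ‖s - s'‖ := by
    intro s s' y hy hmin
    have h1 := hd.growth hQ hy hmin (hYQ s')
    have h2 := hgrow s' y hy
    have h3 := norm_le_lNorm hp hp2 (y - Y s')
    rw [lNorm_sub_comm] at h1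
    have h4 : lNorm p (y - Y s') ^ 2 ≤ inner ℝ (s - s') (y - Y s') := by
      rw [inner_sub_left, inner_sub_right, inner_sub_right]
      linarith
    have h5 := real_inner_le_norm (s - s') (y - Y s')
    by_contra hc
    push Not at hc
    nlinarith [norm_nonneg (s - s')]
  refine ⟨Y, ?_, hYQ, hgrow, fun s y hy hmin => ?_⟩
  · refine LipschitzWith.continuous (K := 1) (LipschitzWith.of_dist_le_mul fun s s' => ?_)
    simpa [dist_eq_norm] using hlip s s' (Y s) (hYQ s) (hYmin s)
  · have := hlip s s y hy hmin
    rw [sub_self, norm_zero] at this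
    exact sub_eq_zero.1 (norm_le_zero_iff.1 this)

/-- Follow the regularized leader: a bound for linear functionals of a sum. -/
theorem inner_sum_le_of_argmin {Y : Vec n → Vec n} (hYQ : ∀ s, Y s ∈ Q)
    (hY : ∀ s, ∀ u ∈ Q,
      d (Y s) - inner ℝ s (Y s) + lNorm p (u - Y s) ^ 2 / 2 ≤ d u - inner ℝ s u)
    (hd0 : ∀ y ∈ Q, 0 ≤ d y) (h : ℕ → Vec n) (a : ℕ → ℝ)
    (ha : ∀ k v, inner ℝ (h k) v ≤ a k * lNorm p v) (x₁ : Vec n) {u : Vec n} (hu : u ∈ Q) (N : ℕ) :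
    inner ℝ (∑ k ∈ Finset.range N, h k) (u - x₁) ≤ d u +
      ∑ k ∈ Finset.range N,
        (inner ℝ (h k) (Y (∑ j ∈ Finset.range k, h j) - x₁) + a k ^ 2 / 2) := by
  -- The potential `max_Q (⟨S, ·⟩ - d)` is nonpositive at `S = 0`. Adding `h` to `S` raises it by at
  -- most `⟨h, Y S⟩ + a² / 2`, because quadratic growth at `Y S` pays for the move to the new
  -- maximizer.
  have key : ∀ N, inner ℝ (∑ k ∈ Finset.range N, h k) (Y (∑ k ∈ Finset.range N, h k)) -
      d (Y (∑ k ∈ Finset.range N, h k)) ≤ ∑ k ∈ Finset.range N,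
        (inner ℝ (h k) (Y (∑ j ∈ Finset.range k, h j)) + a k ^ 2 / 2) := by
    intro N
    induction N with
    | zero => simpa using hd0 _ (hYQ 0)
    | succ N ih =>
      rw [Finset.sum_range_succ (fun k => inner ℝ (h k) _ + _),
        Finset.sum_range_succ h]
      set S := ∑ k ∈ Finset.range N, h k
      set u' := Y (S + h N)
      have h1 := hY S u' (hYQ _)
      have h2 := ha N (u' - Y S)
      rw [inner_sub_right] at h2
      rw [inner_add_left]
      nlinarith [sq_nonneg (a N - lNorm p (u' - Y S))]
  have h1 := hY (∑ k ∈ Finset.range N, h k) u hu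
  have h2 := key N
  have h3 := sq_nonneg (lNorm p (u - Y (∑ k ∈ Finset.range N, h k)))
  have h4 : ∑ k ∈ Finset.range N,
      (inner ℝ (h k) (Y (∑ j ∈ Finset.range k, h j) - x₁) + a k ^ 2 / 2) =
      ∑ k ∈ Finset.range N,
        (inner ℝ (h k) (Y (∑ j ∈ Finset.range k, h j)) + a k ^ 2 / 2) -
        inner ℝ (∑ k ∈ Finset.range N, h k) x₁ := by
    rw [sum_inner, ← Finset.sum_sub_distrib]
    refine Finset.sum_congr rfl fun k _ => ?_
    rw [inner_sub_right]; ring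
  rw [h4, inner_sub_right]
  linarith

theorem hasFDerivAt_euclideanProx (c x : Vec n) :
    HasFDerivAt (euclideanProx c) (innerSL ℝ (x - c)) x := by
  have h := ((hasFDerivAt_id x).sub_const c).norm_sq.const_mul (1 / 2)
  have e : euclideanProx c = fun y => 1 / 2 * ‖id y - c‖ ^ 2 := by
    funext y; rw [euclideanProx, id]; ring
  rw [e]
  refine h.congr_fderiv ?_
  ext v
  simp

theorem bregman_euclideanProx (c x y : Vec n) :
    bregman (euclideanProx c) x y = ‖y - x‖ ^ 2 / 2 := by
  rw [bregman, (hasFDerivAt_euclideanProx c x).fderiv, euclideanProx, euclideanProx,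
    innerSL_apply_apply, show y - c = (y - x) + (x - c) by abel, norm_add_sq_real,
    real_inner_comm]
  ring

theorem isProx_euclideanProx (c : Vec n) (Q : Set (Vec n)) : IsProx 2 Q (euclideanProx c) where
  continuousOn := by unfold euclideanProx; fun_prop
  strongConvex x _ y _ t _ := by
    simp only [euclideanProx, lNorm_two]
    rw [show t • x + (1 - t) • y - c = t • (x - c) + (1 - t) • (y - c) by module,
      show x - y = (x - c) - (y - c) by abel]
    generalize x - c = X
    generalize y - c = Z
    rw [norm_add_sq_real, norm_sub_sq_real, norm_smul,
      norm_smul, inner_smul_left, inner_smul_right, mul_pow, mul_pow, Real.norm_eq_abs,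
      Real.norm_eq_abs, sq_abs, sq_abs]
    simp only [conj_trivial]
    apply le_of_eq
    ring

/-! ### Freezing of independent variables -/
section Freezing

section Joint

variable {A A' 𝒴 𝒵 β : Type*} [MeasurableSpace A] [MeasurableSpace A'] [MeasurableSpace 𝒴]
  [MeasurableSpace 𝒵] [MeasurableSpace β] {f : A → A'} {y : A → 𝒴}

/-- Abstract spaces are used here so that the σ-algebra on `Ω` can be passed explicitly: later it is
`ℱ k` and not the ambient one. -/
theorem measurable_comp_graph (hf : Measurable f) (hy : Measurable y) {F : A' × 𝒴 → β}
    (hF : Measurable F) : Measurable (fun a => F (f a, y a)) := hF.comp (hf.prodMk hy)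

theorem measurable_section {F : A × 𝒴 → β} (hF : Measurable F) (a : A) :
    Measurable (fun y => F (a, y)) := hF.comp measurable_prodMk_left

theorem measurable_comp_graph_prod (hf : Measurable f) (hy : Measurable y) {F : A' × (𝒴 × 𝒵) → β}
    (hF : Measurable F) : Measurable (fun t : A × 𝒵 => F (f t.1, (y t.1, t.2))) :=
  hF.comp ((hf.comp measurable_fst).prodMk ((hy.comp measurable_fst).prodMk measurable_snd))

theorem measurable_integral_comp_graph {E : Type*} [NormedAddCommGroup E] [NormedSpace ℝ E]
    [MeasurableSpace E] [BorelSpace E] [SecondCountableTopology E] {ν : Measure 𝒵} [SFinite ν]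
    (hf : Measurable f) (hy : Measurable y)
    {F : A' × (𝒴 × 𝒵) → E} (hF : Measurable F) :
    Measurable (fun a => ∫ z, F (f a, (y a, z)) ∂ν) :=
  (measurable_comp_graph_prod hf hy hF).stronglyMeasurable.integral_prod_right'.measurable

theorem measurable_inner_sub {F : A × 𝒵 → Vec n} (hF : Measurable F)
    {w v : A → Vec n} (hw : Measurable w) (hv : Measurable v) :
    Measurable (fun t : A × 𝒵 => (inner ℝ (F t - w t.1) (v t.1) : ℝ)) := by
  have h1 : Measurable fun t : A × 𝒵 => w t.1 := hw.comp measurable_fst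
  have h2 : Measurable fun t : A × 𝒵 => v t.1 := hv.comp measurable_fst
  exact (hF.sub h1).inner h2

end Joint

variable {Ω Ω' 𝒵 : Type*} [MeasurableSpace Ω] [MeasurableSpace Ω'] [MeasurableSpace 𝒵]
  {P : Measure Ω} [IsProbabilityMeasure P] {f : Ω → Ω'} {Z : Ω → 𝒵} {ν : Measure 𝒵}

theorem map_prodMk_of_indepFun (hf : Measurable f) (hZ : Measurable Z) (hind : IndepFun f Z P)
    (hν : P.map Z = ν) : P.map (fun ω => (f ω, Z ω)) = (P.map f).prod ν := by
  rw [← hν]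
  exact hind.map_prod_eq_prod_map_map hf.aemeasurable hZ.aemeasurable

/-- Tonelli for the product of the law of `f` with `ν`. In the applications `f` is the identity of
`Ω`, with `ℱ k` as the σ-algebra of the target, so the bound `c` is one that is uniform over all
pasts. -/
theorem integrable_freeze [IsProbabilityMeasure ν] (hf : Measurable f) (hZ : Measurable Z) (hind : IndepFun f Z P)
    (hν : P.map Z = ν) {Φ : Ω' × 𝒵 → ℝ} (hΦ : Measurable Φ) (h0 : ∀ t, 0 ≤ Φ t) {c : ℝ}
    (hi : ∀ ω, Integrable (fun z => Φ (f ω, z)) ν) (hc : ∀ ω, ∫ z, Φ (f ω, z) ∂ν ≤ c) :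
    Integrable (fun ω => Φ (f ω, Z ω)) P ∧ ∫ ω, Φ (f ω, Z ω) ∂P ≤ c := by
  have hm : Measurable (fun ω => Φ (f ω, Z ω)) := hΦ.comp (hf.prodMk hZ)
  have hl : ∫⁻ ω, ENNReal.ofReal (Φ (f ω, Z ω)) ∂P ≤ ENNReal.ofReal c := by
    calc ∫⁻ ω, ENNReal.ofReal (Φ (f ω, Z ω)) ∂P
        = ∫⁻ t, ENNReal.ofReal (Φ t) ∂(P.map (fun ω => (f ω, Z ω))) :=
          (lintegral_map hΦ.ennreal_ofReal (hf.prodMk hZ)).symm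
      _ = ∫⁻ ω, ∫⁻ z, ENNReal.ofReal (Φ (f ω, z)) ∂ν ∂P := by
          rw [map_prodMk_of_indepFun hf hZ hind hν, lintegral_prod _ hΦ.ennreal_ofReal.aemeasurable,
            lintegral_map hΦ.ennreal_ofReal.lintegral_prod_right' hf]
      _ ≤ ∫⁻ ω, ENNReal.ofReal c ∂P := by
          refine lintegral_mono fun ω => ?_
          rw [← ofReal_integral_eq_lintegral_ofReal (hi ω) (.of_forall fun z => h0 _)]
          exact ENNReal.ofReal_le_ofReal (hc ω)
      _ = _ := by simp
  have hint : Integrable (fun ω => Φ (f ω, Z ω)) P := by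
    refine ⟨hm.aestronglyMeasurable, ?_⟩
    rw [hasFiniteIntegral_iff_ofReal (.of_forall fun ω => h0 _)]
    exact hl.trans_lt ENNReal.ofReal_lt_top
  refine ⟨hint, ?_⟩
  obtain ⟨ω⟩ := nonempty_of_isProbabilityMeasure P
  have hc0 : 0 ≤ c := (integral_nonneg fun z => h0 _).trans (hc ω)
  rw [integral_eq_lintegral_of_nonneg_ae (.of_forall fun ω => h0 _) hm.aestronglyMeasurable]
  exact ENNReal.toReal_le_of_le_ofReal hc0 hl

/-- Fubini plays the role of conditioning: the past is held fixed while the fresh variable is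
integrated out. -/
theorem integral_freeze [IsProbabilityMeasure ν] (hf : Measurable f) (hZ : Measurable Z) (hind : IndepFun f Z P)
    (hν : P.map Z = ν) {Φ : Ω' × 𝒵 → ℝ} (hΦ : Measurable Φ)
    (hi : Integrable (fun ω => Φ (f ω, Z ω)) P) :
    ∫ ω, Φ (f ω, Z ω) ∂P = ∫ ω, ∫ z, Φ (f ω, z) ∂ν ∂P := by
  have hmap := map_prodMk_of_indepFun hf hZ hind hν
  have hi' : Integrable Φ ((P.map f).prod ν) := by
    rw [← hmap, integrable_map_measure hΦ.aestronglyMeasurable (hf.prodMk hZ).aemeasurable]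
    exact hi
  rw [← integral_map (φ := fun ω => (f ω, Z ω)) (f := Φ) (hf.prodMk hZ).aemeasurable
    hΦ.aestronglyMeasurable, hmap, integral_prod _ hi', integral_map hf.aemeasurable]
  exact hΦ.stronglyMeasurable.integral_prod_right'.aestronglyMeasurable

theorem sq_integral_le_integral_sq [IsProbabilityMeasure ν] {X : 𝒵 → ℝ} (hX : MemLp X 2 ν) :
    (∫ z, X z ∂ν) ^ 2 ≤ ∫ z, X z ^ 2 ∂ν := by
  have h := variance_nonneg X ν
  rw [variance_eq_sub hX] at h
  simpa using h

end Freezing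

/-! ### Integrability, measurability and continuity of the losses -/

namespace Game
variable {Ω Ξ : Type*} [MeasurableSpace Ω] [MeasurableSpace Ξ] {G : Game n Ω Ξ}

theorem subset_nbhd (G : Game n Ω Ξ) : G.Q ⊆ G.nbhd := Metric.self_subset_cthickening G.Q

theorem closedBall_subset_nbhd {μ : ℝ} (hμ : μ ≤ G.μ₀) {x : Vec n} (hx : x ∈ G.Q) :
    Metric.closedBall x μ ⊆ G.nbhd :=
  (Metric.closedBall_subset_closedBall hμ).trans (Metric.closedBall_subset_cthickening hx _)

theorem Valid.measurable_f_apply (hG : G.Valid) (k : ℕ) (ω : Ω) (x : Vec n) :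
    Measurable (G.f k ω x) :=
  (@measurable_section Ω (Vec n × Ξ) ℝ (G.ℱ k) _ _ _ (hG.measurable_f k) ω).comp
    measurable_prodMk_left

theorem Valid.measurable_fNoisy_apply (hG : G.Valid) (k : ℕ) (ω : Ω) :
    Measurable (fun t : Vec n × Ξ => G.fNoisy k ω t.1 t.2) :=
  @measurable_section Ω (Vec n × Ξ) ℝ (G.ℱ k) _ _ _ (hG.measurable_fNoisy k) ω

theorem memLp_f (hG : G.Valid) {δ B : ℝ} (hN : G.NoiseBound δ B) (k : ℕ) (ω : Ω) {x : Vec n}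
    (hx : x ∈ G.nbhd) : MemLp (G.f k ω x) 2 G.law := by
  have := hG.isProb_law
  have h1 : MemLp (fun z => G.fNoisy k ω x z - G.f k ω x z) 2 G.law := by
    refine MemLp.of_bound ?_ δ (.of_forall fun z => hN.noise k ω x hx z)
    exact ((hN.memLp k ω x hx).1.aemeasurable.sub
      (hG.measurable_f_apply k ω x).aemeasurable).aestronglyMeasurable
  have := (hN.memLp k ω x hx).sub h1
  refine this.congr_norm (hG.measurable_f_apply k ω x).aestronglyMeasurable (.of_forall fun z => ?_)
  simp

/-- A crude bound from `|t| ≤ (1 + t²) / 2`. It serves the integrability of losses and regrets and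
does not enter the rate. -/
theorem abs_loss_le (hG : G.Valid) {δ B : ℝ} (hN : G.NoiseBound δ B) (k : ℕ) (ω : Ω) {x : Vec n}
    (hx : x ∈ G.nbhd) : |G.loss k ω x| ≤ (1 + B ^ 2) / 2 + δ := by
  have := hG.isProb_law
  have hi := (hN.memLp k ω x hx).integrable_sq
  calc |G.loss k ω x| ≤ ∫ z, |G.f k ω x z| ∂G.law := abs_integral_le_integral_abs
    _ ≤ ∫ z, ((1 + G.fNoisy k ω x z ^ 2) / 2 + δ) ∂G.law := by
        refine integral_mono ((memLp_f hG hN k ω hx).integrable one_le_two).abs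
          ((((integrable_const _).add hi).div_const _).add (integrable_const _)) fun z => ?_
        have h1 := hN.noise k ω x hx z
        have h2 := abs_sub_abs_le_abs_sub (G.f k ω x z) (G.fNoisy k ω x z)
        rw [abs_sub_comm] at h2
        have h3 : |G.fNoisy k ω x z| ≤ (1 + G.fNoisy k ω x z ^ 2) / 2 := by
          rw [← sq_abs]; nlinarith [sq_nonneg (|G.fNoisy k ω x z| - 1)]
        simp only
        linarith
    _ = (1 + ∫ z, G.fNoisy k ω x z ^ 2 ∂G.law) / 2 + δ := by
        have h1 : Integrable (fun z => (1 + G.fNoisy k ω x z ^ 2) / 2) G.law :=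
          ((integrable_const _).add hi).div_const _
        rw [integral_add h1 (integrable_const _), integral_div,
          integral_add (integrable_const _) hi]
        simp
    _ ≤ _ := by
        have := hN.moment k ω x hx
        gcongr

theorem Valid.measurable_loss_comp (hG : G.Valid) (k : ℕ) {y : Ω → Vec n}
    (hy : Measurable[G.ℱ k] y) : Measurable[G.ℱ k] (fun ω => G.loss k ω (y ω)) := by
  have := hG.isProb_law
  exact @measurable_integral_comp_graph Ω Ω (Vec n) Ξ (G.ℱ k) (G.ℱ k) _ _ id y ℝ _ _ _ _ _ G.law _
    (@measurable_id _ (G.ℱ k)) hy _ (hG.measurable_f k)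

/-- A convex function is continuous in the interior of its domain, and `Q` lies in the interior of
its neighbourhood because `μ₀ > 0`. -/
theorem Valid.continuousOn_loss (hG : G.Valid) (h0 : 0 < G.μ₀) (k : ℕ) (ω : Ω) :
    ContinuousOn (G.loss k ω) G.Q := by
  refine (hG.convexOn_loss k ω).continuousOn_interior.mono ?_
  refine interior_maximal (Metric.thickening_subset_cthickening G.μ₀ G.Q)
    Metric.isOpen_thickening |>.trans' ?_
  exact Metric.self_subset_thickening h0 _

/-! ### Gradient oracles -/

/-- The joint law of a direction and of the randomness of a loss. -/
def ν (G : Game n Ω Ξ) : Measure (Vec n × Ξ) := (sphereUniform n).prod G.law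

theorem isProbabilityMeasure_ν (hn : 1 ≤ n) (hG : G.Valid) : IsProbabilityMeasure G.ν := by
  have := hG.isProb_law
  have := isProbabilityMeasure_sphereUniform hn
  unfold ν; infer_instance

/-- A continuous gauge for the sizes of gradient estimates. -/
structure _root_.BanditMD.IsGauge (W : Vec n → ℝ) : Prop where
  continuous : Continuous W
  nonneg : ∀ g, 0 ≤ W g
  norm_le : ∃ c, ∀ g, ‖g‖ ≤ c * W g
  le_norm : ∃ c, ∀ g, W g ≤ c * ‖g‖

/-- Approximately unbiased gradient estimates with bounded second moment. -/
structure GoodOracle (G : Game n Ω Ξ) (est : ℕ → Ω → Vec n → Vec n × Ξ → Vec n) (W : Vec n → ℝ)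
    (s γ β : ℝ) : Prop where
  measurable : ∀ k, Measurable[@Prod.instMeasurableSpace Ω (Vec n × (Vec n × Ξ)) (G.ℱ k)
    inferInstance] (fun t : Ω × (Vec n × (Vec n × Ξ)) => est k t.1 t.2.1 t.2.2)
  memLp : ∀ k ω, ∀ x ∈ G.Q, MemLp (est k ω x) 2 G.ν
  moment : ∀ k ω, ∀ x ∈ G.Q, ∫ z, W (est k ω x z) ^ 2 ∂G.ν ≤ s
  approx : ∀ k ω, ∀ x ∈ G.Q, ∀ u ∈ G.Q, G.loss k ω x - G.loss k ω u + γ / 2 * ‖x - u‖ ^ 2 ≤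
    ∫ z, inner ℝ (est k ω x z) (x - u) ∂G.ν + β

/-- The gradient estimate at step `k`. -/
def grad (G : Game n Ω Ξ) (est : ℕ → Ω → Vec n → Vec n × Ξ → Vec n) (x : ℕ → Ω → Vec n) (k : ℕ)
    (ω : Ω) : Vec n := est k ω (x k ω) (G.e k ω, G.ξ k ω)

/-- The conditional mean of the gradient estimate at step `k`. -/
def meanGrad (G : Game n Ω Ξ) (est : ℕ → Ω → Vec n → Vec n × Ξ → Vec n) (x : ℕ → Ω → Vec n)
    (k : ℕ) (ω : Ω) : Vec n := ∫ z, est k ω (x k ω) z ∂G.ν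

section Oracle

variable {est : ℕ → Ω → Vec n → Vec n × Ξ → Vec n} {W : Vec n → ℝ} {s γ β : ℝ}
  {x : ℕ → Ω → Vec n}

theorem Valid.measurable_pair (hG : G.Valid) (k : ℕ) :
    Measurable[G.ℱ (k + 1)] (fun ω => (G.e k ω, G.ξ k ω)) :=
  @measurable_comp_graph Ω (Vec n) Ξ _ (G.ℱ (k + 1)) _ _ _ (G.e k) (G.ξ k)
    (hG.measurable_e k) (hG.measurable_ξ k) id measurable_id

/-- The past is encoded as the identity map into `(Ω, ℱ k)`, the form in which the freezing lemmas
accept it. -/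
theorem Valid.indepFun_id (hG : G.Valid) (k : ℕ) :
    @IndepFun Ω Ω (Vec n × Ξ) _ (G.ℱ k) _ id (fun ω => (G.e k ω, G.ξ k ω)) G.P := by
  have h : Indep (MeasurableSpace.comap id (G.ℱ k))
      (MeasurableSpace.comap (fun ω => (G.e k ω, G.ξ k ω)) inferInstance) G.P := by
    rw [MeasurableSpace.comap_id]
    exact (hG.indep k).symm
  exact h

theorem GoodOracle.measurable_comp (h : G.GoodOracle est W s γ β) {k : ℕ}
    (hx : Measurable[G.ℱ k] (x k)) :
    Measurable[@Prod.instMeasurableSpace Ω (Vec n × Ξ) (G.ℱ k) inferInstance]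
      (fun t : Ω × (Vec n × Ξ) => est k t.1 (x k t.1) t.2) :=
  @measurable_comp_graph_prod Ω Ω (Vec n) (Vec n × Ξ) (Vec n) (G.ℱ k) (G.ℱ k) _ _ _ id (x k)
    (@measurable_id _ (G.ℱ k)) hx _ (h.measurable k)

theorem GoodOracle.measurable_grad (hG : G.Valid) (h : G.GoodOracle est W s γ β) {k : ℕ}
    (hx : Measurable[G.ℱ k] (x k)) : Measurable[G.ℱ (k + 1)] (G.grad est x k) :=
  @measurable_comp_graph Ω Ω (Vec n × Ξ) (Vec n) (G.ℱ (k + 1)) (G.ℱ k) _ _ id _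
    (measurable_id'' (G.ℱ.mono k.le_succ)) (hG.measurable_pair k) _ (h.measurable_comp hx)

theorem GoodOracle.measurable_meanGrad (hn : 1 ≤ n) (hG : G.Valid) (h : G.GoodOracle est W s γ β)
    {k : ℕ} (hx : Measurable[G.ℱ k] (x k)) : Measurable[G.ℱ k] (G.meanGrad est x k) := by
  have := isProbabilityMeasure_ν hn hG
  exact @measurable_integral_comp_graph Ω Ω (Vec n) (Vec n × Ξ) (G.ℱ k) (G.ℱ k) _ _ id (x k) (Vec n)
    _ _ _ _ _ G.ν _ (@measurable_id _ (G.ℱ k)) hx _ (h.measurable k)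

theorem GoodOracle.integrable_est (hn : 1 ≤ n) (hG : G.Valid) (h : G.GoodOracle est W s γ β)
    (k : ℕ) (ω : Ω) {y : Vec n} (hy : y ∈ G.Q) : Integrable (est k ω y) G.ν := by
  have := isProbabilityMeasure_ν hn hG
  exact (h.memLp k ω y hy).integrable one_le_two

theorem GoodOracle.memLp_gauge (hW : IsGauge W) (h : G.GoodOracle est W s γ β)
    (k : ℕ) (ω : Ω) {y : Vec n} (hy : y ∈ G.Q) : MemLp (fun z => W (est k ω y z)) 2 G.ν := by
  obtain ⟨c, hc⟩ := hW.le_norm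
  refine MemLp.of_le_mul (c := c) (h.memLp k ω y hy)
    (hW.continuous.comp_aestronglyMeasurable (h.memLp k ω y hy).1) (.of_forall fun z => ?_)
  rw [Real.norm_of_nonneg (hW.nonneg _)]
  exact hc _

theorem GoodOracle.gauge_grad (hn : 1 ≤ n) (hG : G.Valid) (hW : IsGauge W)
    (h : G.GoodOracle est W s γ β) {k : ℕ} (hx : Measurable[G.ℱ k] (x k))
    (hxQ : ∀ ω, x k ω ∈ G.Q) :
    Integrable (fun ω => W (G.grad est x k ω) ^ 2) G.P ∧
      ∫ ω, W (G.grad est x k ω) ^ 2 ∂G.P ≤ s := by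
  have := isProbabilityMeasure_ν hn hG
  have := hG.isProb
  exact @integrable_freeze Ω Ω (Vec n × Ξ) _ (G.ℱ k) _ G.P _ id (fun ω => (G.e k ω, G.ξ k ω)) G.ν _
    (measurable_id'' (G.ℱ.le k)) ((hG.measurable_pair k).mono (G.ℱ.le _) le_rfl)
    (hG.indepFun_id k) (hG.map_eq k) (fun t => W (est k t.1 (x k t.1) t.2) ^ 2)
    ((hW.continuous.measurable.comp (h.measurable_comp hx)).pow_const 2)
    (fun t => sq_nonneg _) s
    (fun ω => (h.memLp_gauge hW k ω (hxQ ω)).integrable_sq)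
    (fun ω => h.moment k ω _ (hxQ ω))

/-- Jensen twice: for the gauge, in the form of `hWc`, and for the square. -/
theorem GoodOracle.gauge_meanGrad_sq_le (hn : 1 ≤ n) (hG : G.Valid) (hW : IsGauge W)
    (hWc : ∀ g : Vec n × Ξ → Vec n, Integrable g G.ν → W (∫ z, g z ∂G.ν) ≤ ∫ z, W (g z) ∂G.ν)
    (h : G.GoodOracle est W s γ β) {k : ℕ} (hxQ : ∀ ω, x k ω ∈ G.Q) (ω : Ω) :
    W (G.meanGrad est x k ω) ^ 2 ≤ s := by
  have := isProbabilityMeasure_ν hn hG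
  calc W (G.meanGrad est x k ω) ^ 2 ≤ (∫ z, W (est k ω (x k ω) z) ∂G.ν) ^ 2 := by
        have := hW.nonneg (G.meanGrad est x k ω)
        gcongr
        exact hWc _ (h.integrable_est hn hG k ω (hxQ ω))
    _ ≤ ∫ z, W (est k ω (x k ω) z) ^ 2 ∂G.ν :=
        sq_integral_le_integral_sq (h.memLp_gauge hW k ω (hxQ ω))
    _ ≤ s := h.moment k ω _ (hxQ ω)

theorem GoodOracle.inner_meanGrad (hn : 1 ≤ n) (hG : G.Valid) (h : G.GoodOracle est W s γ β)
    {k : ℕ} (hxQ : ∀ ω, x k ω ∈ G.Q) (ω : Ω) (v : Vec n) :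
    ∫ z, inner ℝ (est k ω (x k ω) z) v ∂G.ν = inner ℝ (G.meanGrad est x k ω) v := by
  rw [real_inner_comm, meanGrad, ← integral_inner (h.integrable_est hn hG k ω (hxQ ω))]
  simp_rw [real_inner_comm]

/-- The martingale difference property: with the past frozen, `v` is a constant vector and the
centred estimate integrates to zero. Boundedness of `v` secures integrability. -/
theorem GoodOracle.integral_inner_grad_sub (hn : 1 ≤ n) (hG : G.Valid) (hW : IsGauge W)
    (h : G.GoodOracle est W s γ β) {k : ℕ} (hx : Measurable[G.ℱ k] (x k))
    (hxQ : ∀ ω, x k ω ∈ G.Q) {v : Ω → Vec n} (hv : Measurable[G.ℱ k] v) {c : ℝ}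
    (hvc : ∀ ω, ‖v ω‖ ≤ c) :
    Integrable (fun ω => inner ℝ (G.grad est x k ω - G.meanGrad est x k ω) (v ω)) G.P ∧
      ∫ ω, inner ℝ (G.grad est x k ω - G.meanGrad est x k ω) (v ω) ∂G.P = 0 := by
  have := isProbabilityMeasure_ν hn hG
  have := hG.isProb
  have hmp := (hG.measurable_pair k).mono (G.ℱ.le _) le_rfl
  have hmv := hv.mono (G.ℱ.le k) le_rfl
  have hmm := h.measurable_meanGrad hn hG hx
  have hmm' := hmm.mono (G.ℱ.le k) le_rfl
  have hmg := (h.measurable_grad hG hx).mono (G.ℱ.le _) le_rfl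
  obtain ⟨C, hC⟩ := hW.norm_le
  obtain ⟨ω₀⟩ := nonempty_of_isProbabilityMeasure G.P
  have hc0 : 0 ≤ c := (norm_nonneg _).trans (hvc ω₀)
  have hgn : Integrable (fun ω => ‖G.grad est x k ω‖ ^ 2) G.P := by
    refine Integrable.mono' ((h.gauge_grad hn hG hW hx hxQ).1.const_mul (C ^ 2))
      (Measurable.aestronglyMeasurable (by fun_prop)) (.of_forall fun ω => ?_)
    rw [Real.norm_of_nonneg (sq_nonneg _), ← mul_pow]
    gcongr
    exact hC _
  have hg : Integrable (G.grad est x k) G.P := by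
    refine MemLp.integrable one_le_two ?_
    rwa [memLp_two_iff_integrable_sq_norm hmg.aestronglyMeasurable]
  have hmean : ∀ ω, ‖G.meanGrad est x k ω‖ ≤ |C| * (1 + s) := by
    intro ω
    have h1 := h.integrable_est hn hG k ω (hxQ ω)
    have hL := h.memLp_gauge hW k ω (hxQ ω)
    calc ‖G.meanGrad est x k ω‖ ≤ ∫ z, ‖est k ω (x k ω) z‖ ∂G.ν := norm_integral_le_integral_norm _
      _ ≤ ∫ z, |C| * (1 + W (est k ω (x k ω) z) ^ 2) ∂G.ν := by
          refine integral_mono h1.norm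
            (((integrable_const _).add hL.integrable_sq).const_mul _) fun z => ?_
          refine (hC _).trans ?_
          have h2 := hW.nonneg (est k ω (x k ω) z)
          refine mul_le_mul (le_abs_self C) ?_ h2 (abs_nonneg _)
          nlinarith [sq_nonneg (W (est k ω (x k ω) z) - 1)]
      _ = |C| * (1 + ∫ z, W (est k ω (x k ω) z) ^ 2 ∂G.ν) := by
          rw [integral_const_mul, integral_add (integrable_const _) hL.integrable_sq]
          simp
      _ ≤ _ := by
          have := h.moment k ω _ (hxQ ω)
          gcongr
  have hm : Integrable (G.meanGrad est x k) G.P :=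
    Integrable.of_bound hmm'.aestronglyMeasurable _ (.of_forall hmean)
  have hint : Integrable (fun ω => inner ℝ (G.grad est x k ω - G.meanGrad est x k ω) (v ω)) G.P := by
    refine Integrable.mono' ((hg.sub hm).norm.mul_const c)
      (Measurable.aestronglyMeasurable (by fun_prop)) (.of_forall fun ω => ?_)
    refine (norm_inner_le_norm _ _).trans ?_
    simp only [Pi.sub_apply]
    gcongr
    exact hvc ω
  refine ⟨hint, ?_⟩
  have hΦ : Measurable[@Prod.instMeasurableSpace Ω (Vec n × Ξ) (G.ℱ k) inferInstance]
      (fun t : Ω × (Vec n × Ξ) =>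
        inner ℝ (est k t.1 (x k t.1) t.2 - G.meanGrad est x k t.1) (v t.1)) :=
    @measurable_inner_sub n Ω (Vec n × Ξ) (G.ℱ k) _ _ (h.measurable_comp hx) _ _ hmm hv
  have hfr := @integral_freeze Ω Ω (Vec n × Ξ) _ (G.ℱ k) _ G.P _ id
    (fun ω => (G.e k ω, G.ξ k ω)) G.ν _
    (measurable_id'' (G.ℱ.le k)) hmp (hG.indepFun_id k) (hG.map_eq k) _ hΦ hint
  refine hfr.trans ?_
  have : ∀ ω, ∫ z, inner ℝ (est k ω (x k ω) z - G.meanGrad est x k ω) (v ω) ∂G.ν = 0 := by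
    intro ω
    have h1 := h.integrable_est hn hG k ω (hxQ ω)
    simp_rw [inner_sub_left]
    rw [integral_sub (h1.inner_const _) (integrable_const _), h.inner_meanGrad hn hG hxQ]
    simp
  simp [this]

end Oracle

end Game

/-- Comparability with the Euclidean norm is needed for integrability only. One direction follows
from `‖g‖² = ⟨g, g⟩ ≤ dualBound p g * lNorm p g` and `lNorm_sq_le`. -/
theorem isGauge_dualBound {p : ℝ} (hp : 1 ≤ p) (hp2 : p ≤ 2) :
    IsGauge (dualBound p : Vec n → ℝ) where
  continuous := continuous_dualBound p
  nonneg := dualBound_nonneg p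
  norm_le := by
    refine ⟨√((n : ℝ) ^ (2 / p - 1)), fun g => ?_⟩
    rcases (norm_nonneg g).eq_or_lt with h | h
    · rw [← h]; exact mul_nonneg (Real.sqrt_nonneg _) (dualBound_nonneg p g)
    have h1 := inner_le_dualBound hp g g
    rw [real_inner_self_eq_norm_sq] at h1
    have h2 := lNorm_sq_le hp hp2 g
    have h3 : lNorm p g ≤ √((n : ℝ) ^ (2 / p - 1)) * ‖g‖ := by
      apply le_of_sq_le_sq _ (by positivity)
      rw [mul_pow, Real.sq_sqrt (by positivity)]
      exact h2
    have h4 := mul_le_mul_of_nonneg_left h3 (dualBound_nonneg p g)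
    have h5 : ‖g‖ * ‖g‖ ≤ (√((n : ℝ) ^ (2 / p - 1)) * dualBound p g) * ‖g‖ := by nlinarith
    exact le_of_mul_le_mul_right h5 h
  le_norm := ⟨(n : ℝ) ^ (1 - 1 / p), fun g =>
    mul_le_mul_of_nonneg_left (supNorm_le_norm g) (by positivity)⟩

theorem isGauge_norm : IsGauge (fun g : Vec n => ‖g‖) where
  continuous := continuous_norm
  nonneg := norm_nonneg
  norm_le := ⟨1, fun g => by simp⟩
  le_norm := ⟨1, fun g => by simp⟩

theorem dualBound_integral_le {p : ℝ} {𝒵 : Type*} [MeasurableSpace 𝒵]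
    {ν : Measure 𝒵} {g : 𝒵 → Vec n} (hg : Integrable g ν) :
    dualBound p (∫ z, g z ∂ν) ≤ ∫ z, dualBound p (g z) ∂ν := by
  have hs : Integrable (fun z => supNorm (g z)) ν := by
    refine hg.norm.mono' (continuous_supNorm.comp_aestronglyMeasurable hg.1)
      (.of_forall fun z => ?_)
    rw [Real.norm_of_nonneg (supNorm_nonneg _)]
    exact supNorm_le_norm _
  unfold dualBound
  rw [integral_const_mul]
  refine mul_le_mul_of_nonneg_left ?_ (by positivity)
  refine supNorm_le (integral_nonneg fun z => supNorm_nonneg _) fun i => ?_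
  have h1 : (∫ z, g z ∂ν) i = ∫ z, g z i ∂ν :=
    ((EuclideanSpace.proj (𝕜 := ℝ) i).integral_comp_comm hg).symm
  rw [h1]
  refine abs_integral_le_integral_abs.trans (integral_mono_of_nonneg
    (.of_forall fun z => abs_nonneg _) hs (.of_forall fun z => abs_coord_le_supNorm _ i))

/-! ### Compactness of the feasible set and measurability of the iterates -/

namespace Game

variable {Ω Ξ : Type*} [MeasurableSpace Ω] [MeasurableSpace Ξ] {G : Game n Ω Ξ}
  {d : Vec n → ℝ} {p D : ℝ} {x₁ : Vec n}

/-- Strong convexity turns the bound on the divergence into one on the size of `Q`. Compactness and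
the diameter `2 √2 D` come from here. -/
theorem lNorm_sub_sq_le (hd : IsProx p G.Q d) (hx₁ : x₁ ∈ G.Q) (hdx : DifferentiableAt ℝ d x₁)
    (hD : ∀ y ∈ G.Q, bregman d x₁ y ≤ D ^ 2) {y : Vec n} (hy : y ∈ G.Q) :
    lNorm p (y - x₁) ^ 2 ≤ 2 * D ^ 2 := by
  have h1 := hd.half_sq_le_bregman hx₁ hy hdx
  have h2 := hD y hy
  linarith

theorem norm_sub_le (hp : 1 ≤ p) (hp2 : p ≤ 2) (hd : IsProx p G.Q d) (hx₁ : x₁ ∈ G.Q)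
    (hdx : DifferentiableAt ℝ d x₁) (hD0 : 0 ≤ D) (hD : ∀ y ∈ G.Q, bregman d x₁ y ≤ D ^ 2)
    {y z : Vec n} (hy : y ∈ G.Q) (hz : z ∈ G.Q) : ‖y - z‖ ≤ 2 * (√2 * D) := by
  have key : ∀ y ∈ G.Q, ‖y - x₁‖ ≤ √2 * D := by
    intro y hy
    refine (norm_le_lNorm hp hp2 _).trans ?_
    apply le_of_sq_le_sq _ (by positivity)
    rw [mul_pow, Real.sq_sqrt (by norm_num)]
    exact lNorm_sub_sq_le hd hx₁ hdx hD hy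
  have h1 := key y hy
  have h2 := key z hz
  have h3 : ‖y - z‖ ≤ ‖y - x₁‖ + ‖z - x₁‖ := by
    rw [show y - z = (y - x₁) - (z - x₁) by abel]
    exact _root_.norm_sub_le _ _
  linarith

theorem isCompact_Q (hG : G.Valid) (hp : 1 ≤ p) (hp2 : p ≤ 2) (hd : IsProx p G.Q d)
    (hx₁ : x₁ ∈ G.Q) (hdx : DifferentiableAt ℝ d x₁) (hD0 : 0 ≤ D)
    (hD : ∀ y ∈ G.Q, bregman d x₁ y ≤ D ^ 2) : IsCompact G.Q := by
  refine Metric.isCompact_of_isClosed_isBounded hG.isClosed ?_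
  rw [Metric.isBounded_iff]
  exact ⟨_, fun y hy z hz => by
    rw [dist_eq_norm]; exact norm_sub_le hp hp2 hd hx₁ hdx hD0 hD hy hz⟩

section Descent

variable {est : ℕ → Ω → Vec n → Vec n × Ξ → Vec n} {W : Vec n → ℝ} {s γ β : ℝ}
  {x : ℕ → Ω → Vec n} {α : ℕ → ℝ} {g : ℕ → Ω → Vec n → Vec n}

theorem IsMirrorDescent.mem (h : G.IsMirrorDescent d g α x₁ x) (k : ℕ) (ω : Ω) :
    x k ω ∈ G.Q := by
  cases k with
  | zero => rw [h.start]; exact h.start_mem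
  | succ k => exact (h.step k ω).1

theorem IsMirrorDescent.differentiableAt_start (hG : G.Valid)
    (h : G.IsMirrorDescent d g α x₁ x) : DifferentiableAt ℝ d x₁ := by
  have := hG.isProb
  obtain ⟨ω⟩ := nonempty_of_isProbabilityMeasure G.P
  rw [← h.start ω]
  exact h.differentiable 0 ω

/-- The new iterate minimizes `d - ⟨s, ·⟩` over `Q` for `s = ∇d(x k) - α k g k`, and this minimizer
is a continuous function of `s`. The map `fderiv ℝ d` is measurable on all of `ℝⁿ`, wherever `d` may
fail to be differentiable. -/
theorem IsMirrorDescent.measurable (hG : G.Valid) (hp : 1 ≤ p) (hp2 : p ≤ 2) (hd : IsProx p G.Q d)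
    (hQc : IsCompact G.Q) (ho : G.GoodOracle est W s γ β)
    (h : G.IsMirrorDescent d (fun k ω y => est k ω y (G.e k ω, G.ξ k ω)) α x₁ x) (k : ℕ) :
    Measurable[G.ℱ k] (x k) := by
  obtain ⟨Y, hYc, -, -, hYu⟩ := hd.exists_argmin hp hp2 hG.convex hQc ⟨x₁, h.start_mem⟩
  induction k with
  | zero =>
    rw [show x 0 = fun _ => x₁ from funext h.start]
    exact measurable_const
  | succ k ih =>
    have hstep : x (k + 1) = fun ω => Y ((InnerProductSpace.toDual ℝ (Vec n)).symm
        (fderiv ℝ d (x k ω)) - α k • G.grad est x k ω) := by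
      funext ω
      refine hYu _ _ (h.step k ω).1 fun z hz => ?_
      have hm := (h.step k ω).2 hz
      simp only [mem_ofPred_eq, bregman, map_sub, inner_sub_right] at hm
      simp only [inner_sub_left, InnerProductSpace.toDual_symm_apply]
      change _ ≤ d z - (_ - inner ℝ (α k • est k ω (x k ω) (G.e k ω, G.ξ k ω)) z)
      change d _ - (_ - inner ℝ (α k • est k ω (x k ω) (G.e k ω, G.ξ k ω)) _) ≤ _
      linarith
    rw [hstep]
    have h1 : Measurable[G.ℱ (k + 1)] (x k) := ih.mono (G.ℱ.mono k.le_succ) le_rfl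
    have h2 : Measurable[G.ℱ (k + 1)] (fun ω =>
        (InnerProductSpace.toDual ℝ (Vec n)).symm (fderiv ℝ d (x k ω))) :=
      ((InnerProductSpace.toDual ℝ (Vec n)).symm.continuous.measurable.comp
        (measurable_fderiv ℝ d)).comp h1
    have h3 := ho.measurable_grad hG ih
    exact hYc.measurable.comp (h2.sub (h3.const_smul (α k)))

/-! ### Measurability and integrability of losses and regrets -/

theorem Valid.measurable_loss_comp' (hG : G.Valid) {k : ℕ} {y : Ω → Vec n}
    (hy : Measurable[G.ℱ k] y) : Measurable (fun ω => G.loss k ω (y ω)) :=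
  (hG.measurable_loss_comp k hy).mono (G.ℱ.le k) le_rfl

theorem abs_average_le {N : ℕ} {a : ℕ → ℝ} {c : ℝ} (hc : 0 ≤ c) (ha : ∀ k, |a k| ≤ c) :
    |(1 / (N : ℝ)) * ∑ k ∈ Finset.range N, a k| ≤ c := by
  rcases Nat.eq_zero_or_pos N with h | h
  · simp [h, hc]
  have hN : (0 : ℝ) < N := by exact_mod_cast h
  rw [abs_mul, abs_of_nonneg (by positivity), one_div, inv_mul_le_iff₀ hN]
  calc |∑ k ∈ Finset.range N, a k| ≤ ∑ k ∈ Finset.range N, |a k| := Finset.abs_sum_le_sum_abs _ _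
    _ ≤ ∑ k ∈ Finset.range N, c := Finset.sum_le_sum fun k _ => ha k
    _ = N * c := by simp

variable {δ B : ℝ}

theorem lossBound_nonneg (hG : G.Valid) (hN : G.NoiseBound δ B) (hx₁ : x₁ ∈ G.Q) :
    0 ≤ (1 + B ^ 2) / 2 + δ := by
  have := hG.isProb
  obtain ⟨ω⟩ := nonempty_of_isProbabilityMeasure G.P
  exact (abs_nonneg _).trans (abs_loss_le hG hN 0 ω (G.subset_nbhd hx₁))

theorem abs_avgLoss_le (hG : G.Valid) (hN : G.NoiseBound δ B) (N : ℕ) (ω : Ω) {y : Vec n}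
    (hy : y ∈ G.Q) : |G.avgLoss N ω y| ≤ (1 + B ^ 2) / 2 + δ :=
  abs_average_le (lossBound_nonneg hG hN hy) fun k => abs_loss_le hG hN k ω (G.subset_nbhd hy)

theorem measurable_avgLoss (hG : G.Valid) (N : ℕ) (y : Vec n) :
    Measurable (fun ω => G.avgLoss N ω y) := by
  unfold avgLoss
  exact (Finset.measurable_sum _ fun k _ =>
    hG.measurable_loss_comp' (k := k) (y := fun _ => y) measurable_const).const_mul _

theorem integrable_avgLoss (hG : G.Valid) (hN : G.NoiseBound δ B) (N : ℕ) {y : Vec n}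
    (hy : y ∈ G.Q) : Integrable (fun ω => G.avgLoss N ω y) G.P := by
  have := hG.isProb
  exact Integrable.of_bound (measurable_avgLoss hG N y).aestronglyMeasurable _
    (.of_forall fun ω => abs_avgLoss_le hG hN N ω hy)

theorem measurable_incurred (hG : G.Valid) (hx : ∀ k, Measurable[G.ℱ k] (x k)) (N : ℕ) :
    Measurable (G.incurred x N) := by
  unfold incurred
  exact (Finset.measurable_sum _ fun k _ => hG.measurable_loss_comp' (hx k)).const_mul _

theorem integrable_incurred (hG : G.Valid) (hN : G.NoiseBound δ B)
    (hx : ∀ k, Measurable[G.ℱ k] (x k)) (hxQ : ∀ k ω, x k ω ∈ G.Q) (N : ℕ) :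
    Integrable (G.incurred x N) G.P := by
  have := hG.isProb
  obtain ⟨ω₀⟩ := nonempty_of_isProbabilityMeasure G.P
  exact Integrable.of_bound (measurable_incurred hG hx N).aestronglyMeasurable _
    (.of_forall fun ω => abs_average_le (lossBound_nonneg hG hN (hxQ 0 ω₀))
      fun k => abs_loss_le hG hN k ω (G.subset_nbhd (hxQ k ω)))

theorem continuousOn_avgLoss (hG : G.Valid) (h0 : 0 < G.μ₀) (N : ℕ) (ω : Ω) :
    ContinuousOn (G.avgLoss N ω) G.Q := by
  unfold avgLoss
  exact continuousOn_const.mul (continuousOn_finsetSum _ fun k _ => hG.continuousOn_loss h0 k ω)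

theorem bddBelow_avgLoss (hG : G.Valid) (hN : G.NoiseBound δ B) (N : ℕ) (ω : Ω) :
    BddBelow (G.avgLoss N ω '' G.Q) := by
  refine ⟨-((1 + B ^ 2) / 2 + δ), ?_⟩
  rintro _ ⟨y, hy, rfl⟩
  exact (abs_le.1 (abs_avgLoss_le hG hN N ω hy)).1

/-- By continuity the infimum over `Q` is an infimum over a countable dense subset. -/
theorem measurable_sInf_avgLoss (hG : G.Valid) (h0 : 0 < G.μ₀) (hN : G.NoiseBound δ B)
    (hQ : G.Q.Nonempty) (N : ℕ) : Measurable (fun ω => sInf (G.avgLoss N ω '' G.Q)) := by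
  have := hQ.to_subtype
  refine measurable_of_Iio fun c => ?_
  have : (fun ω => sInf (G.avgLoss N ω '' G.Q)) ⁻¹' Iio c =
      ⋃ i : ℕ, {ω | G.avgLoss N ω (TopologicalSpace.denseSeq G.Q i) < c} := by
    ext ω
    simp only [mem_preimage, mem_Iio, mem_iUnion, mem_ofPred_eq]
    rw [csInf_lt_iff (bddBelow_avgLoss hG hN N ω) (hQ.image _)]
    constructor
    · rintro ⟨_, ⟨y, hy, rfl⟩, hlt⟩
      have hc : Continuous (fun y : G.Q => G.avgLoss N ω y) :=
        (continuousOn_avgLoss hG h0 N ω).domRestrict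
      exact (TopologicalSpace.denseRange_denseSeq G.Q).exists_mem_open
        (isOpen_Iio.preimage hc) ⟨⟨y, hy⟩, hlt⟩
    · rintro ⟨i, hi⟩
      exact ⟨_, ⟨_, (TopologicalSpace.denseSeq G.Q i).2, rfl⟩, hi⟩
  rw [this]
  exact MeasurableSet.iUnion fun i => measurableSet_lt (measurable_avgLoss hG N _) measurable_const

theorem abs_sInf_avgLoss_le (hG : G.Valid) (hN : G.NoiseBound δ B) (hQ : G.Q.Nonempty) (N : ℕ)
    (ω : Ω) : |sInf (G.avgLoss N ω '' G.Q)| ≤ (1 + B ^ 2) / 2 + δ := by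
  obtain ⟨y, hy⟩ := hQ
  rw [abs_le]
  constructor
  · refine le_csInf ⟨_, y, hy, rfl⟩ ?_
    rintro _ ⟨z, hz, rfl⟩
    exact (abs_le.1 (abs_avgLoss_le hG hN N ω hz)).1
  · exact (csInf_le (bddBelow_avgLoss hG hN N ω) ⟨y, hy, rfl⟩).trans
      (abs_le.1 (abs_avgLoss_le hG hN N ω hy)).2

theorem integrable_regret (hG : G.Valid) (h0 : 0 < G.μ₀) (hN : G.NoiseBound δ B)
    (hx : ∀ k, Measurable[G.ℱ k] (x k)) (hxQ : ∀ k ω, x k ω ∈ G.Q) (N : ℕ) :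
    Integrable (G.regret x N) G.P := by
  have := hG.isProb
  obtain ⟨ω₀⟩ := nonempty_of_isProbabilityMeasure G.P
  have hQ : G.Q.Nonempty := ⟨_, hxQ 0 ω₀⟩
  exact (integrable_incurred hG hN hx hxQ N).sub (Integrable.of_bound
    (measurable_sInf_avgLoss hG h0 hN hQ N).aestronglyMeasurable _
    (.of_forall fun ω => abs_sInf_avgLoss_le hG hN hQ N ω))

/-- Pathwise domination of the regret by a random variable gives both regret bounds. -/
theorem convexConclusion_of_majorant (hG : G.Valid) (h0 : 0 < G.μ₀) (hN : G.NoiseBound δ B)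
    (hx : ∀ k, Measurable[G.ℱ k] (x k)) (hxQ : ∀ k ω, x k ω ∈ G.Q) {N : ℕ} {R ε : ℝ} {M : Ω → ℝ}
    (hM : Integrable M G.P) (hMε : ∫ ω, M ω ∂G.P ≤ ε)
    (hreg : ∀ ω, ∀ u ∈ G.Q, bregman d x₁ u ≤ R ^ 2 → G.incurred x N ω - G.avgLoss N ω u ≤ M ω) :
    G.ConvexConclusion d x₁ R x N ε := by
  have := hG.isProb
  refine ⟨fun h => ⟨integrable_regret hG h0 hN hx hxQ N, ?_⟩, ?_⟩
  · refine (integral_mono (integrable_regret hG h0 hN hx hxQ N) hM fun ω => ?_).trans hMε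
    obtain ⟨u, hu, hmin, hR⟩ := h ω
    have : sInf (G.avgLoss N ω '' G.Q) = G.avgLoss N ω u :=
      IsLeast.csInf_eq ⟨⟨u, hu, rfl⟩, by rintro _ ⟨z, hz, rfl⟩; exact hmin hz⟩
    rw [regret, this]
    exact hreg ω u hu hR
  · rintro ⟨u, hu, hmin, hR⟩
    have hi := integrable_incurred hG hN hx hxQ N
    have ha := integrable_avgLoss hG hN N hu
    refine ⟨hi, fun y hy => integrable_avgLoss hG hN N hy, ?_⟩
    have : sInf (G.expAvgLoss N '' G.Q) = G.expAvgLoss N u :=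
      IsLeast.csInf_eq ⟨⟨u, hu, rfl⟩, by rintro _ ⟨z, hz, rfl⟩; exact hmin hz⟩
    rw [this, expAvgLoss, ← integral_sub hi ha]
    exact (integral_mono (hi.sub ha) hM fun ω => hreg ω u hu hR).trans hMε

/-- Domination of the regret against each fixed decision in expectation. -/
theorem stronglyConvexConclusion_of_le (hG : G.Valid) (hN : G.NoiseBound δ B)
    (hx : ∀ k, Measurable[G.ℱ k] (x k)) (hxQ : ∀ k ω, x k ω ∈ G.Q) {N : ℕ} {ε : ℝ}
    (hreg : ∀ u ∈ G.Q, ∫ ω, (G.incurred x N ω - G.avgLoss N ω u) ∂G.P ≤ ε) :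
    G.StronglyConvexConclusion x N ε := by
  have := hG.isProb
  obtain ⟨ω₀⟩ := nonempty_of_isProbabilityMeasure G.P
  have hQ : G.Q.Nonempty := ⟨_, hxQ 0 ω₀⟩
  have hi := integrable_incurred hG hN hx hxQ N
  have hP : ∫ ω, G.incurred x N ω ∂G.P - sInf (G.expAvgLoss N '' G.Q) ≤ ε := by
    have : ∫ ω, G.incurred x N ω ∂G.P - ε ≤ sInf (G.expAvgLoss N '' G.Q) := by
      refine le_csInf (hQ.image _) ?_
      rintro _ ⟨u, hu, rfl⟩
      have := hreg u hu
      rw [integral_sub hi (integrable_avgLoss hG hN N hu)] at this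
      rw [expAvgLoss]
      linarith
    linarith
  refine ⟨⟨hi, fun y hy => integrable_avgLoss hG hN N hy, hP⟩, fun hind => ?_⟩
  -- Losses that ignore the past are deterministic, so the minimum in the regret is a constant and
  -- the mean of the regret is the pseudo-regret.
  have hc : ∀ ω, G.avgLoss N ω = G.expAvgLoss N := by
    intro ω
    funext y
    have : ∀ ω', G.avgLoss N ω' y = G.avgLoss N ω y := fun ω' => by
      simp only [avgLoss, hind _ ω' ω]
    simp [expAvgLoss, this]
  have hr : G.regret x N = fun ω => G.incurred x N ω - sInf (G.expAvgLoss N '' G.Q) := by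
    funext ω; rw [regret, hc]
  rw [RegretBound, hr]
  refine ⟨hi.sub (integrable_const _), ?_⟩
  rw [integral_sub hi (integrable_const _)]
  simpa using hP

end Descent

end Game

namespace Game

variable {Ω Ξ : Type*} [MeasurableSpace Ω] [MeasurableSpace Ξ] {G : Game n Ω Ξ}
  {d : Vec n → ℝ} {p D : ℝ} {x₁ : Vec n}
  {est : ℕ → Ω → Vec n → Vec n × Ξ → Vec n} {s γ β δ B : ℝ} {x : ℕ → Ω → Vec n}

/-! ### Regret of mirror descent with a good oracle -/

/-- The mirror steps telescope, and the last divergence is dropped because it is nonnegative. -/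
theorem sum_inner_grad_le (hG : G.Valid) (hp : 1 ≤ p) (hd : IsProx p G.Q d) {α : ℝ}
    (h : G.IsMirrorDescent d (fun k ω y => est k ω y (G.e k ω, G.ξ k ω)) (fun _ => α) x₁ x)
    (N : ℕ) (ω : Ω) {u : Vec n} (hu : u ∈ G.Q) :
    ∑ k ∈ Finset.range N, α * inner ℝ (G.grad est x k ω) (x k ω - u) ≤
      bregman d x₁ u + ∑ k ∈ Finset.range N, (α * dualBound p (G.grad est x k ω)) ^ 2 / 2 := by
  have key : ∑ k ∈ Finset.range N, α * inner ℝ (G.grad est x k ω) (x k ω - u) ≤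
      bregman d x₁ u - bregman d (x N ω) u +
        ∑ k ∈ Finset.range N, (α * dualBound p (G.grad est x k ω)) ^ 2 / 2 := by
    induction N with
    | zero => simp [h.start]
    | succ N ih =>
      rw [Finset.sum_range_succ, Finset.sum_range_succ]
      have h1 := hd.mirror_step hG.convex (h.mem N ω) (h.differentiable N ω)
        (h.differentiable (N + 1) ω) (h.step N ω) hu (inner_le_dualBound hp _)
      rw [dualBound_smul, inner_smul_left, mul_pow, sq_abs, ← mul_pow] at h1
      simp only [conj_trivial] at h1
      change α * inner ℝ (G.grad est x N ω) (x N ω - u) ≤ bregman d (x N ω) u -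
        bregman d (x (N + 1) ω) u + (α * dualBound p (G.grad est x N ω)) ^ 2 / 2 at h1
      linarith
  have h2 := hd.half_sq_le_bregman (h.mem N ω) hu (h.differentiable N ω)
  have h3 := sq_nonneg (lNorm p (u - x N ω))
  linarith

/-- Mirror descent and the leader each cost `R²`, hence `2 R² / (α N)`. Mirror descent contributes
`α / 2` times the squared size of the estimate; the leader contributes `α / 2` times that of `Δ`,
which is at most twice that of the estimate plus `2 s`. The mean per step is at most `(α / 2)(3 s +
2 s)`. -/
theorem convexConclusion_of_goodOracle (hn : 1 ≤ n) (hG : G.Valid) (h0 : 0 < G.μ₀)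
    (hN : G.NoiseBound δ B) (hp : 1 ≤ p) (hp2 : p ≤ 2) (hd : IsProx p G.Q d) (hD0 : 0 ≤ D)
    (hD : ∀ y ∈ G.Q, bregman d x₁ y ≤ D ^ 2) {α R ε : ℝ} (hα : 0 < α) {N : ℕ} (hN0 : 0 < N)
    (ho : G.GoodOracle est (dualBound p) s 0 β)
    (h : G.IsMirrorDescent d (fun k ω y => est k ω y (G.e k ω, G.ξ k ω)) (fun _ => α) x₁ x)
    (hε : 2 * R ^ 2 / (α * N) + 5 / 2 * α * s + β ≤ ε) : G.ConvexConclusion d x₁ R x N ε := by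
  have hP := hG.isProb
  have hW := isGauge_dualBound (n := n) hp hp2
  have hdx := h.differentiableAt_start hG
  have hQc := isCompact_Q hG hp hp2 hd h.start_mem hdx hD0 hD
  have hmx := h.measurable hG hp hp2 hd hQc ho
  have hxQ := h.mem
  have hN' : (0 : ℝ) < N := by exact_mod_cast hN0
  -- The leader is regularized by `V_{x₁}`, which is nonnegative on `Q` and at most `R²` at the
  -- comparators in question.
  obtain ⟨Y, hYc, hYQ, hYg, -⟩ :=
    (hd.bregman x₁).exists_argmin hp hp2 hG.convex hQc ⟨x₁, h.start_mem⟩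
  have hV0 : ∀ y ∈ G.Q, 0 ≤ bregman d x₁ y := fun y hy =>
    (by positivity : (0 : ℝ) ≤ lNorm p (y - x₁) ^ 2 / 2).trans
      (hd.half_sq_le_bregman h.start_mem hy hdx)
  set Δ : ℕ → Ω → Vec n := fun k ω => G.grad est x k ω - G.meanGrad est x k ω with hΔ
  -- Only `Δ j` with `j < k` enter `y k`. It is therefore known before step `k`, and the cross terms
  -- below have mean zero.
  set y : ℕ → Ω → Vec n := fun k ω => Y (∑ j ∈ Finset.range k, α • Δ j ω) with hy
  have hmΔ : ∀ k, Measurable[G.ℱ (k + 1)] (Δ k) := fun k =>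
    (ho.measurable_grad hG (hmx k)).sub
      ((ho.measurable_meanGrad hn hG (hmx k)).mono (G.ℱ.mono k.le_succ) le_rfl)
  have hmy : ∀ k, Measurable[G.ℱ k] (y k) := fun k =>
    hYc.measurable.comp (Finset.measurable_sum _ fun j hj =>
      ((hmΔ j).mono (G.ℱ.mono (Finset.mem_range.1 hj)) le_rfl).const_smul α)
  have hcross : ∀ k, Integrable (fun ω => inner ℝ (Δ k ω) (y k ω - x k ω)) G.P ∧
      ∫ ω, inner ℝ (Δ k ω) (y k ω - x k ω) ∂G.P = 0 :=
    fun k => ho.integral_inner_grad_sub hn hG hW (hmx k) (hxQ k)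
    ((hmy k).sub (hmx k)) (c := 2 * (√2 * D))
    (fun ω => norm_sub_le hp hp2 hd h.start_mem hdx hD0 hD (hYQ _) (hxQ k ω))
  have hmom := fun k => ho.gauge_grad hn hG hW (hmx k) (hxQ k)
  have hmean := fun k ω => ho.gauge_meanGrad_sq_le hn hG hW
    (fun g hg => dualBound_integral_le hg) (hxQ k) (k := k) ω
  -- No comparator occurs in the majorant: `u` has been used only through `bregman d x₁ u ≤ R ^ 2`
  -- and may depend on the realization.
  set M : Ω → ℝ := fun ω => 2 * R ^ 2 / (α * N) + β + (1 / (N : ℝ)) * ∑ k ∈ Finset.range N,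
    (α / 2 * (3 * dualBound p (G.grad est x k ω) ^ 2 + 2 * s) +
      inner ℝ (Δ k ω) (y k ω - x k ω)) with hMdef
  have hterm : ∀ k, Integrable (fun ω =>
      α / 2 * (3 * dualBound p (G.grad est x k ω) ^ 2 + 2 * s) +
      inner ℝ (Δ k ω) (y k ω - x k ω)) G.P := fun k =>
    ((((hmom k).1.const_mul 3).add (integrable_const _)).const_mul _).add (hcross k).1
  have hM : Integrable M G.P :=
    (integrable_const _).add ((integrable_finsetSum _ fun k _ => hterm k).const_mul _)
  have htermle : ∀ k, ∫ ω, (α / 2 * (3 * dualBound p (G.grad est x k ω) ^ 2 + 2 * s) +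
      inner ℝ (Δ k ω) (y k ω - x k ω)) ∂G.P ≤ 5 / 2 * α * s := by
    intro k
    have hi1 : Integrable (fun ω => 3 * dualBound p (G.grad est x k ω) ^ 2 + 2 * s) G.P :=
      ((hmom k).1.const_mul 3).add (integrable_const _)
    rw [integral_add (hi1.const_mul _) (hcross k).1, integral_const_mul,
      integral_add ((hmom k).1.const_mul 3) (integrable_const _), integral_const_mul]
    rw [(hcross k).2]
    simp only [integral_const, probReal_univ, one_smul]
    have := (hmom k).2
    have := mul_le_mul_of_nonneg_left this hα.le
    nlinarith
  refine convexConclusion_of_majorant hG h0 hN hmx hxQ hM ?_ ?_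
  · have : ∫ ω, M ω ∂G.P = 2 * R ^ 2 / (α * N) + β + (1 / (N : ℝ)) * ∑ k ∈ Finset.range N,
        ∫ ω, (α / 2 * (3 * dualBound p (G.grad est x k ω) ^ 2 + 2 * s) +
          inner ℝ (Δ k ω) (y k ω - x k ω)) ∂G.P := by
      rw [hMdef, integral_add (integrable_const _)
        ((integrable_finsetSum _ fun k _ => hterm k).const_mul _), integral_const_mul,
        integral_finsetSum _ fun k _ => hterm k]
      simp
    rw [this]
    have h2 : ∑ k ∈ Finset.range N,
        ∫ ω, (α / 2 * (3 * dualBound p (G.grad est x k ω) ^ 2 + 2 * s) +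
          inner ℝ (Δ k ω) (y k ω - x k ω)) ∂G.P ≤ N * (5 / 2 * α * s) := by
      calc _ ≤ ∑ k ∈ Finset.range N, 5 / 2 * α * s := Finset.sum_le_sum fun k _ => htermle k
        _ = _ := by simp
    have h3 : (1 / (N : ℝ)) * ∑ k ∈ Finset.range N,
        ∫ ω, (α / 2 * (3 * dualBound p (G.grad est x k ω) ^ 2 + 2 * s) +
          inner ℝ (Δ k ω) (y k ω - x k ω)) ∂G.P ≤ 5 / 2 * α * s := by
      rw [one_div, inv_mul_le_iff₀ hN']
      exact h2
    linarith
  · intro ω u hu hR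
    have h1 := sum_inner_grad_le hG hp hd h N ω hu
    have h2 := inner_sum_le_of_argmin hYQ hYg hV0 (fun k => α • Δ k ω)
      (fun k => dualBound p (α • Δ k ω)) (fun k => inner_le_dualBound hp _) x₁ hu N
    have h3 : ∀ k ∈ Finset.range N, α * (G.loss k ω (x k ω) - G.loss k ω u) ≤
        α * β + α * inner ℝ (G.meanGrad est x k ω) (x k ω - u) := by
      intro k _
      have := ho.approx k ω _ (hxQ k ω) u hu
      rw [ho.inner_meanGrad hn hG (hxQ k)] at this
      rw [zero_div, zero_mul, add_zero] at this
      nlinarith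
    -- The noise term is split at `x₁`. The part with `u` is left to the leader's bound `h2`; the
    -- part with `x k` is predictable and joins `y k` in `h5`.
    have h4 : ∀ k ∈ Finset.range N, α * inner ℝ (G.meanGrad est x k ω) (x k ω - u) =
        α * inner ℝ (G.grad est x k ω) (x k ω - u) + inner ℝ (α • Δ k ω) (u - x₁) -
          inner ℝ (α • Δ k ω) (x k ω - x₁) := by
      intro k _
      rw [add_sub_assoc, ← inner_sub_right, inner_smul_left, hΔ,
        show u - x₁ - (x k ω - x₁) = -(x k ω - u) by abel, inner_neg_right, inner_sub_left]
      simp only [conj_trivial]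
      ring
    have h5 : ∀ k ∈ Finset.range N, (inner ℝ (α • Δ k ω) (y k ω - x₁) +
        dualBound p (α • Δ k ω) ^ 2 / 2) - inner ℝ (α • Δ k ω) (x k ω - x₁) +
        (α * dualBound p (G.grad est x k ω)) ^ 2 / 2 ≤
        α * (α / 2 * (3 * dualBound p (G.grad est x k ω) ^ 2 + 2 * s) +
          inner ℝ (Δ k ω) (y k ω - x k ω)) := by
      intro k _
      have e1 : inner ℝ (α • Δ k ω) (y k ω - x₁) - inner ℝ (α • Δ k ω) (x k ω - x₁) =
          α * inner ℝ (Δ k ω) (y k ω - x k ω) := by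
        rw [← inner_sub_right, inner_smul_left, sub_sub_sub_cancel_right]
        simp
      have e2 := dualBound_sub_sq_le p (G.grad est x k ω) (G.meanGrad est x k ω)
      have e3 := hmean k ω
      have e4 : dualBound p (α • Δ k ω) ^ 2 = α ^ 2 * dualBound p (Δ k ω) ^ 2 := by
        rw [dualBound_smul, mul_pow, sq_abs]
      have e5 : dualBound p (Δ k ω) ^ 2 ≤ 2 * dualBound p (G.grad est x k ω) ^ 2 + 2 * s := by
        linarith
      rw [e4, mul_pow]
      have e6 := mul_le_mul_of_nonneg_left e5 (sq_nonneg α)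
      nlinarith
    have h3s := Finset.sum_le_sum h3
    have h4s := Finset.sum_congr rfl h4
    have h5s := Finset.sum_le_sum h5
    simp only [Finset.sum_add_distrib, Finset.sum_sub_distrib, Finset.sum_const,
      Finset.card_range, nsmul_eq_mul, ← Finset.mul_sum] at h1 h2 h3s h4s h5s
    rw [sum_inner] at h2
    have hfin : α * (∑ k ∈ Finset.range N, G.loss k ω (x k ω) -
        ∑ k ∈ Finset.range N, G.loss k ω u) ≤ N * (α * β) + 2 * R ^ 2 + α *
          (∑ k ∈ Finset.range N, (α / 2 * (3 * dualBound p (G.grad est x k ω) ^ 2 + 2 * s) +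
      inner ℝ (Δ k ω) (y k ω - x k ω))) := by
      simp only [Finset.sum_add_distrib, ← Finset.mul_sum, Finset.sum_const,
        Finset.card_range, nsmul_eq_mul]
      linarith
    rw [hMdef, incurred, avgLoss, ← mul_sub]
    have e : 2 * R ^ 2 / (α * N) + β + (1 / (N : ℝ)) * ∑ k ∈ Finset.range N,
        (α / 2 * (3 * dualBound p (G.grad est x k ω) ^ 2 + 2 * s) +
          inner ℝ (Δ k ω) (y k ω - x k ω)) = (1 / (α * N)) * (N * (α * β) + 2 * R ^ 2 + α *
          (∑ k ∈ Finset.range N, (α / 2 * (3 * dualBound p (G.grad est x k ω) ^ 2 + 2 * s) +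
      inner ℝ (Δ k ω) (y k ω - x k ω)))) := by
      field_simp
      ring
    simp only
    rw [e]
    calc _ = (1 / (α * N)) * (α * (∑ k ∈ Finset.range N, G.loss k ω (x k ω) -
        ∑ k ∈ Finset.range N, G.loss k ω u)) := by field_simp
      _ ≤ _ := by gcongr

theorem sum_one_div_le (N : ℕ) :
    ∑ k ∈ Finset.range N, 1 / ((k : ℝ) + 1) ≤ 1 + Real.log N := by
  have h := harmonic_le_one_add_log N
  rw [harmonic] at h
  push_cast at h
  simpa using h

/-- Multiplying the `k`-th mirror step by `γ (k + 1)` and subtracting the strong convexity term `γ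
V_k` leaves `γ k V_k - γ (k + 1) V_{k+1}`. This telescopes and starts from zero, so no initial
divergence remains. The second moments carry weights `1 / (k + 1)`, whence the logarithm of `N`.
Since `u` is fixed, the noise has mean zero against it. -/
theorem stronglyConvexConclusion_of_goodOracle (hn : 1 ≤ n) (hG : G.Valid)
    (hN : G.NoiseBound δ B) {c : Vec n} (hD0 : 0 ≤ D)
    (hD : ∀ y ∈ G.Q, bregman (euclideanProx c) x₁ y ≤ D ^ 2) (hγ : 0 < γ) {ε : ℝ} {N : ℕ}
    (hN0 : 0 < N) (ho : G.GoodOracle est (fun g => ‖g‖) s γ β)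
    (h : G.IsMirrorDescent (euclideanProx c) (fun k ω y => est k ω y (G.e k ω, G.ξ k ω))
      (fun k => 1 / (γ * ((k : ℝ) + 1))) x₁ x)
    (hε : s * (1 + Real.log N) / (2 * γ * N) + β ≤ ε) : G.StronglyConvexConclusion x N ε := by
  have hP := hG.isProb
  have hW := isGauge_norm (n := n)
  have hd := isProx_euclideanProx c G.Q
  have hdx := h.differentiableAt_start hG
  have hQc := isCompact_Q hG one_le_two le_rfl hd h.start_mem hdx hD0 hD
  have hmx := h.measurable hG one_le_two le_rfl hd hQc ho
  have hxQ := h.mem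
  have hN' : (0 : ℝ) < N := by exact_mod_cast hN0
  refine stronglyConvexConclusion_of_le hG hN hmx hxQ fun u hu => ?_
  have hcross := fun k => ho.integral_inner_grad_sub hn hG hW (hmx k) (hxQ k)
    ((hmx k).sub_const u) (c := 2 * (√2 * D))
    (fun ω => norm_sub_le one_le_two le_rfl hd h.start_mem hdx hD0 hD (hxQ k ω) hu)
  have hmom := fun k => ho.gauge_grad hn hG hW (hmx k) (hxQ k)
  set M : Ω → ℝ := fun ω => β + (1 / (N : ℝ)) * ∑ k ∈ Finset.range N,
    (1 / ((k : ℝ) + 1) * (1 / (2 * γ) * ‖G.grad est x k ω‖ ^ 2) -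
      inner ℝ (G.grad est x k ω - G.meanGrad est x k ω) (x k ω - u)) with hMdef
  have hterm : ∀ k : ℕ, Integrable (fun ω =>
      1 / ((k : ℝ) + 1) * (1 / (2 * γ) * ‖G.grad est x k ω‖ ^ 2) -
      inner ℝ (G.grad est x k ω - G.meanGrad est x k ω) (x k ω - u)) G.P := fun k =>
    (((hmom k).1.const_mul _).const_mul _).sub (hcross k).1
  have hM : Integrable M G.P :=
    (integrable_const _).add ((integrable_finsetSum _ fun k _ => hterm k).const_mul _)
  have htermle : ∀ k : ℕ, ∫ ω, (1 / ((k : ℝ) + 1) * (1 / (2 * γ) * ‖G.grad est x k ω‖ ^ 2) -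
      inner ℝ (G.grad est x k ω - G.meanGrad est x k ω) (x k ω - u)) ∂G.P ≤
      1 / ((k : ℝ) + 1) * (1 / (2 * γ) * s) := by
    intro k
    rw [integral_sub (((hmom k).1.const_mul _).const_mul _) (hcross k).1, (hcross k).2,
      integral_const_mul, integral_const_mul, sub_zero]
    have := (hmom k).2
    gcongr
  have hMle : ∫ ω, M ω ∂G.P ≤ ε := by
    have : ∫ ω, M ω ∂G.P = β + (1 / (N : ℝ)) * ∑ k ∈ Finset.range N,
        ∫ ω, (1 / ((k : ℝ) + 1) * (1 / (2 * γ) * ‖G.grad est x k ω‖ ^ 2) -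
      inner ℝ (G.grad est x k ω - G.meanGrad est x k ω) (x k ω - u)) ∂G.P := by
      rw [hMdef, integral_add (integrable_const _)
        ((integrable_finsetSum _ fun k _ => hterm k).const_mul _), integral_const_mul,
        integral_finsetSum _ fun k _ => hterm k]
      simp
    rw [this]
    obtain ⟨ω₀⟩ := nonempty_of_isProbabilityMeasure G.P
    have hs : 0 ≤ s := (integral_nonneg fun _ => by positivity).trans
      (ho.moment 0 ω₀ _ (hxQ 0 ω₀))
    have h2 : ∑ k ∈ Finset.range N,
        ∫ ω, (1 / ((k : ℝ) + 1) * (1 / (2 * γ) * ‖G.grad est x k ω‖ ^ 2) -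
      inner ℝ (G.grad est x k ω - G.meanGrad est x k ω) (x k ω - u)) ∂G.P ≤
        (1 + Real.log N) * (1 / (2 * γ) * s) := by
      refine (Finset.sum_le_sum fun k _ => htermle k).trans ?_
      rw [← Finset.sum_mul]
      have := sum_one_div_le N
      gcongr
    refine le_trans ?_ hε
    rw [add_comm]
    gcongr
    calc _ ≤ (1 / (N : ℝ)) * ((1 + Real.log N) * (1 / (2 * γ) * s)) := by gcongr
      _ = _ := by field_simp
  refine (integral_mono ((integrable_incurred hG hN hmx hxQ N).sub
    (integrable_avgLoss hG hN N hu)) hM fun ω => ?_).trans hMle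
  set V : ℕ → ℝ := fun k => ‖u - x k ω‖ ^ 2 / 2 with hV
  have hV0 : 0 ≤ V N := by positivity
  have h1 : ∀ k : ℕ, inner ℝ (G.grad est x k ω) (x k ω - u) ≤
      γ * (k + 1) * (V k - V (k + 1)) +
        1 / ((k : ℝ) + 1) * (1 / (2 * γ) * ‖G.grad est x k ω‖ ^ 2) := by
    intro k
    have hk : (0 : ℝ) < (k : ℝ) + 1 := by positivity
    have hst := hd.mirror_step hG.convex (h.mem k ω) (h.differentiable k ω)
      (h.differentiable (k + 1) ω) (h.step k ω) hu
      (a := ‖(1 / (γ * ((k : ℝ) + 1))) • G.grad est x k ω‖)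
      (fun v => by rw [lNorm_two]; exact real_inner_le_norm _ _)
    rw [bregman_euclideanProx, bregman_euclideanProx, inner_smul_left, norm_smul, mul_pow,
      Real.norm_eq_abs, sq_abs] at hst
    simp only [conj_trivial] at hst
    change 1 / (γ * ((k : ℝ) + 1)) * inner ℝ (G.grad est x k ω) (x k ω - u) ≤
      V k - V (k + 1) + (1 / (γ * ((k : ℝ) + 1))) ^ 2 * ‖G.grad est x k ω‖ ^ 2 / 2 at hst
    have h2 := mul_le_mul_of_nonneg_left hst (by positivity : 0 ≤ γ * ((k : ℝ) + 1))
    have e1 : γ * ((k : ℝ) + 1) * (1 / (γ * ((k : ℝ) + 1)) *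
        inner ℝ (G.grad est x k ω) (x k ω - u)) = inner ℝ (G.grad est x k ω) (x k ω - u) := by
      field_simp
    have e2 : γ * ((k : ℝ) + 1) * (V k - V (k + 1) +
        (1 / (γ * ((k : ℝ) + 1))) ^ 2 * ‖G.grad est x k ω‖ ^ 2 / 2) =
        γ * (k + 1) * (V k - V (k + 1)) +
        1 / ((k : ℝ) + 1) * (1 / (2 * γ) * ‖G.grad est x k ω‖ ^ 2) := by
      field_simp
    rw [e1, e2] at h2
    exact h2
  have h2 : ∀ k ∈ Finset.range N, G.loss k ω (x k ω) - G.loss k ω u ≤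
      (γ * k * V k - γ * ((k + 1 : ℕ) : ℝ) * V (k + 1)) + (β +
      (1 / ((k : ℝ) + 1) * (1 / (2 * γ) * ‖G.grad est x k ω‖ ^ 2) -
      inner ℝ (G.grad est x k ω - G.meanGrad est x k ω) (x k ω - u))) := by
    intro k _
    have h3 := ho.approx k ω _ (hxQ k ω) u hu
    rw [ho.inner_meanGrad hn hG (hxQ k), norm_sub_rev] at h3
    have h4 := h1 k
    rw [inner_sub_left]
    push_cast
    have e : γ / 2 * ‖u - x k ω‖ ^ 2 = γ * V k := by simp only [hV]; ring
    rw [e] at h3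
    linarith
  have h2s := Finset.sum_le_sum h2
  rw [Finset.sum_add_distrib, Finset.sum_range_sub' (fun k : ℕ => γ * (k : ℝ) * V k),
    Finset.sum_sub_distrib, Finset.sum_add_distrib, Finset.sum_const, Finset.card_range,
    nsmul_eq_mul] at h2s
  have hpos : 0 ≤ γ * (N : ℝ) * V N := by positivity
  simp only [Nat.cast_zero, mul_zero, zero_mul, zero_sub] at h2s
  rw [hMdef]
  simp only [Pi.sub_apply, incurred, avgLoss]
  rw [← mul_sub]
  calc _ ≤ (1 / (N : ℝ)) * (N * β + ∑ k ∈ Finset.range N,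
      (1 / ((k : ℝ) + 1) * (1 / (2 * γ) * ‖G.grad est x k ω‖ ^ 2) -
      inner ℝ (G.grad est x k ω - G.meanGrad est x k ω) (x k ω - u))) := by
        gcongr
        linarith
    _ = _ := by rw [mul_add, ← mul_assoc, one_div_mul_cancel hN'.ne', one_mul]

end Game

/-! ### Gauges on the sphere -/

/-- A homogeneous gauge with symmetric square, whose mean square on the sphere is at most `H`. -/
structure SphereGauge (W : Vec n → ℝ) (H : ℝ) : Prop extends IsGauge W where
  smul : ∀ t g, W (t • g) = |t| * W g
  symm : SymmWeight (fun e => W e ^ 2)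
  integral_le : ∫ e, W e ^ 2 ∂sphereUniform n ≤ H

theorem sphereGauge_norm (hn : 1 ≤ n) : SphereGauge (fun g : Vec n => ‖g‖) 1 where
  toIsGauge := isGauge_norm
  smul t g := by rw [norm_smul, Real.norm_eq_abs]
  symm :=
    { measurable := by fun_prop
      swap := fun _ _ _ => by simp only [LinearIsometryEquiv.norm_map]
      neg := fun _ _ => by simp only [LinearIsometryEquiv.norm_map]
      bound := ⟨1, fun e he => by simp [he]⟩ }
  integral_le := by
    have := isProbabilityMeasure_sphereUniform hn
    have : ∫ e, ‖e‖ ^ 2 ∂sphereUniform n = ∫ e, (1 : ℝ) ∂sphereUniform n := by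
      refine integral_congr_ae ?_
      filter_upwards [ae_norm_eq_one] with e he
      simp [he]
    rw [this]
    simp

theorem sphereGauge_dualBound (hn : 1 ≤ n) {p : ℝ} (hp : 1 ≤ p) (hp2 : p ≤ 2) :
    SphereGauge (dualBound p : Vec n → ℝ)
      ((n : ℝ) ^ twoDivQ p * (8 * (1 + Real.log n) / n)) where
  toIsGauge := isGauge_dualBound hp hp2
  smul := dualBound_smul p
  symm := by
    simp_rw [dualBound_sq]
    exact symmWeight_supNorm_sq _
  integral_le := by
    simp_rw [dualBound_sq]
    rw [integral_const_mul]
    have := integral_supNorm_sq_le hn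
    gcongr

theorem integral_inner_eq_zero (hn : 1 ≤ n) (v : Vec n) :
    ∫ e, inner ℝ e v ∂sphereUniform n = 0 := by
  have := integral_sphereUniform_comp hn (LinearIsometryEquiv.neg ℝ) (fun e => inner ℝ e v)
  simp [integral_neg] at this
  linarith

/-- Cauchy–Schwarz and `E⟨e, v⟩² = ‖v‖² / n`. The gain of `√n` over the trivial bound is why noise
of order `ε μ / (D √n)` is tolerable. -/
theorem integral_abs_inner_le (hn : 1 ≤ n) (v : Vec n) :
    ∫ e, |inner ℝ e v| ∂sphereUniform n ≤ ‖v‖ / √n := by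
  have := isProbabilityMeasure_sphereUniform hn
  have hL : MemLp (fun e => |inner ℝ e v|) 2 (sphereUniform n) := by
    refine MemLp.of_bound (Measurable.aestronglyMeasurable (by fun_prop)) ‖v‖ ?_
    filter_upwards [ae_norm_eq_one] with e he
    have := abs_real_inner_le_norm e v
    rw [he, one_mul] at this
    simpa using this
  have h := sq_integral_le_integral_sq hL
  simp_rw [sq_abs, real_inner_comm] at h
  rw [integral_inner_sq hn] at h
  simp_rw [real_inner_comm]
  apply le_of_sq_le_sq _ (by positivity)
  rw [div_pow, Real.sq_sqrt (by positivity)]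
  exact h

/-! ### Integrals over the joint law of direction and randomness -/

namespace Game

variable {Ω Ξ : Type*} [MeasurableSpace Ω] [MeasurableSpace Ξ] {G : Game n Ω Ξ}
  {μ δ B γ b : ℝ} {k : ℕ} {ω : Ω} {x : Vec n}

theorem ae_ν_norm_eq_one (G : Game n Ω Ξ) (hG : G.Valid) : ∀ᵐ z ∂G.ν, ‖z.1‖ = 1 := by
  have := hG.isProb_law
  exact (Measure.quasiMeasurePreserving_fst (μ := sphereUniform n) (ν := G.law)).ae ae_norm_eq_one

theorem add_smul_mem_nbhd (hμ : 0 < μ) (hμ₀ : μ ≤ G.μ₀) (hx : x ∈ G.Q) {e : Vec n}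
    (he : ‖e‖ ≤ 1) : x + μ • e ∈ G.nbhd := by
  refine closedBall_subset_nbhd hμ₀ hx ?_
  rw [mem_closedBall_iff_norm, add_sub_cancel_left, norm_smul, Real.norm_of_nonneg hμ.le]
  nlinarith

/-- Integration over `G.ν` with the direction outside. -/
theorem memLp_ν (hn : 1 ≤ n) (hG : G.Valid) {F : Vec n × Ξ → ℝ} (hF : Measurable F) {c : ℝ}
    (h1 : ∀ e : Vec n, ‖e‖ = 1 → MemLp (fun z => F (e, z)) 2 G.law)
    (h2 : ∀ e : Vec n, ‖e‖ = 1 → ∫ z, F (e, z) ^ 2 ∂G.law ≤ c) : MemLp F 2 G.ν := by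
  have := hG.isProb_law
  have := isProbabilityMeasure_sphereUniform hn
  rw [memLp_two_iff_integrable_sq hF.aestronglyMeasurable, ν,
    integrable_prod_iff (hF.pow_const 2).aestronglyMeasurable]
  constructor
  · filter_upwards [ae_norm_eq_one] with e he using (h1 e he).integrable_sq
  · refine Integrable.of_bound ?_ c ?_
    · exact ((hF.pow_const 2).norm.stronglyMeasurable.integral_prod_right').aestronglyMeasurable
    · filter_upwards [ae_norm_eq_one] with e he
      rw [Real.norm_of_nonneg (integral_nonneg fun _ => norm_nonneg _)]
      simpa using h2 e he

theorem integrable_sq_mul_weight (hG : G.Valid) {F : Vec n × Ξ → ℝ} (hF : MemLp F 2 G.ν)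
    {h : Vec n → ℝ} (hh : SymmWeight h) : Integrable (fun z => F z ^ 2 * h z.1) G.ν := by
  obtain ⟨c, hc⟩ := hh.bound
  refine (hF.integrable_sq).mul_bdd (c := c)
    (hh.measurable.comp measurable_fst).aestronglyMeasurable ?_
  filter_upwards [ae_ν_norm_eq_one G hG] with z hz using hc _ hz

/-- For second moments that are bounded uniformly in the direction: `ξ` is integrated first. -/
theorem integral_sq_mul_weight_le (hn : 1 ≤ n) (hG : G.Valid) {F : Vec n × Ξ → ℝ}
    (hF : MemLp F 2 G.ν) {h : Vec n → ℝ} (hh : SymmWeight h) (h0 : ∀ e, 0 ≤ h e) {c H : ℝ}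
    (hc : 0 ≤ c) (h2 : ∀ e : Vec n, ‖e‖ = 1 → ∫ z, F (e, z) ^ 2 ∂G.law ≤ c)
    (hH : ∫ e, h e ∂sphereUniform n ≤ H) : ∫ z, F z ^ 2 * h z.1 ∂G.ν ≤ c * H := by
  have := hG.isProb_law
  have := isProbabilityMeasure_sphereUniform hn
  obtain ⟨C, hC⟩ := hh.bound
  have hi : Integrable h (sphereUniform n) := integrable_sphereUniform hn hh.measurable hC
  rw [ν, integral_prod _ (integrable_sq_mul_weight hG hF hh)]
  calc _ ≤ ∫ e, c * h e ∂sphereUniform n := by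
        refine integral_mono_of_nonneg (.of_forall fun e => integral_nonneg fun z =>
          mul_nonneg (sq_nonneg _) (h0 e)) (hi.const_mul c) ?_
        filter_upwards [ae_norm_eq_one] with e he
        rw [integral_mul_const]
        exact mul_le_mul_of_nonneg_right (h2 e he) (h0 e)
    _ = c * ∫ e, h e ∂sphereUniform n := integral_const_mul _ _
    _ ≤ c * H := by gcongr

/-- For feedback that is nearly linear in the direction: here `e` is integrated first, at fixed `ξ`,
so that averaging over the sphere can be exploited. -/
theorem integral_sq_mul_weight_le' (hn : 1 ≤ n) (hG : G.Valid) {F : Vec n × Ξ → ℝ}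
    (hF : MemLp F 2 G.ν) {h : Vec n → ℝ} (hh : SymmWeight h) (h0 : ∀ e, 0 ≤ h e) {g : Ξ → ℝ}
    (hg : Integrable g G.law)
    (h2 : ∀ z, ∫ e, F (e, z) ^ 2 * h e ∂sphereUniform n ≤ g z) :
    ∫ z, F z ^ 2 * h z.1 ∂G.ν ≤ ∫ z, g z ∂G.law := by
  have := hG.isProb_law
  have := isProbabilityMeasure_sphereUniform hn
  rw [ν, integral_prod_symm _ (integrable_sq_mul_weight hG hF hh)]
  exact integral_mono_of_nonneg (.of_forall fun z => integral_nonneg fun e =>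
    mul_nonneg (sq_nonneg _) (h0 e)) hg (.of_forall h2)

/-! ### The two estimators -/

/-- The scalar factor of the one-point estimate. -/
def oneScalar (G : Game n Ω Ξ) (μ : ℝ) (k : ℕ) (ω : Ω) (x : Vec n) (z : Vec n × Ξ) : ℝ :=
  G.fNoisy k ω (x + μ • z.1) z.2

/-- The scalar factor of the two-point estimate. -/
def twoScalar (G : Game n Ω Ξ) (μ : ℝ) (k : ℕ) (ω : Ω) (x : Vec n) (z : Vec n × Ξ) : ℝ :=
  G.fNoisy k ω (x + μ • z.1) z.2 - G.fNoisy k ω x z.2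

/-- A gradient estimate in the random direction `z.1`. -/
def directional (n : ℕ) {Ξ : Type*} (μ : ℝ) (F : ℕ → Ω → Vec n → Vec n × Ξ → ℝ) (k : ℕ) (ω : Ω)
    (x : Vec n) (z : Vec n × Ξ) : Vec n := ((n : ℝ) / μ * F k ω x z) • z.1

section Measurability
variable {A : Type*} [MeasurableSpace A] {F : A × (Vec n × Ξ) → ℝ}

theorem measurable_shifted (hF : Measurable F) (μ : ℝ) :
    Measurable (fun t : A × (Vec n × (Vec n × Ξ)) => F (t.1, (t.2.1 + μ • t.2.2.1, t.2.2.2))) :=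
  hF.comp (by fun_prop)

theorem measurable_unshifted (hF : Measurable F) :
    Measurable (fun t : A × (Vec n × (Vec n × Ξ)) => F (t.1, (t.2.1, t.2.2.2))) :=
  hF.comp (by fun_prop)

theorem measurable_smul_direction {F : A × (Vec n × (Vec n × Ξ)) → ℝ} (hF : Measurable F) (c : ℝ) :
    Measurable (fun t : A × (Vec n × (Vec n × Ξ)) => (c * F t) • t.2.2.1) := by
  fun_prop

end Measurability

theorem measurable_oneScalar (hG : G.Valid) (μ : ℝ) (k : ℕ) :
    Measurable[@Prod.instMeasurableSpace Ω (Vec n × (Vec n × Ξ)) (G.ℱ k) inferInstance]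
      (fun t : Ω × (Vec n × (Vec n × Ξ)) => G.oneScalar μ k t.1 t.2.1 t.2.2) :=
  @measurable_shifted n Ξ _ Ω (G.ℱ k) _ (hG.measurable_fNoisy k) μ

theorem measurable_twoScalar (hG : G.Valid) (μ : ℝ) (k : ℕ) :
    Measurable[@Prod.instMeasurableSpace Ω (Vec n × (Vec n × Ξ)) (G.ℱ k) inferInstance]
      (fun t : Ω × (Vec n × (Vec n × Ξ)) => G.twoScalar μ k t.1 t.2.1 t.2.2) :=
  (measurable_oneScalar hG μ k).sub
    (@measurable_unshifted n Ξ _ Ω (G.ℱ k) _ (hG.measurable_fNoisy k))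

theorem memLp_oneScalar (hn : 1 ≤ n) (hG : G.Valid) (hN : G.NoiseBound δ B) (hμ : 0 < μ)
    (hμ₀ : μ ≤ G.μ₀) (k : ℕ) (ω : Ω) (hx : x ∈ G.Q) : MemLp (G.oneScalar μ k ω x) 2 G.ν :=
  memLp_ν hn hG ((hG.measurable_fNoisy_apply k ω).comp
      (f := fun z : Vec n × Ξ => (x + μ • z.1, z.2)) (by fun_prop))
    (fun _ he => hN.memLp k ω _ (add_smul_mem_nbhd hμ hμ₀ hx he.le))
    (fun _ he => hN.moment k ω _ (add_smul_mem_nbhd hμ hμ₀ hx he.le))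

theorem memLp_snd (hn : 1 ≤ n) (hG : G.Valid) {g : Ξ → ℝ} (hg : MemLp g 2 G.law) :
    MemLp (fun z : Vec n × Ξ => g z.2) 2 G.ν := by
  have := hG.isProb_law
  have := isProbabilityMeasure_sphereUniform hn
  exact hg.comp_measurePreserving (measurePreserving_snd (μ := sphereUniform n) (ν := G.law))

theorem memLp_twoScalar (hn : 1 ≤ n) (hG : G.Valid) (hN : G.NoiseBound δ B) (hμ : 0 < μ)
    (hμ₀ : μ ≤ G.μ₀) (k : ℕ) (ω : Ω) (hx : x ∈ G.Q) : MemLp (G.twoScalar μ k ω x) 2 G.ν :=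
  (memLp_oneScalar hn hG hN hμ hμ₀ k ω hx).sub
    (memLp_snd hn hG (hN.memLp k ω x (G.subset_nbhd hx)))

theorem integrable_mul_inner (hn : 1 ≤ n) (hG : G.Valid) {F : Vec n × Ξ → ℝ} (hF : MemLp F 2 G.ν)
    (v : Vec n) : Integrable (fun z => F z * inner ℝ z.1 v) G.ν := by
  have := isProbabilityMeasure_ν hn hG
  refine (hF.integrable one_le_two).mul_bdd (c := ‖v‖)
    (Measurable.aestronglyMeasurable (by fun_prop)) ?_
  filter_upwards [ae_ν_norm_eq_one G hG] with z hz
  simpa [hz] using abs_real_inner_le_norm z.1 v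

/-- The subtracted value depends on `ξ` alone, which is independent of `e`, and `E⟨e, v⟩ = 0`. -/
theorem integral_twoScalar (hn : 1 ≤ n) (hG : G.Valid) (hN : G.NoiseBound δ B) (hμ : 0 < μ)
    (hμ₀ : μ ≤ G.μ₀) (k : ℕ) (ω : Ω) (hx : x ∈ G.Q) (v : Vec n) :
    ∫ z, G.twoScalar μ k ω x z * inner ℝ z.1 v ∂G.ν =
      ∫ z, G.oneScalar μ k ω x z * inner ℝ z.1 v ∂G.ν := by
  have := hG.isProb_law
  have := isProbabilityMeasure_sphereUniform hn
  have h0 : ∫ z, G.fNoisy k ω x z.2 * inner ℝ z.1 v ∂G.ν = 0 := by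
    have := integral_prod_mul (μ := sphereUniform n) (ν := G.law)
      (fun e => inner ℝ e v) (fun z => G.fNoisy k ω x z)
    rw [integral_inner_eq_zero hn, zero_mul] at this
    rw [← this, ν]
    simp_rw [mul_comm]
  have h1 := integrable_mul_inner hn hG (memLp_oneScalar hn hG hN hμ hμ₀ k ω hx) v
  have h2 := integrable_mul_inner hn hG
    (memLp_snd hn hG (hN.memLp k ω x (G.subset_nbhd hx))) v
  have : ∀ z, G.twoScalar μ k ω x z * inner ℝ z.1 v = G.oneScalar μ k ω x z * inner ℝ z.1 v -
      G.fNoisy k ω x z.2 * inner ℝ z.1 v := fun z => by rw [twoScalar, oneScalar]; ring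
  simp_rw [this]
  rw [integral_sub h1 h2, h0, sub_zero]

/-- The losses are Lipschitz on balls of radius `μ`, and smoothing over such balls increases them
by at most `b`. -/
def Smoothable (G : Game n Ω Ξ) (μ b : ℝ) : Prop :=
  ∀ k ω, ∀ y ∈ G.Q, (∃ L, LipschitzOnWith L (G.loss k ω) (Metric.closedBall y μ)) ∧
    ∀ u : Vec n, ‖u‖ ≤ 1 →
      G.loss k ω (y + μ • u) + G.loss k ω (y + μ • (-u)) ≤ 2 * (G.loss k ω y + b)

theorem Smoothable.mono (h : G.Smoothable μ b) {b' : ℝ} (hb : b ≤ b') : G.Smoothable μ b' :=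
  fun k ω y hy => ⟨(h k ω y hy).1, fun u hu => by have := (h k ω y hy).2 u hu; linarith⟩

/-- Integrating out `ξ` replaces `f(·, ξ)` by the convex loss, to which `smoothing_inequality`
applies. The noise adds at most `(n / μ) δ E|⟨e, u - x⟩|`, and `n / √n = √n`. -/
theorem approx_oneScalar (hn : 1 ≤ n) (hG : G.Valid) (hN : G.NoiseBound δ B) (hδ : 0 ≤ δ)
    (hμ : 0 < μ) (hμ₀ : μ ≤ G.μ₀) (hγ : 0 ≤ γ) (hsc : G.StronglyConvex γ)
    (hs : G.Smoothable μ b) (k : ℕ) (ω : Ω) {u : Vec n} (hx : x ∈ G.Q) (hu : u ∈ G.Q) :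
    (n : ℝ) / μ * ∫ z, G.oneScalar μ k ω x z * inner ℝ z.1 (u - x) ∂G.ν ≤
      G.loss k ω u - G.loss k ω x + b - γ / 2 * ‖u - x‖ ^ 2 + √n * δ / μ * ‖u - x‖ := by
  have := hG.isProb_law
  have := isProbabilityMeasure_sphereUniform hn
  have := isProbabilityMeasure_ν hn hG
  have hn' : (0 : ℝ) < n := by exact_mod_cast hn
  have hfm : Measurable (fun z : Vec n × Ξ => G.f k ω (x + μ • z.1) z.2) :=
    (@measurable_section Ω (Vec n × Ξ) ℝ (G.ℱ k) _ _ _ (hG.measurable_f k) ω).comp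
      (by fun_prop : Measurable fun z : Vec n × Ξ => (x + μ • z.1, z.2))
  have hone := memLp_oneScalar hn hG hN hμ hμ₀ k ω hx
  have hdiff : ∀ᵐ z ∂G.ν, |G.oneScalar μ k ω x z - G.f k ω (x + μ • z.1) z.2| ≤ δ := by
    filter_upwards [ae_ν_norm_eq_one G hG] with z hz
    exact hN.noise k ω _ (add_smul_mem_nbhd hμ hμ₀ hx hz.le) _
  have hfL : MemLp (fun z : Vec n × Ξ => G.f k ω (x + μ • z.1) z.2) 2 G.ν := by
    have h1 : MemLp (fun z => G.oneScalar μ k ω x z - G.f k ω (x + μ • z.1) z.2) 2 G.ν :=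
      MemLp.of_bound (hone.1.sub hfm.aestronglyMeasurable) δ hdiff
    refine (hone.sub h1).congr_norm hfm.aestronglyMeasurable (.of_forall fun z => ?_)
    simp
  have hab : Integrable (fun z : Vec n × Ξ => |inner ℝ z.1 (u - x)|) G.ν := by
    refine Integrable.of_bound (Measurable.aestronglyMeasurable (by fun_prop)) ‖u - x‖ ?_
    filter_upwards [ae_ν_norm_eq_one G hG] with z hz
    simpa [hz] using abs_real_inner_le_norm z.1 (u - x)
  have habs : ∫ z, |inner ℝ z.1 (u - x)| ∂G.ν ≤ ‖u - x‖ / √n := by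
    have := integral_fun_fst (μ := sphereUniform n) (ν := G.law) (fun e => |inner ℝ e (u - x)|)
    rw [ν, this]
    simpa using integral_abs_inner_le hn (u - x)
  have h1 : ∫ z, G.oneScalar μ k ω x z * inner ℝ z.1 (u - x) ∂G.ν ≤
      ∫ e, G.loss k ω (x + μ • e) * inner ℝ e (u - x) ∂sphereUniform n + δ * (‖u - x‖ / √n) := by
    calc _ ≤ ∫ z, (G.f k ω (x + μ • z.1) z.2 * inner ℝ z.1 (u - x) +
          δ * |inner ℝ z.1 (u - x)|) ∂G.ν := by
          refine integral_mono_ae (integrable_mul_inner hn hG hone _)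
            ((integrable_mul_inner hn hG hfL _).add (hab.const_mul δ)) ?_
          filter_upwards [hdiff] with z hz
          have h2 := mul_le_mul_of_nonneg_right hz (abs_nonneg (inner ℝ z.1 (u - x)))
          rw [← abs_mul, sub_mul] at h2
          have := le_of_abs_le h2
          linarith
      _ = ∫ z, G.f k ω (x + μ • z.1) z.2 * inner ℝ z.1 (u - x) ∂G.ν +
          δ * ∫ z, |inner ℝ z.1 (u - x)| ∂G.ν := by
          rw [integral_add (integrable_mul_inner hn hG hfL _) (hab.const_mul δ),
            integral_const_mul]
      _ ≤ _ := by
          refine add_le_add (le_of_eq ?_) (by gcongr)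
          have := integrable_mul_inner hn hG hfL (u - x)
          rw [ν] at this ⊢
          rw [integral_prod _ this]
          simp_rw [integral_mul_const]
          rfl
  obtain ⟨⟨Lx, hLx⟩, -⟩ := hs k ω x hx
  obtain ⟨⟨Ly, hLy⟩, hb⟩ := hs k ω u hu
  have h2 := smoothing_inequality hn hγ (hsc k ω) hμ (closedBall_subset_nbhd hμ₀ hx)
    (closedBall_subset_nbhd hμ₀ hu) hLx hLy hb
  have h3 := mul_le_mul_of_nonneg_left h1 (by positivity : 0 ≤ (n : ℝ) / μ)
  rw [mul_add] at h3
  have h4 : (n : ℝ) / μ * (δ * (‖u - x‖ / √n)) = √n * δ / μ * ‖u - x‖ := by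
    have hs : √(n : ℝ) * √n = n := Real.mul_self_sqrt hn'.le
    have hs0 : √(n : ℝ) ≠ 0 := (Real.sqrt_pos.2 hn').ne'
    field_simp
    rw [sq, hs]
    ring
  linarith

theorem goodOracle_directional {W : Vec n → ℝ} {H s diam : ℝ} (hn : 1 ≤ n) (hG : G.Valid)
    (hN : G.NoiseBound δ B) (hδ : 0 ≤ δ) (hμ : 0 < μ) (hμ₀ : μ ≤ G.μ₀) (hγ : 0 ≤ γ)
    (hsc : G.StronglyConvex γ) (hs : G.Smoothable μ b) (hW : SphereGauge W H)
    (hdiam : ∀ x ∈ G.Q, ∀ u ∈ G.Q, ‖x - u‖ ≤ diam) {F : ℕ → Ω → Vec n → Vec n × Ξ → ℝ}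
    (hFm : ∀ k, Measurable[@Prod.instMeasurableSpace Ω (Vec n × (Vec n × Ξ)) (G.ℱ k) inferInstance]
      (fun t : Ω × (Vec n × (Vec n × Ξ)) => F k t.1 t.2.1 t.2.2))
    (hFL : ∀ k ω, ∀ x ∈ G.Q, MemLp (F k ω x) 2 G.ν)
    (hFs : ∀ k ω, ∀ x ∈ G.Q, ∫ z, F k ω x z ^ 2 * W z.1 ^ 2 ∂G.ν ≤ s)
    (hFi : ∀ k ω, ∀ x ∈ G.Q, ∀ v, ∫ z, F k ω x z * inner ℝ z.1 v ∂G.ν =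
      ∫ z, G.oneScalar μ k ω x z * inner ℝ z.1 v ∂G.ν) :
    G.GoodOracle (directional n μ F) W (((n : ℝ) / μ) ^ 2 * s) γ (b + √n * δ / μ * diam) where
  measurable k := @measurable_smul_direction n Ξ _ Ω (G.ℱ k) _ (hFm k) _
  memLp k ω x hx := by
    refine MemLp.of_le_mul (c := |(n : ℝ) / μ|) (hFL k ω x hx) ?_ ?_
    · exact ((hFL k ω x hx).1.const_mul _).smul measurable_fst.aestronglyMeasurable
    · filter_upwards [ae_ν_norm_eq_one G hG] with z hz
      rw [directional, norm_smul, hz, mul_one, norm_mul, Real.norm_eq_abs]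
  moment k ω x hx := by
    have : ∀ z, W (directional n μ F k ω x z) ^ 2 =
        ((n : ℝ) / μ) ^ 2 * (F k ω x z ^ 2 * W z.1 ^ 2) := fun z => by
      rw [directional, hW.smul, mul_pow, sq_abs]; ring
    simp_rw [this]
    rw [integral_const_mul]
    have := hFs k ω x hx
    gcongr
  approx k ω x hx u hu := by
    have h1 := approx_oneScalar hn hG hN hδ hμ hμ₀ hγ hsc hs k ω hx hu
    have h2 : ∫ z, inner ℝ (directional n μ F k ω x z) (x - u) ∂G.ν =
        -((n : ℝ) / μ * ∫ z, G.oneScalar μ k ω x z * inner ℝ z.1 (u - x) ∂G.ν) := by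
      rw [← hFi k ω x hx, ← integral_const_mul, ← integral_neg]
      congr 1
      funext z
      rw [directional, inner_smul_left, ← neg_sub u x, inner_neg_right]
      simp only [conj_trivial]
      ring
    have h3 : √n * δ / μ * ‖u - x‖ ≤ √n * δ / μ * diam := by
      have := hdiam u hu x hx
      gcongr
    rw [h2, norm_sub_rev x u]
    linarith

end Game

/-! ### Consequences of the regularity of the losses -/

/-- Along the segment, the Taylor remainder minus `l t² ‖v‖² / 2` has nonpositive derivative.
Gradients are taken within `S`, so boundary points are admitted. -/
theorem sub_sub_inner_le_of_lipschitz_gradient {S : Set (Vec n)} (hS : Convex ℝ S)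
    {φ : Vec n → ℝ} {gr : Vec n → Vec n} {l : ℝ}
    (hd : ∀ x ∈ S, HasGradientWithinAt φ (gr x) S x)
    (hl : ∀ x ∈ S, ∀ y ∈ S, ‖gr x - gr y‖ ≤ l * ‖x - y‖) {a c : Vec n} (ha : a ∈ S) (hc : c ∈ S) :
    φ c - φ a - inner ℝ (gr a) (c - a) ≤ l / 2 * ‖c - a‖ ^ 2 := by
  set v := c - a with hv
  set q : ℝ → ℝ := fun t => φ (a + t • v) - t * inner ℝ (gr a) v - l / 2 * t ^ 2 * ‖v‖ ^ 2 with hq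
  have hmem : ∀ t ∈ Icc (0 : ℝ) 1, a + t • v ∈ S := fun t ht =>
    hS.add_smul_sub_mem ha hc ht
  have hder : ∀ t ∈ Icc (0 : ℝ) 1, HasDerivWithinAt q
      (inner ℝ (gr (a + t • v)) v - inner ℝ (gr a) v - l * t * ‖v‖ ^ 2) (Icc 0 1) t := by
    intro t ht
    have h1 : HasDerivWithinAt (fun t : ℝ => a + t • v) v (Icc 0 1) t := by
      simpa using (((hasDerivAt_id t).smul_const v).const_add a).hasDerivWithinAt
    have h2 := (hd _ (hmem t ht)).hasFDerivWithinAt.comp_hasDerivWithinAt t h1 hmem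
    have h3 : HasDerivWithinAt (fun t : ℝ => t * inner ℝ (gr a) v) (inner ℝ (gr a) v) (Icc 0 1) t := by
      simpa using ((hasDerivAt_id t).mul_const (inner ℝ (gr a) v)).hasDerivWithinAt
    have h4 : HasDerivWithinAt (fun t : ℝ => l / 2 * t ^ 2 * ‖v‖ ^ 2) (l * t * ‖v‖ ^ 2)
        (Icc 0 1) t := by
      refine (((hasDerivAt_pow 2 t).const_mul (l / 2)).mul_const (‖v‖ ^ 2)).hasDerivWithinAt
        |>.congr_deriv ?_
      push_cast
      ring
    refine ((h2.sub h3).sub h4).congr_deriv ?_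
    simp
  have hanti : AntitoneOn q (Icc 0 1) := by
    refine antitoneOn_of_hasDerivWithinAt_nonpos (convex_Icc 0 1)
      (fun t ht => (hder t ht).continuousWithinAt)
      (fun t ht => (hder t (interior_subset ht)).mono interior_subset) fun t ht => ?_
    have ht' := interior_subset ht
    have h1 := hl _ (hmem t ht') a ha
    rw [add_sub_cancel_left, norm_smul, Real.norm_of_nonneg ht'.1] at h1
    have h2 := real_inner_le_norm (gr (a + t • v) - gr a) v
    rw [inner_sub_left] at h2
    have h3 := mul_le_mul_of_nonneg_right h1 (norm_nonneg v)
    nlinarith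
  have h := hanti (left_mem_Icc.2 zero_le_one) (right_mem_Icc.2 zero_le_one) zero_le_one
  simp only [hq, zero_smul, one_smul, add_zero, hv, add_sub_cancel] at h ⊢
  linarith

theorem abs_sub_sub_inner_le_of_lipschitz_gradient {S : Set (Vec n)} (hS : Convex ℝ S)
    {φ : Vec n → ℝ} {gr : Vec n → Vec n} {l : ℝ}
    (hd : ∀ x ∈ S, HasGradientWithinAt φ (gr x) S x)
    (hl : ∀ x ∈ S, ∀ y ∈ S, ‖gr x - gr y‖ ≤ l * ‖x - y‖) {a c : Vec n} (ha : a ∈ S) (hc : c ∈ S) :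
    |φ c - φ a - inner ℝ (gr a) (c - a)| ≤ l / 2 * ‖c - a‖ ^ 2 := by
  have h1 := sub_sub_inner_le_of_lipschitz_gradient hS hd hl ha hc
  have h2 := sub_sub_inner_le_of_lipschitz_gradient hS (φ := fun x => -φ x)
    (gr := fun x => -gr x) (l := l) (fun x hx => by
      rw [hasGradientWithinAt_iff_hasFDerivWithinAt, map_neg]
      exact (hd x hx).hasFDerivWithinAt.neg)
    (fun x hx y hy => by rw [neg_sub_neg, norm_sub_rev]; exact hl x hx y hy) ha hc
  rw [inner_neg_left] at h2
  rw [abs_le]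
  constructor <;> linarith

namespace Game

variable {Ω Ξ : Type*} [MeasurableSpace Ω] [MeasurableSpace Ξ] {G : Game n Ω Ξ}
  {μ δ B : ℝ} {x : Vec n}

theorem integral_le_of_integral_sq_le (hG : G.Valid) {m : Ξ → ℝ} {M : ℝ} (hM : 0 ≤ M)
    (hm : MemLp m 2 G.law) (h : ∫ z, m z ^ 2 ∂G.law ≤ M ^ 2) : ∫ z, m z ∂G.law ≤ M := by
  have := hG.isProb_law
  exact le_of_sq_le_sq ((sq_integral_le_integral_sq hm).trans h) hM

theorem integrable_f (hG : G.Valid) (hN : G.NoiseBound δ B) (k : ℕ) (ω : Ω) (hx : x ∈ G.nbhd) :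
    Integrable (G.f k ω x) G.law := by
  have := hG.isProb_law
  exact (memLp_f hG hN k ω hx).integrable one_le_two

theorem LipschitzLoss.abs_loss_sub_le (hG : G.Valid) (hN : G.NoiseBound δ B) {r M : ℝ} (hM : 0 ≤ M)
    (h : G.LipschitzLoss r M) (k : ℕ) (ω : Ω) {y : Vec n} (hx : x ∈ G.nbhd) (hy : y ∈ G.nbhd) :
    |G.loss k ω x - G.loss k ω y| ≤ M * lNorm r (x - y) := by
  have := hG.isProb_law
  obtain ⟨m, hm, hm2, hl⟩ := h k ω
  have hfx := integrable_f hG hN k ω hx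
  have hfy := integrable_f hG hN k ω hy
  calc |G.loss k ω x - G.loss k ω y| = |∫ z, (G.f k ω x z - G.f k ω y z) ∂G.law| := by
        rw [integral_sub hfx hfy]; rfl
    _ ≤ ∫ z, |G.f k ω x z - G.f k ω y z| ∂G.law := abs_integral_le_integral_abs
    _ ≤ ∫ z, m z * lNorm r (x - y) ∂G.law :=
        integral_mono (hfx.sub hfy).abs ((hm.integrable one_le_two).mul_const _)
          fun z => hl z x hx y hy
    _ = (∫ z, m z ∂G.law) * lNorm r (x - y) := integral_mul_const _ _
    _ ≤ _ := mul_le_mul_of_nonneg_right (integral_le_of_integral_sq_le hG hM hm hm2)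
        (lNorm_nonneg _ _)

theorem norm_smul_le (hμ : 0 < μ) {u : Vec n} (hu : ‖u‖ ≤ 1) : ‖μ • u‖ ≤ μ := by
  rw [norm_smul, Real.norm_of_nonneg hμ.le]
  nlinarith

theorem LipschitzLoss.smoothable (hG : G.Valid) (hN : G.NoiseBound δ B) (hμ : 0 < μ)
    (hμ₀ : μ ≤ G.μ₀) {M : ℝ} (hM : 0 ≤ M) (h : G.LipschitzLoss 2 M) : G.Smoothable μ (M * μ) := by
  intro k ω y hy
  refine ⟨⟨Real.toNNReal M, LipschitzOnWith.of_dist_le_mul fun a ha c hc => ?_⟩, fun u hu => ?_⟩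
  · have := h.abs_loss_sub_le hG hN hM k ω (closedBall_subset_nbhd hμ₀ hy ha)
      (closedBall_subset_nbhd hμ₀ hy hc)
    rw [lNorm_two] at this
    rw [Real.dist_eq, dist_eq_norm, Real.coe_toNNReal _ hM]
    exact this
  · have hu' : ‖-u‖ ≤ 1 := by rwa [norm_neg]
    have key : ∀ w : Vec n, ‖w‖ ≤ 1 → G.loss k ω (y + μ • w) ≤ G.loss k ω y + M * μ := by
      intro w hw
      have := h.abs_loss_sub_le hG hN hM k ω (add_smul_mem_nbhd hμ hμ₀ hy hw) (G.subset_nbhd hy)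
      rw [lNorm_two, add_sub_cancel_left] at this
      have h2 := mul_le_mul_of_nonneg_left (norm_smul_le hμ hw) hM
      have := (le_abs_self _).trans this
      linarith
    have := key u hu
    have := key (-u) hu'
    linarith

theorem Valid.convex_nbhd (hG : G.Valid) : Convex ℝ G.nbhd := hG.convex.cthickening _

/-- First-order Taylor expansion of smooth losses. -/
theorem SmoothLoss.exists_taylor (hG : G.Valid) {L : ℝ} (h : G.SmoothLoss L) (k : ℕ) (ω : Ω) :
    ∃ l : Ξ → ℝ, MemLp l 2 G.law ∧ ∫ z, l z ^ 2 ∂G.law ≤ L ^ 2 ∧ (∀ z, 0 ≤ l z) ∧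
      ∀ z, ∃ gr : Vec n → Vec n,
        (∀ x ∈ G.nbhd, HasGradientWithinAt (fun y => G.f k ω y z) (gr x) G.nbhd x) ∧
        (∀ x ∈ G.nbhd, ∀ y ∈ G.nbhd, ‖gr x - gr y‖ ≤ l z * ‖x - y‖) ∧
        ∀ a ∈ G.nbhd, ∀ c ∈ G.nbhd,
          |G.f k ω c z - G.f k ω a z - inner ℝ (gr a) (c - a)| ≤ l z / 2 * ‖c - a‖ ^ 2 := by
  obtain ⟨l, hl, hl2, hgr⟩ := h k ω
  -- Absolute values make the constant nonnegative without changing its second moment.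
  refine ⟨fun z => |l z|, hl.abs, by simpa using hl2, fun z => abs_nonneg _, fun z => ?_⟩
  obtain ⟨gr, hd, hlip⟩ := hgr z
  have hlip' : ∀ x ∈ G.nbhd, ∀ y ∈ G.nbhd, ‖gr x - gr y‖ ≤ |l z| * ‖x - y‖ := fun x hx y hy =>
    (hlip x hx y hy).trans (mul_le_mul_of_nonneg_right (le_abs_self _) (norm_nonneg _))
  exact ⟨gr, hd, hlip', fun a ha c hc =>
    abs_sub_sub_inner_le_of_lipschitz_gradient hG.convex_nbhd hd hlip' ha hc⟩

theorem lNorm_one (x : Vec n) : lNorm 1 x = ∑ i, |x i| := by simp [lNorm]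

/-- The symmetric second difference cancels the gradient, which gives the defect. Lipschitz
continuity of the mean needs an integrable constant, although nothing is assumed about the size of
the gradients: their coordinates at `y` are controlled by finite differences of `f` with step `μ`,
which are integrable in `ξ`. -/
theorem SmoothLoss.smoothable (hG : G.Valid) (hN : G.NoiseBound δ B) (hμ : 0 < μ)
    (hμ₀ : μ ≤ G.μ₀) {L : ℝ} (hL : 0 ≤ L) (h : G.SmoothLoss L) :
    G.Smoothable μ (L * μ ^ 2 / 2) := by
  intro k ω y hy
  have := hG.isProb_law
  obtain ⟨l, hl, hl2, hl0, hgr⟩ := h.exists_taylor hG k ω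
  have hli := hl.integrable one_le_two
  have hyn := G.subset_nbhd hy
  have hfy := integrable_f hG hN k ω hyn
  constructor
  -- The sum bounds the `l_1`-norm of the gradient at `y`. Of the extra `2 l μ`, one half moves the
  -- gradient from `y` to `c`; the other covers the remainder, since `‖a - c‖ ≤ 2 μ`.
  · set K : Ξ → ℝ := fun z => ∑ i, (|G.f k ω (y + μ • EuclideanSpace.single i (1 : ℝ)) z -
      G.f k ω y z| / μ + l z * μ) + 2 * (l z * μ) with hK
    have hone : ∀ i : Fin n, ‖EuclideanSpace.single i (1 : ℝ)‖ ≤ 1 := by simp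
    have hKi : Integrable K G.law := by
      refine (integrable_finsetSum _ fun i _ => ?_).add ((hli.mul_const _).const_mul _)
      exact (((integrable_f hG hN k ω (add_smul_mem_nbhd hμ hμ₀ hy (hone i))).sub
        hfy).abs.div_const _).add (hli.mul_const _)
    have hKb : ∀ z, ∀ a ∈ Metric.closedBall y μ, ∀ c ∈ Metric.closedBall y μ,
        |G.f k ω a z - G.f k ω c z| ≤ K z * ‖a - c‖ := by
      intro z a ha c hc
      obtain ⟨gr, -, hlip, htay⟩ := hgr z
      have han := closedBall_subset_nbhd hμ₀ hy ha
      have hcn := closedBall_subset_nbhd hμ₀ hy hc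
      rw [mem_closedBall_iff_norm] at ha hc
      have h1 : ‖gr y‖ ≤ ∑ i, (|G.f k ω (y + μ • EuclideanSpace.single i (1 : ℝ)) z -
          G.f k ω y z| / μ + l z * μ) := by
        refine (norm_le_lNorm le_rfl one_le_two _).trans ?_
        rw [lNorm_one]
        refine Finset.sum_le_sum fun i _ => ?_
        have ht := htay y hyn _ (add_smul_mem_nbhd hμ hμ₀ hy (hone i))
        rw [add_sub_cancel_left, inner_smul_right, EuclideanSpace.inner_single_right, norm_smul,
          PiLp.norm_single] at ht
        simp only [one_mul, norm_one, mul_one, Real.norm_eq_abs, sq_abs, conj_trivial] at ht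
        have h2 := abs_sub_abs_le_abs_sub (μ * gr y i)
          (G.f k ω (y + μ • EuclideanSpace.single i (1 : ℝ)) z - G.f k ω y z)
        rw [abs_sub_comm (μ * gr y i) _, abs_mul, abs_of_pos hμ] at h2
        have h3 : μ * |gr y i| ≤ |G.f k ω (y + μ • EuclideanSpace.single i (1 : ℝ)) z -
            G.f k ω y z| + l z * μ * μ := by
          have := mul_nonneg (hl0 z) (sq_nonneg μ)
          linarith
        have h4 : |gr y i| * μ ≤ (|G.f k ω (y + μ • EuclideanSpace.single i (1 : ℝ)) z -
            G.f k ω y z| / μ + l z * μ) * μ := by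
          rw [add_mul, div_mul_cancel₀ _ hμ.ne']
          linarith
        exact le_of_mul_le_mul_right h4 hμ
      have h2 : ‖gr c‖ ≤ ‖gr y‖ + l z * μ := by
        have h5 := hlip c hcn y hyn
        have h6 := mul_le_mul_of_nonneg_left hc (hl0 z)
        have h7 := norm_sub_norm_le (gr c) (gr y)
        linarith
      have h3 : ‖a - c‖ ≤ 2 * μ := by
        rw [show a - c = (a - y) - (c - y) by abel]
        exact (_root_.norm_sub_le _ _).trans (by linarith)
      have h4 := htay c hcn a han
      have h5 := abs_real_inner_le_norm (gr c) (a - c)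
      have h6 : |G.f k ω a z - G.f k ω c z| ≤
          |G.f k ω a z - G.f k ω c z - inner ℝ (gr c) (a - c)| + |inner ℝ (gr c) (a - c)| := by
        have := abs_add_le (G.f k ω a z - G.f k ω c z - inner ℝ (gr c) (a - c))
          (inner ℝ (gr c) (a - c))
        rwa [sub_add_cancel] at this
      have h7 : l z / 2 * ‖a - c‖ ^ 2 ≤ l z * μ * ‖a - c‖ := by
        have h8 := mul_le_mul_of_nonneg_right h3 (norm_nonneg (a - c))
        have h9 := mul_le_mul_of_nonneg_left h8 (hl0 z)
        linarith
      have h8 : ‖gr c‖ * ‖a - c‖ ≤ (‖gr y‖ + l z * μ) * ‖a - c‖ := by gcongr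
      have h9 : (‖gr y‖ + l z * μ) * ‖a - c‖ + l z * μ * ‖a - c‖ ≤ K z * ‖a - c‖ := by
        rw [← add_mul]
        refine mul_le_mul_of_nonneg_right ?_ (norm_nonneg _)
        simp only [hK]
        linarith
      linarith
    refine ⟨Real.toNNReal (∫ z, K z ∂G.law), LipschitzOnWith.of_dist_le_mul fun a ha c hc => ?_⟩
    have hfa := integrable_f hG hN k ω (closedBall_subset_nbhd hμ₀ hy ha)
    have hfc := integrable_f hG hN k ω (closedBall_subset_nbhd hμ₀ hy hc)
    rw [Real.dist_eq, dist_eq_norm]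
    calc |G.loss k ω a - G.loss k ω c| = |∫ z, (G.f k ω a z - G.f k ω c z) ∂G.law| := by
          rw [integral_sub hfa hfc]; rfl
      _ ≤ ∫ z, |G.f k ω a z - G.f k ω c z| ∂G.law := abs_integral_le_integral_abs
      _ ≤ ∫ z, K z * ‖a - c‖ ∂G.law :=
          integral_mono (hfa.sub hfc).abs (hKi.mul_const _) fun z => hKb z a ha c hc
      _ = (∫ z, K z ∂G.law) * ‖a - c‖ := integral_mul_const _ _
      _ ≤ _ := mul_le_mul_of_nonneg_right (Real.le_coe_toNNReal _) (norm_nonneg _)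
  · intro u hu
    have hu' : ‖-u‖ ≤ 1 := by rwa [norm_neg]
    have hp := add_smul_mem_nbhd hμ hμ₀ hy hu
    have hm := add_smul_mem_nbhd hμ hμ₀ hy hu'
    have hfp := integrable_f hG hN k ω hp
    have hfm := integrable_f hG hN k ω hm
    have hpt : ∀ z, G.f k ω (y + μ • u) z + G.f k ω (y + μ • (-u)) z ≤
        2 * G.f k ω y z + l z * μ ^ 2 := by
      intro z
      obtain ⟨gr, -, -, htay⟩ := hgr z
      have h1 := le_of_abs_le (htay y hyn _ hp)
      have h2 := le_of_abs_le (htay y hyn _ hm)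
      rw [add_sub_cancel_left] at h1 h2
      rw [smul_neg, inner_neg_right, norm_neg] at h2
      have h3 : ‖μ • u‖ ^ 2 ≤ μ ^ 2 := by
        have := norm_smul_le hμ hu
        gcongr
      have h4 := mul_le_mul_of_nonneg_left h3 (hl0 z)
      rw [smul_neg]
      linarith
    have hle := integral_mono (hfp.add hfm) ((hfy.const_mul 2).add (hli.mul_const (μ ^ 2))) hpt
    have e1 : ∫ z, (G.f k ω (y + μ • u) + G.f k ω (y + μ • (-u))) z ∂G.law =
        G.loss k ω (y + μ • u) + G.loss k ω (y + μ • (-u)) := integral_add hfp hfm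
    have e2 : ∫ z, (2 * G.f k ω y z + l z * μ ^ 2) ∂G.law =
        2 * G.loss k ω y + (∫ z, l z ∂G.law) * μ ^ 2 := by
      rw [integral_add (hfy.const_mul 2) (hli.mul_const (μ ^ 2)), integral_const_mul,
        integral_mul_const]
      rfl
    have h5 : ∫ z, (fun z => 2 * G.f k ω y z) z + l z * μ ^ 2 ∂G.law = _ := e2
    have h6 := mul_le_mul_of_nonneg_right (integral_le_of_integral_sq_le hG hL hl hl2)
      (sq_nonneg μ)
    have h7 : G.loss k ω (y + μ • u) + G.loss k ω (y + μ • (-u)) ≤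
        2 * G.loss k ω y + (∫ z, l z ∂G.law) * μ ^ 2 := by
      rw [← e1, ← e2]; exact hle
    linarith

/-! ### Second moments of the estimators -/

section Moments

variable {W : Vec n → ℝ} {H : ℝ}

theorem moment_oneScalar (hn : 1 ≤ n) (hG : G.Valid) (hN : G.NoiseBound δ B) (hμ : 0 < μ)
    (hμ₀ : μ ≤ G.μ₀) (hW : SphereGauge W H) (k : ℕ) (ω : Ω) (hx : x ∈ G.Q) :
    ∫ z, G.oneScalar μ k ω x z ^ 2 * W z.1 ^ 2 ∂G.ν ≤ B ^ 2 * H :=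
  integral_sq_mul_weight_le hn hG (memLp_oneScalar hn hG hN hμ hμ₀ k ω hx) hW.symm
    (fun _ => sq_nonneg _) (sq_nonneg B)
    (fun _ he => hN.moment k ω _ (add_smul_mem_nbhd hμ hμ₀ hx he.le)) hW.integral_le

theorem abs_twoScalar_le (hN : G.NoiseBound δ B) (hμ : 0 < μ)
    (hμ₀ : μ ≤ G.μ₀) (k : ℕ) (ω : Ω) (hx : x ∈ G.Q) {e : Vec n} (he : ‖e‖ = 1) (z : Ξ) :
    |G.twoScalar μ k ω x (e, z)| ≤ |G.f k ω (x + μ • e) z - G.f k ω x z| + 2 * δ := by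
  have h1 := hN.noise k ω _ (add_smul_mem_nbhd hμ hμ₀ hx he.le) z
  have h2 := hN.noise k ω _ (G.subset_nbhd hx) z
  rw [abs_le] at h1 h2
  have h3 := abs_le.1 (le_refl |G.f k ω (x + μ • e) z - G.f k ω x z|)
  rw [twoScalar, abs_le]
  constructor <;> linarith [h1.1, h1.2, h2.1, h2.2, h3.1, h3.2]

/-- The difference is at most `m μ ‖e‖_p + 2 δ`, and `‖e‖_p² ≤ n ^ (2 / p - 1)`. Its correlation
with the direction is ignored. -/
theorem moment_twoScalar_of_lipschitz (hn : 1 ≤ n) (hG : G.Valid) (hN : G.NoiseBound δ B)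
    (hμ : 0 < μ) (hμ₀ : μ ≤ G.μ₀) (hW : SphereGauge W H) {p M : ℝ} (hp : 1 ≤ p)
    (hp2 : p ≤ 2) (h : G.LipschitzLoss p M) (k : ℕ) (ω : Ω) (hx : x ∈ G.Q) :
    ∫ z, G.twoScalar μ k ω x z ^ 2 * W z.1 ^ 2 ∂G.ν ≤
      (2 * (μ ^ 2 * (n : ℝ) ^ (2 / p - 1) * M ^ 2) + 8 * δ ^ 2) * H := by
  have := hG.isProb_law
  obtain ⟨m, hm, hm2, hl⟩ := h k ω
  refine integral_sq_mul_weight_le hn hG (memLp_twoScalar hn hG hN hμ hμ₀ k ω hx) hW.symm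
    (fun _ => sq_nonneg _) (by positivity) (fun e he => ?_) hW.integral_le
  have hi := hm.integrable_sq
  calc ∫ z, G.twoScalar μ k ω x (e, z) ^ 2 ∂G.law
      ≤ ∫ z, (2 * (μ ^ 2 * (n : ℝ) ^ (2 / p - 1) * m z ^ 2) + 8 * δ ^ 2) ∂G.law := by
        refine integral_mono_of_nonneg (.of_forall fun z => sq_nonneg _)
          (((hi.const_mul _).const_mul _).add (integrable_const _)) (.of_forall fun z => ?_)
        have h1 := abs_twoScalar_le hN hμ hμ₀ k ω hx he z
        have h2 := hl z _ (add_smul_mem_nbhd hμ hμ₀ hx he.le) _ (G.subset_nbhd hx)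
        rw [add_sub_cancel_left, lNorm_smul hp, abs_of_pos hμ] at h2
        have h3 := lNorm_sq_le hp hp2 e
        rw [he, one_pow, mul_one] at h3
        have h4 : G.twoScalar μ k ω x (e, z) ^ 2 ≤
            (m z * (μ * lNorm p e) + 2 * δ) ^ 2 := by
          rw [← sq_abs]
          have := abs_nonneg (G.twoScalar μ k ω x (e, z))
          gcongr
          linarith
        have h5 := mul_le_mul_of_nonneg_left h3 (by positivity : 0 ≤ μ ^ 2 * m z ^ 2)
        simp only
        nlinarith [sq_nonneg (m z * (μ * lNorm p e) - 2 * δ)]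
    _ = 2 * (μ ^ 2 * (n : ℝ) ^ (2 / p - 1) * ∫ z, m z ^ 2 ∂G.law) + 8 * δ ^ 2 := by
        rw [integral_add ((hi.const_mul _).const_mul _) (integrable_const _), integral_const_mul,
          integral_const_mul]
        simp
    _ ≤ _ := by gcongr

theorem nbhd_mem_nhds (h0 : 0 < G.μ₀) (hx : x ∈ G.Q) : G.nbhd ∈ nhds x :=
  Filter.mem_of_superset (Metric.closedBall_mem_nhds x h0) (closedBall_subset_nbhd le_rfl hx)

/-- The difference is `μ ⟨∇f(x, ξ), e⟩` up to a remainder `l μ² / 2` and noise `2 δ`. On the linear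
term `SymmWeight.integral_inner_sq` gains the factor `1 / n`; the `3` comes from squaring three
summands. -/
theorem moment_twoScalar_of_smooth (hn : 1 ≤ n) (hG : G.Valid) (hN : G.NoiseBound δ B)
    (hμ : 0 < μ) (hμ₀ : μ ≤ G.μ₀) (hW : SphereGauge W H) {M L : ℝ}
    (hM : G.LipschitzLoss 2 M) (hL : G.SmoothLoss L) (k : ℕ) (ω : Ω) (hx : x ∈ G.Q) :
    ∫ z, G.twoScalar μ k ω x z ^ 2 * W z.1 ^ 2 ∂G.ν ≤
      3 * (μ ^ 2 * M ^ 2 / n + L ^ 2 * μ ^ 4 / 4 + 4 * δ ^ 2) * H := by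
  have := hG.isProb_law
  have := isProbabilityMeasure_sphereUniform hn
  obtain ⟨m, hm, hm2, hml⟩ := hM k ω
  obtain ⟨l, hl, hl2, hl0, hgr⟩ := hL.exists_taylor hG k ω
  have him := hm.integrable_sq
  have hil := hl.integrable_sq
  set I := ∫ e, W e ^ 2 ∂sphereUniform n with hI
  have hI0 : 0 ≤ I := integral_nonneg fun _ => sq_nonneg _
  have hint : Integrable (fun z =>
      3 * (μ ^ 2 / n * m z ^ 2 + μ ^ 4 / 4 * l z ^ 2 + 4 * δ ^ 2) * I) G.law :=
    ((((him.const_mul _).add (hil.const_mul _)).add (integrable_const _)).const_mul 3).mul_const I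
  have hbd : ∀ z, ∫ e, G.twoScalar μ k ω x (e, z) ^ 2 * W e ^ 2 ∂sphereUniform n ≤
      3 * (μ ^ 2 / n * m z ^ 2 + μ ^ 4 / 4 * l z ^ 2 + 4 * δ ^ 2) * I := by
    intro z
    obtain ⟨gr, hgrad, -, htay⟩ := hgr z
    have hxn := G.subset_nbhd hx
    -- `x` is interior to the neighbourhood, so the Lipschitz constant of `f(·, ξ)` bounds its
    -- gradient there.
    have hgm : ‖gr x‖ ≤ |m z| := by
      have hnh := nbhd_mem_nhds (hμ.trans_le hμ₀) hx
      have hfd := (hgrad x hxn).hasFDerivWithinAt.hasFDerivAt hnh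
      have := hfd.le_of_lip' (abs_nonneg (m z)) (by
        filter_upwards [hnh] with y hy
        have := hml z y hy x hxn
        rw [lNorm_two] at this
        exact this.trans (mul_le_mul_of_nonneg_right (le_abs_self _) (norm_nonneg _)))
      simpa using this
    have hg2 : ‖gr x‖ ^ 2 ≤ m z ^ 2 := by
      rw [← sq_abs (m z)]
      gcongr
    obtain ⟨C, hC⟩ := hW.symm.bound
    have hiW : Integrable (fun e => W e ^ 2) (sphereUniform n) :=
      integrable_sphereUniform hn hW.symm.measurable hC
    have hig : Integrable (fun e => inner ℝ (gr x) e ^ 2 * W e ^ 2) (sphereUniform n) := by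
      refine hiW.bdd_mul (c := ‖gr x‖ ^ 2) (Measurable.aestronglyMeasurable (by fun_prop)) ?_
      filter_upwards [ae_norm_eq_one] with e he
      have := abs_real_inner_le_norm (gr x) e
      rw [he, mul_one] at this
      rw [Real.norm_of_nonneg (sq_nonneg _), ← sq_abs]
      gcongr
    calc _ ≤ ∫ e, (3 * μ ^ 2 * (inner ℝ (gr x) e ^ 2 * W e ^ 2) +
          3 * (μ ^ 4 / 4 * l z ^ 2 + 4 * δ ^ 2) * W e ^ 2) ∂sphereUniform n := by
          refine integral_mono_of_nonneg (.of_forall fun e =>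
            mul_nonneg (sq_nonneg _) (sq_nonneg _))
            ((hig.const_mul _).add (hiW.const_mul _)) ?_
          filter_upwards [ae_norm_eq_one] with e he
          have h1 := abs_twoScalar_le hN hμ hμ₀ k ω hx he z
          have h2 := htay x hxn _ (add_smul_mem_nbhd hμ hμ₀ hx he.le)
          rw [add_sub_cancel_left, inner_smul_right, norm_smul, he, mul_one,
            Real.norm_of_nonneg hμ.le] at h2
          have h3 := abs_sub_abs_le_abs_sub (G.f k ω (x + μ • e) z - G.f k ω x z)
            (μ * inner ℝ (gr x) e)
          have h4 : G.twoScalar μ k ω x (e, z) ^ 2 ≤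
              (|μ * inner ℝ (gr x) e| + l z / 2 * μ ^ 2 + 2 * δ) ^ 2 := by
            rw [← sq_abs]
            have := abs_nonneg (G.twoScalar μ k ω x (e, z))
            gcongr
            linarith
          have h5 : (|μ * inner ℝ (gr x) e| + l z / 2 * μ ^ 2 + 2 * δ) ^ 2 ≤
              3 * (|μ * inner ℝ (gr x) e| ^ 2 + (l z / 2 * μ ^ 2) ^ 2 + (2 * δ) ^ 2) := by
            nlinarith [sq_nonneg (|μ * inner ℝ (gr x) e| - l z / 2 * μ ^ 2),
              sq_nonneg (|μ * inner ℝ (gr x) e| - 2 * δ), sq_nonneg (l z / 2 * μ ^ 2 - 2 * δ)]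
          rw [sq_abs] at h5
          have h6 := mul_le_mul_of_nonneg_right (h4.trans h5) (sq_nonneg (W e))
          linarith
      _ = 3 * μ ^ 2 * (‖gr x‖ ^ 2 / n * I) + 3 * (μ ^ 4 / 4 * l z ^ 2 + 4 * δ ^ 2) * I := by
          rw [integral_add (hig.const_mul _) (hiW.const_mul _), integral_const_mul,
            integral_const_mul, hW.symm.integral_inner_sq hn]
      _ ≤ 3 * μ ^ 2 * (m z ^ 2 / n * I) + 3 * (μ ^ 4 / 4 * l z ^ 2 + 4 * δ ^ 2) * I := by
          gcongr
      _ = _ := by ring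
  have h := integral_sq_mul_weight_le' hn hG (memLp_twoScalar hn hG hN hμ hμ₀ k ω hx) hW.symm
    (fun _ => sq_nonneg _) hint hbd
  refine h.trans ?_
  have hsum : Integrable (fun z => μ ^ 2 / n * m z ^ 2 + μ ^ 4 / 4 * l z ^ 2) G.law :=
    (him.const_mul _).add (hil.const_mul _)
  rw [integral_mul_const, integral_const_mul, integral_add hsum (integrable_const _), integral_add (him.const_mul _) (hil.const_mul _), integral_const_mul,
    integral_const_mul]
  simp only [integral_const, probReal_univ, one_smul]
  have hIH := hW.integral_le
  calc _ ≤ 3 * (μ ^ 2 / n * M ^ 2 + μ ^ 4 / 4 * L ^ 2 + 4 * δ ^ 2) * H := by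
        gcongr
    _ = _ := by ring

end Moments

end Game

/-! ### Elementary estimates -/

/-- The constants combine to `2 √2 / 8 = √2 / 4 < 0.36`. -/
theorem noise_bias_le (hn : 1 ≤ n) {ε δ μ D : ℝ} (hε : 0 < ε) (hμ : 0 < μ) (hD : 0 < D)
    (hδ : δ ≤ ε * μ / (8 * D * √n)) : √n * δ / μ * (2 * (√2 * D)) ≤ 36 / 100 * ε := by
  have hn' : 0 < √(n : ℝ) := Real.sqrt_pos.2 (by exact_mod_cast hn)
  have h2 : √2 ≤ 1.44 := by rw [Real.sqrt_le_left (by norm_num)]; norm_num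
  calc √n * δ / μ * (2 * (√2 * D)) ≤ √n * (ε * μ / (8 * D * √n)) / μ * (2 * (√2 * D)) := by gcongr
    _ = ε * √2 / 4 := by field_simp; ring
    _ ≤ 36 / 100 * ε := by nlinarith

/-- Unless the losses are nearly constant on `Q`, `ε` is at most of order `D M`. This converts a
noise level stated in terms of `ε` into one relative to the Lipschitz constant. -/
theorem sq_noise_div_le (hn : 1 ≤ n) {ε δ μ D M : ℝ} (hδ0 : 0 ≤ δ) (hμ : 0 < μ)
    (hD : 0 < D) (hδ : δ ≤ ε * μ / (16 * D * √n)) (hM : ε ≤ 2 * (√2 * D) * M) :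
    (δ / μ) ^ 2 ≤ M ^ 2 / (32 * n) := by
  have hn' : (0 : ℝ) < n := by exact_mod_cast hn
  have h1 : δ / μ ≤ ε / (16 * D * √n) := by
    rw [div_le_iff₀ hμ]
    exact hδ.trans_eq (by ring)
  have h2 : δ / μ ≤ √2 * M / (8 * √n) :=
    h1.trans (by
      rw [div_le_div_iff₀ (by positivity) (by positivity)]
      nlinarith [mul_le_mul_of_nonneg_left hM (Real.sqrt_nonneg n)])
  calc (δ / μ) ^ 2 ≤ (√2 * M / (8 * √n)) ^ 2 := by gcongr
    _ = M ^ 2 / (32 * n) := by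
      rw [div_pow, mul_pow, mul_pow, Real.sq_sqrt (by norm_num), Real.sq_sqrt hn'.le]
      field_simp
      ring

/-- The optimization error of mirror descent with constant steps. -/
theorem constant_step_error_le {K l A M R ε s N : ℝ} (hK : 1 ≤ K) (hl : 1 ≤ l) (hA : 0 < A)
    (hM : 0 < M) (hR : 0 < R) (hε : 0 < ε) (hN0 : 0 < N) (hAM : A ≤ K * M ^ 2)
    (hMA : M ^ 2 ≤ K * l * A) (hs : s ≤ 40 * l * A)
    (hN : 1100000 * K * l ^ 2 * (A * R ^ 2 / ε ^ 2) ≤ N) :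
    2 * R ^ 2 / (R / M * √(2 / N) * N) + 5 / 2 * (R / M * √(2 / N)) * s ≤ 14 / 100 * ε := by
  set r := √(2 / N) with hr
  have hr0 : 0 < r := Real.sqrt_pos.2 (by positivity)
  have hrN : r ^ 2 * N = 2 := by
    rw [hr, Real.sq_sqrt (by positivity)]
    field_simp
  set a := √A with ha
  have ha0 : 0 < a := Real.sqrt_pos.2 hA
  have haA : a ^ 2 = A := Real.sq_sqrt hA.le
  set k := √K with hk
  have hk0 : 0 < k := Real.sqrt_pos.2 (by linarith)
  have hkK : k ^ 2 = K := Real.sq_sqrt (by linarith)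
  have haM : a ≤ k * M := by
    apply le_of_sq_le_sq _ (by positivity)
    rw [haA, mul_pow, hkK]
    exact hAM
  have hMa : M ≤ k * l * a := by
    apply le_of_sq_le_sq _ (by positivity)
    rw [mul_pow, mul_pow, hkK, haA]
    refine hMA.trans ?_
    gcongr
    nlinarith
  have e1 : 2 * R ^ 2 / (R / M * r * N) = R * r * M := by
    rw [← hrN]
    field_simp
  have e2 : 5 / 2 * (R / M * r) * s ≤ 100 * (R * r * (l * k * a)) := by
    calc 5 / 2 * (R / M * r) * s ≤ 5 / 2 * (R / M * r) * (40 * l * A) := by gcongr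
      _ = 100 * (R * r * (l * (a * (a / M)))) := by rw [← haA]; field_simp; ring
      _ ≤ 100 * (R * r * (l * (a * k))) := by
        gcongr
        rwa [div_le_iff₀ hM]
      _ = _ := by ring
  have e3 : R * r * M ≤ R * r * (k * l * a) := by gcongr
  -- Here `101 = 1 + 100` adds up `e3` and `e2`. After squaring, `2 · 101² / 0.14²` is about `1.041
  -- · 10⁶`, which `1100000` exceeds.
  have e4 : 101 * (R * r * (k * l * a)) ≤ 14 / 100 * ε := by
    apply le_of_sq_le_sq _ (by positivity)
    have h1 : 1100000 * K * l ^ 2 * (A * R ^ 2) ≤ N * ε ^ 2 := by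
      have := mul_le_mul_of_nonneg_right hN (sq_nonneg ε)
      calc _ = 1100000 * K * l ^ 2 * (A * R ^ 2 / ε ^ 2) * ε ^ 2 := by field_simp
        _ ≤ _ := this
    have h2 : (101 * (R * r * (k * l * a))) ^ 2 = 10201 * r ^ 2 * (K * l ^ 2 * (A * R ^ 2)) := by
      rw [← hkK, ← haA]; ring
    rw [h2]
    have h3 := mul_le_mul_of_nonneg_left h1 (sq_nonneg r)
    have h4 : r ^ 2 * (N * ε ^ 2) = 2 * ε ^ 2 := by rw [← mul_assoc, hrN]
    nlinarith
  rw [e1]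
  linarith

/-- The optimization error of mirror descent with steps `1 / (γ (k + 1))`. -/
theorem harmonic_step_error_le {γ ε s N l : ℝ} (hγ : 0 < γ) (hε : 0 < ε) (hN0 : 0 < N)
    (hN : 4 * l * (s / (γ * ε)) ≤ N) : s * l / (2 * γ * N) ≤ 14 / 100 * ε := by
  rw [div_le_iff₀ (by positivity)]
  have h := mul_le_mul_of_nonneg_right hN (mul_pos hγ hε).le
  have : 4 * l * (s / (γ * ε)) * (γ * ε) = 4 * l * s := by field_simp
  rw [this] at h
  have : 0 < N * (γ * ε) := by positivity
  linarith

theorem twoDivQ_le_one {p : ℝ} (hp : 1 ≤ p) (hp2 : p ≤ 2) : twoDivQ p ≤ 1 := by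
  rw [twoDivQ]
  have : 1 / 2 ≤ 1 / p := one_div_le_one_div_of_le (by linarith) hp2
  linarith

theorem one_le_one_add_log (n : ℕ) : 1 ≤ 1 + Real.log n := by
  have := Real.log_natCast_nonneg n
  linarith

/-! ### From scalar feedback to the two conclusions -/

namespace Game

variable {Ω Ξ : Type*} [MeasurableSpace Ω] [MeasurableSpace Ξ] {G : Game n Ω Ξ}
  {d : Vec n → ℝ} {p D δ B μ ε : ℝ} {x₁ : Vec n} {x : ℕ → Ω → Vec n} {N : ℕ}

/-- `F` is a square integrable scalar feedback with the same correlations with the direction as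
the one-point feedback. -/
structure IsFeedback (G : Game n Ω Ξ) (μ : ℝ) (F : ℕ → Ω → Vec n → Vec n × Ξ → ℝ) : Prop where
  measurable : ∀ k,
    Measurable[@Prod.instMeasurableSpace Ω (Vec n × (Vec n × Ξ)) (G.ℱ k) inferInstance]
      (fun t : Ω × (Vec n × (Vec n × Ξ)) => F k t.1 t.2.1 t.2.2)
  memLp : ∀ k ω, ∀ x ∈ G.Q, MemLp (F k ω x) 2 G.ν
  integral_mul_inner : ∀ k ω, ∀ x ∈ G.Q, ∀ v, ∫ z, F k ω x z * inner ℝ z.1 v ∂G.ν =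
    ∫ z, G.oneScalar μ k ω x z * inner ℝ z.1 v ∂G.ν

theorem isFeedback_oneScalar (hn : 1 ≤ n) (hG : G.Valid) (hN : G.NoiseBound δ B) (hμ : 0 < μ)
    (hμ₀ : μ ≤ G.μ₀) : G.IsFeedback μ (G.oneScalar μ) where
  measurable := measurable_oneScalar hG μ
  memLp k ω _ hx := memLp_oneScalar hn hG hN hμ hμ₀ k ω hx
  integral_mul_inner _ _ _ _ _ := rfl

theorem isFeedback_twoScalar (hn : 1 ≤ n) (hG : G.Valid) (hN : G.NoiseBound δ B) (hμ : 0 < μ)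
    (hμ₀ : μ ≤ G.μ₀) : G.IsFeedback μ (G.twoScalar μ) where
  measurable := measurable_twoScalar hG μ
  memLp k ω _ hx := memLp_twoScalar hn hG hN hμ hμ₀ k ω hx
  integral_mul_inner k ω _ hx v := integral_twoScalar hn hG hN hμ hμ₀ k ω hx v

theorem NoiseBound.nonneg (hG : G.Valid) (hN : G.NoiseBound δ B) (hx₁ : x₁ ∈ G.Q) : 0 ≤ δ := by
  have := hG.isProb
  have := hG.isProb_law
  obtain ⟨ω⟩ := nonempty_of_isProbabilityMeasure G.P
  obtain ⟨z⟩ := nonempty_of_isProbabilityMeasure G.law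
  exact (abs_nonneg _).trans (hN.noise 0 ω x₁ (G.subset_nbhd hx₁) z)

theorem Valid.stronglyConvex_zero (hG : G.Valid) : G.StronglyConvex 0 := fun k ω =>
  strongConvexOn_zero.2 (hG.convexOn_loss k ω)

theorem smoothable_of_lipschitz (hG : G.Valid) (hN : G.NoiseBound δ B) (hμ : 0 < μ)
    (hμ₀ : μ ≤ G.μ₀) {M : ℝ} (hM : 0 < M) (h : G.LipschitzLoss 2 M) (hμM : μ ≤ ε / (2 * M)) :
    G.Smoothable μ (ε / 2) := by
  refine (h.smoothable hG hN hμ hμ₀ hM.le).mono ?_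
  rw [le_div_iff₀ (by positivity)] at hμM
  linarith

theorem smoothable_of_smooth (hG : G.Valid) (hN : G.NoiseBound δ B) (hμ : 0 < μ)
    (hμ₀ : μ ≤ G.μ₀) (hε : 0 < ε) {L : ℝ} (hL : 0 < L) (h : G.SmoothLoss L) (hμL : μ ≤ √(ε / L)) :
    G.Smoothable μ (ε / 2) := by
  refine (h.smoothable hG hN hμ hμ₀ hL.le).mono ?_
  have h1 : μ ^ 2 ≤ ε / L := by
    rw [← Real.sq_sqrt (div_pos hε hL).le]
    gcongr
  rw [le_div_iff₀ hL] at h1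
  linarith

section Conclusions

variable {F : ℕ → Ω → Vec n → Vec n × Ξ → ℝ} {s : ℝ}

/-- The bias budget `0.86 ε` consists of `ε / 2` from smoothing and `0.36 ε` from noise. -/
theorem goodOracle_of_isFeedback {W : Vec n → ℝ} {H γ : ℝ} {α : ℕ → ℝ}
    {g : ℕ → Ω → Vec n → Vec n} (hn : 1 ≤ n) (hG : G.Valid)
    (hN : G.NoiseBound δ B) (hμ : 0 < μ) (hμ₀ : μ ≤ G.μ₀) (hp : 1 ≤ p) (hp2 : p ≤ 2)
    (hd : IsProx p G.Q d) (hD0 : 0 < D) (hD : ∀ y ∈ G.Q, bregman d x₁ y ≤ D ^ 2) (hε : 0 < ε)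
    (hδ : δ ≤ ε * μ / (8 * D * √n)) (hγ : 0 ≤ γ) (hsc : G.StronglyConvex γ)
    (hs : G.Smoothable μ (ε / 2)) (hW : SphereGauge W H) (hF : G.IsFeedback μ F)
    (hFs : ∀ k ω, ∀ x ∈ G.Q, ∫ z, F k ω x z ^ 2 * W z.1 ^ 2 ∂G.ν ≤ s)
    (h : G.IsMirrorDescent d g α x₁ x) :
    ∃ β ≤ 86 / 100 * ε, G.GoodOracle (directional n μ F) W ((n / μ) ^ 2 * s) γ β := by
  have hdx := h.differentiableAt_start hG
  refine ⟨_, ?_, goodOracle_directional hn hG hN (hN.nonneg hG h.start_mem) hμ hμ₀ hγ hsc hs hW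
    (fun y hy z hz => norm_sub_le hp hp2 hd h.start_mem hdx hD0.le hD hy hz)
    hF.measurable hF.memLp hFs hF.integral_mul_inner⟩
  have := noise_bias_le hn hε hμ hD0 hδ
  linarith

/-- Common to the four convex cases: `A` stands for `M_0²`, and each case has only to bound the
second moment by `40 (1 + log n) A`. -/
theorem convexConclusion_of_isFeedback {K M R A : ℝ} (hn : 1 ≤ n) (hG : G.Valid)
    (hN : G.NoiseBound δ B) (hμ : 0 < μ) (hμ₀ : μ ≤ G.μ₀) (hp : 1 ≤ p) (hp2 : p ≤ 2)
    (hd : IsProx p G.Q d) (hD0 : 0 < D) (hD : ∀ y ∈ G.Q, bregman d x₁ y ≤ D ^ 2) (hε : 0 < ε)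
    (hδ : δ ≤ ε * μ / (8 * D * √n)) (hs : G.Smoothable μ (ε / 2)) (hF : G.IsFeedback μ F)
    (hFs : ∀ k ω, ∀ x ∈ G.Q, ∫ z, F k ω x z ^ 2 * dualBound p z.1 ^ 2 ∂G.ν ≤
      s * ((n : ℝ) ^ twoDivQ p * (8 * (1 + Real.log n) / n)))
    (hK : 1 ≤ K) (hR : 0 < R) (hM : 0 < M) (hA : 0 < A) (hAM : A ≤ K * M ^ 2)
    (hMA : M ^ 2 ≤ K * (1 + Real.log n) * A)
    (hsA : (n / μ) ^ 2 * (s * ((n : ℝ) ^ twoDivQ p * (8 * (1 + Real.log n) / n))) ≤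
      40 * (1 + Real.log n) * A)
    (hNA : 1100000 * K * (1 + Real.log n) ^ 2 * (A * R ^ 2 / ε ^ 2) ≤ N)
    (h : G.IsMirrorDescent d (fun k ω y => directional n μ F k ω y (G.e k ω, G.ξ k ω))
      (fun _ => R / M * √(2 / N)) x₁ x) : G.ConvexConclusion d x₁ R x N ε := by
  have hl := one_le_one_add_log n
  have hN0 : (0 : ℝ) < N := lt_of_lt_of_le (by positivity) hNA
  obtain ⟨β, hβ, ho⟩ := goodOracle_of_isFeedback hn hG hN hμ hμ₀ hp hp2 hd hD0 hD hε hδ le_rfl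
    hG.stronglyConvex_zero hs (sphereGauge_dualBound hn hp hp2) hF hFs h
  have := constant_step_error_le hK hl hA hM hR hε hN0 hAM hMA hsA hNA
  exact convexConclusion_of_goodOracle hn hG (hμ.trans_le hμ₀) hN hp hp2 hd hD0.le hD
    (by positivity) (by exact_mod_cast hN0) ho h (by linarith)

theorem stronglyConvexConclusion_of_isFeedback {γ : ℝ} {c : Vec n} (hn : 1 ≤ n) (hG : G.Valid)
    (hN : G.NoiseBound δ B) (hμ : 0 < μ) (hμ₀ : μ ≤ G.μ₀) (hD0 : 0 < D)
    (hD : ∀ y ∈ G.Q, bregman (euclideanProx c) x₁ y ≤ D ^ 2) (hε : 0 < ε)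
    (hδ : δ ≤ ε * μ / (8 * D * √n)) (hs : G.Smoothable μ (ε / 2)) (hF : G.IsFeedback μ F)
    (hFs : ∀ k ω, ∀ x ∈ G.Q, ∫ z, F k ω x z ^ 2 * ‖z.1‖ ^ 2 ∂G.ν ≤ s) (hγ : 0 < γ)
    (hsc : G.StronglyConvex γ) (hN0 : 0 < N)
    (hNs : 4 * (1 + Real.log N) * ((n / μ) ^ 2 * s / (γ * ε)) ≤ N)
    (h : G.IsMirrorDescent (euclideanProx c)
      (fun k ω y => directional n μ F k ω y (G.e k ω, G.ξ k ω))
      (fun k => 1 / (γ * ((k : ℝ) + 1))) x₁ x) : G.StronglyConvexConclusion x N ε := by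
  obtain ⟨β, hβ, ho⟩ := goodOracle_of_isFeedback hn hG hN hμ hμ₀ one_le_two le_rfl
    (isProx_euclideanProx c G.Q) hD0 hD hε hδ hγ.le hsc hs (sphereGauge_norm hn) hF hFs h
  have := harmonic_step_error_le hγ hε (by exact_mod_cast hN0) hNs
  exact stronglyConvexConclusion_of_goodOracle hn hG hN hD0.le hD hγ hN0 ho h (by linarith)

/-- The regret is small for trivial reasons if the losses vary little on `Q`. -/
theorem incurred_sub_avgLoss_le (hG : G.Valid) (hN : G.NoiseBound δ B) (hd : IsProx p G.Q d)
    (hdx : DifferentiableAt ℝ d x₁) (hx₁ : x₁ ∈ G.Q) (hD0 : 0 ≤ D)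
    (hD : ∀ y ∈ G.Q, bregman d x₁ y ≤ D ^ 2) {M : ℝ} (hM : 0 ≤ M) (hL : G.LipschitzLoss p M)
    (hε : 2 * (√2 * D) * M ≤ ε) (hx : ∀ k ω, x k ω ∈ G.Q) (hN0 : 0 < N) (ω : Ω) {u : Vec n}
    (hu : u ∈ G.Q) : G.incurred x N ω - G.avgLoss N ω u ≤ ε := by
  have key : ∀ k, ∀ y ∈ G.Q, |G.loss k ω y - G.loss k ω x₁| ≤ M * (√2 * D) := by
    intro k y hy
    refine (hL.abs_loss_sub_le hG hN hM k ω (G.subset_nbhd hy) (G.subset_nbhd hx₁)).trans ?_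
    gcongr
    apply le_of_sq_le_sq _ (by positivity)
    rw [mul_pow, Real.sq_sqrt (by norm_num)]
    exact lNorm_sub_sq_le hd hx₁ hdx hD hy
  have hN' : (0 : ℝ) < N := by exact_mod_cast hN0
  rw [incurred, avgLoss, ← mul_sub, ← Finset.sum_sub_distrib]
  have : ∑ k ∈ Finset.range N, (G.loss k ω (x k ω) - G.loss k ω u) ≤ N * ε := by
    calc _ ≤ ∑ k ∈ Finset.range N, ε := by
          refine Finset.sum_le_sum fun k _ => ?_
          have h1 := abs_le.1 (key k _ (hx k ω))
          have h2 := abs_le.1 (key k u hu)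
          linarith [h1.2, h2.1]
      _ = N * ε := by simp
  calc _ ≤ 1 / (N : ℝ) * (N * ε) := by gcongr
    _ = ε := by field_simp

theorem convexConclusion_of_small_variation {W : Vec n → ℝ} {s' β : ℝ} {α : ℕ → ℝ} {R M : ℝ}
    (hG : G.Valid) (hN : G.NoiseBound δ B) (h0 : 0 < G.μ₀) (hp : 1 ≤ p) (hp2 : p ≤ 2)
    (hd : IsProx p G.Q d) (hD0 : 0 ≤ D) (hD : ∀ y ∈ G.Q, bregman d x₁ y ≤ D ^ 2) (hM : 0 ≤ M)
    (hL : G.LipschitzLoss p M) (hε : 2 * (√2 * D) * M ≤ ε) (hN0 : 0 < N)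
    (ho : G.GoodOracle (directional n μ F) W s' 0 β)
    (h : G.IsMirrorDescent d (fun k ω y => directional n μ F k ω y (G.e k ω, G.ξ k ω)) α x₁ x) :
    G.ConvexConclusion d x₁ R x N ε := by
  have hP := hG.isProb
  have hdx := h.differentiableAt_start hG
  have hQc := isCompact_Q hG hp hp2 hd h.start_mem hdx hD0 hD
  exact convexConclusion_of_majorant hG h0 hN (h.measurable hG hp hp2 hd hQc ho) h.mem
    (integrable_const ε) (by simp)
    fun ω u hu _ => incurred_sub_avgLoss_le hG hN hd hdx h.start_mem hD0 hD hM hL hε h.mem hN0 ω hu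

theorem stronglyConvexConclusion_of_small_variation {W : Vec n → ℝ} {s' β γ : ℝ} {α : ℕ → ℝ}
    {M : ℝ} {c : Vec n} (hG : G.Valid) (hN : G.NoiseBound δ B) (hD0 : 0 ≤ D)
    (hD : ∀ y ∈ G.Q, bregman (euclideanProx c) x₁ y ≤ D ^ 2) (hM : 0 ≤ M)
    (hL : G.LipschitzLoss 2 M) (hε : 2 * (√2 * D) * M ≤ ε) (hN0 : 0 < N)
    (ho : G.GoodOracle (directional n μ F) W s' γ β)
    (h : G.IsMirrorDescent (euclideanProx c)
      (fun k ω y => directional n μ F k ω y (G.e k ω, G.ξ k ω)) α x₁ x) :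
    G.StronglyConvexConclusion x N ε := by
  have hP := hG.isProb
  have hd := isProx_euclideanProx c G.Q
  have hdx := h.differentiableAt_start hG
  have hQc := isCompact_Q hG one_le_two le_rfl hd h.start_mem hdx hD0 hD
  have hmx := h.measurable hG one_le_two le_rfl hd hQc ho
  refine stronglyConvexConclusion_of_le hG hN hmx h.mem fun u hu => ?_
  calc _ ≤ ∫ _, ε ∂G.P := integral_mono
        ((integrable_incurred hG hN hmx h.mem N).sub (integrable_avgLoss hG hN N hu))
        (integrable_const ε) fun ω =>
          incurred_sub_avgLoss_le hG hN hd hdx h.start_mem hD0 hD hM hL hε h.mem hN0 ω hu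
    _ = ε := by simp

end Conclusions

end Game

/-! ### The second moments of the estimates -/

theorem onePoint_moment_le (hn : 1 ≤ n) (t l : ℝ) {B μ : ℝ} (hl : 1 ≤ l) :
    (n / μ) ^ 2 * (B ^ 2 * ((n : ℝ) ^ t * (8 * l / n))) ≤
      40 * l * ((n : ℝ) ^ (1 + t) * B ^ 2 / μ ^ 2) := by
  have hn' : (0 : ℝ) < n := by exact_mod_cast hn
  rw [Real.rpow_add hn', Real.rpow_one]
  have h : 0 ≤ l * (n * (n : ℝ) ^ t * B ^ 2 / μ ^ 2) := by positivity
  calc (n / μ) ^ 2 * (B ^ 2 * ((n : ℝ) ^ t * (8 * l / n))) =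
      8 * (l * (n * (n : ℝ) ^ t * B ^ 2 / μ ^ 2)) := by field_simp
    _ ≤ _ := by linarith

/-- The exponents cancel: `n ^ (2 / p - 1) n ^ (2 / q) = n`. In the noise part `2 / q ≤ 1` suffices.
-/
theorem twoPoint_moment_le_of_lipschitz (hn : 1 ≤ n) {p l M δ μ : ℝ} (hp : 1 ≤ p) (hp2 : p ≤ 2)
    (hl : 1 ≤ l) (hμ : 0 < μ) (hδ : (δ / μ) ^ 2 ≤ M ^ 2 / (32 * n)) :
    (n / μ) ^ 2 * ((2 * (μ ^ 2 * (n : ℝ) ^ (2 / p - 1) * M ^ 2) + 8 * δ ^ 2) *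
      ((n : ℝ) ^ twoDivQ p * (8 * l / n))) ≤ 40 * l * ((n : ℝ) ^ 2 * M ^ 2) := by
  have hn1 : (1 : ℝ) ≤ n := by exact_mod_cast hn
  have hn' : (0 : ℝ) < n := by linarith
  have h1 : (n : ℝ) ^ (2 / p - 1) * (n : ℝ) ^ twoDivQ p = n := by
    rw [← Real.rpow_add hn', twoDivQ, show 2 / p - 1 + 2 * (1 - 1 / p) = 1 by ring, Real.rpow_one]
  have h2 : (n : ℝ) ^ twoDivQ p ≤ n := by
    calc (n : ℝ) ^ twoDivQ p ≤ (n : ℝ) ^ (1 : ℝ) :=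
          Real.rpow_le_rpow_of_exponent_le hn1 (twoDivQ_le_one hp hp2)
      _ = n := Real.rpow_one _
  have hl0 : 0 ≤ l := by linarith
  calc _ = 16 * l * (n * ((n : ℝ) ^ (2 / p - 1) * (n : ℝ) ^ twoDivQ p)) * M ^ 2 +
        64 * l * (n * (n : ℝ) ^ twoDivQ p) * (δ / μ) ^ 2 := by field_simp; ring
    _ ≤ 16 * l * (n * n) * M ^ 2 + 64 * l * (n * n) * (M ^ 2 / (32 * n)) := by
        rw [h1]
        gcongr
    _ = 16 * l * (n * n) * M ^ 2 + 2 * l * (n * M ^ 2) := by field_simp; ring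
    _ ≤ 16 * l * (n * n) * M ^ 2 + 2 * l * (n * n * M ^ 2) := by
        gcongr
        nlinarith
    _ ≤ 40 * l * ((n : ℝ) ^ 2 * M ^ 2) := by
        have : 0 ≤ l * ((n : ℝ) ^ 2 * M ^ 2) := by positivity
        nlinarith

/-- The conditions on `μ` and `δ` make the second and the third summand at most a third of the first
each, and `3 (1 + 1/3 + 1/3) = 5`. -/
theorem twoPoint_bracket_le_of_smooth (hn : 1 ≤ n) {M L δ μ : ℝ} (hμ : 0 < μ) (hM : 0 < M)
    (hL : 0 < L) (hδ0 : 0 ≤ δ) (hμL : μ ≤ M / L * √(4 / (3 * n))) (hδ : δ ≤ M * μ / √(12 * n)) :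
    3 * (μ ^ 2 * M ^ 2 / n + L ^ 2 * μ ^ 4 / 4 + 4 * δ ^ 2) ≤ 5 * (μ ^ 2 * M ^ 2 / n) := by
  have hn' : (0 : ℝ) < n := by exact_mod_cast hn
  have h1 : L ^ 2 * μ ^ 2 ≤ 4 * M ^ 2 / (3 * n) := by
    calc L ^ 2 * μ ^ 2 ≤ L ^ 2 * (M / L * √(4 / (3 * n))) ^ 2 := by gcongr
      _ = _ := by rw [mul_pow, Real.sq_sqrt (by positivity)]; field_simp
  have h2 : δ ^ 2 ≤ μ ^ 2 * M ^ 2 / n / 12 := by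
    calc δ ^ 2 ≤ (M * μ / √(12 * n)) ^ 2 := by gcongr
      _ = _ := by rw [div_pow, Real.sq_sqrt (by positivity)]; field_simp
  have h3 : L ^ 2 * μ ^ 4 ≤ 4 / 3 * (μ ^ 2 * M ^ 2 / n) := by
    calc L ^ 2 * μ ^ 4 = L ^ 2 * μ ^ 2 * μ ^ 2 := by ring
      _ ≤ 4 * M ^ 2 / (3 * n) * μ ^ 2 := by gcongr
      _ = _ := by field_simp
  linarith

namespace Game

variable {Ω Ξ : Type*} [MeasurableSpace Ω] [MeasurableSpace Ξ] {G : Game n Ω Ξ}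
  {d : Vec n → ℝ} {p D δ B μ ε : ℝ} {x₁ : Vec n} {x : ℕ → Ω → Vec n} {N : ℕ}

theorem smoothable_of_lipschitz_of_smooth (hG : G.Valid) (hN : G.NoiseBound δ B) (hμ : 0 < μ)
    (hμ₀ : μ ≤ G.μ₀) (hε : 0 < ε) {M L : ℝ} (hM : 0 < M) (hL : 0 < L) (h : G.LipschitzLoss 2 M)
    (h' : G.SmoothLoss L) (hμm : μ ≤ max (ε / (2 * M)) √(ε / L)) : G.Smoothable μ (ε / 2) :=
  (le_max_iff.1 hμm).elim (smoothable_of_lipschitz hG hN hμ hμ₀ hM h)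
    (smoothable_of_smooth hG hN hμ hμ₀ hε hL h')

theorem delta_le_of_le_half (hn : 1 ≤ n) (hε : 0 < ε) (hμ : 0 < μ) (hD : 0 < D)
    (hδ : δ ≤ ε * μ / (16 * D * √n)) : δ ≤ ε * μ / (8 * D * √n) := by
  have hn' : 0 < √(n : ℝ) := Real.sqrt_pos.2 (by exact_mod_cast hn)
  refine hδ.trans ?_
  gcongr
  norm_num

/-! ### Convex losses -/

section Convex

variable {K M R : ℝ}

/-- With `c` equal to `M₂² / ε²` or to `L₂ / ε`, this covers Lipschitz and smooth losses together.
The lower bound on `μ` enters through `hμc` and costs the factor `4 K²`. -/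
theorem convexConclusion_onePoint (hn : 1 ≤ n) (hG : G.Valid) (hN : G.NoiseBound δ B)
    (hB : 0 < B) (hμ : 0 < μ) (hμ₀ : μ ≤ G.μ₀) (hp : 1 ≤ p) (hp2 : p ≤ 2) (hd : IsProx p G.Q d)
    (hD0 : 0 < D) (hD : ∀ y ∈ G.Q, bregman d x₁ y ≤ D ^ 2) (hε : 0 < ε)
    (hδ : δ ≤ ε * μ / (8 * D * √n)) (hs : G.Smoothable μ (ε / 2)) (hK : 1 ≤ K) (hR : 0 < R)
    (hM : 0 < M) (hAM : (n : ℝ) ^ (1 + twoDivQ p) * B ^ 2 / μ ^ 2 ≤ K * M ^ 2)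
    (hMA : M ^ 2 ≤ K * (1 + Real.log n) * ((n : ℝ) ^ (1 + twoDivQ p) * B ^ 2 / μ ^ 2))
    {c : ℝ} (hμc : 1 / μ ^ 2 ≤ 4 * K ^ 2 * c)
    (hNA : 4400000 * K ^ 3 * (1 + Real.log n) ^ 2 *
      (c * ((n : ℝ) ^ (1 + twoDivQ p) * B ^ 2 * R ^ 2 / ε ^ 2)) ≤ N)
    (h : G.IsMirrorDescent d (G.onePoint μ) (fun _ => R / M * √(2 / N)) x₁ x) :
    G.ConvexConclusion d x₁ R x N ε := by
  have hn' : (0 : ℝ) < n := by exact_mod_cast hn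
  have hl := one_le_one_add_log n
  refine convexConclusion_of_isFeedback (F := G.oneScalar μ) (s := B ^ 2) hn hG hN hμ hμ₀ hp hp2
    hd hD0 hD hε hδ hs (isFeedback_oneScalar hn hG hN hμ hμ₀)
    (fun k ω _ hx => moment_oneScalar hn hG hN hμ hμ₀ (sphereGauge_dualBound hn hp hp2) k ω hx)
    hK hR hM (by positivity) hAM hMA (onePoint_moment_le hn _ _ hl) (le_trans ?_ hNA) h
  calc _ = 1100000 * K * (1 + Real.log n) ^ 2 * (1 / μ ^ 2 *
        ((n : ℝ) ^ (1 + twoDivQ p) * B ^ 2 * R ^ 2 / ε ^ 2)) := by ring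
    _ ≤ 1100000 * K * (1 + Real.log n) ^ 2 * (4 * K ^ 2 * c *
        ((n : ℝ) ^ (1 + twoDivQ p) * B ^ 2 * R ^ 2 / ε ^ 2)) := by gcongr
    _ = _ := by ring

theorem convexConclusion_twoPoint_of_lipschitz (hn : 1 ≤ n) (hG : G.Valid)
    (hN : G.NoiseBound δ B) (hμ : 0 < μ) (hμ₀ : μ ≤ G.μ₀) (hp : 1 ≤ p)
    (hp2 : p ≤ 2) (hd : IsProx p G.Q d) (hD0 : 0 < D) (hD : ∀ y ∈ G.Q, bregman d x₁ y ≤ D ^ 2)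
    (hε : 0 < ε) (hδ : δ ≤ ε * μ / (16 * D * √n)) (hs : G.Smoothable μ (ε / 2)) (hK : 1 ≤ K)
    (hR : 0 < R) (hM : 0 < M) {Mₚ : ℝ} (hMₚ : 0 < Mₚ) (hL : G.LipschitzLoss p Mₚ)
    (hAM : (n : ℝ) ^ 2 * Mₚ ^ 2 ≤ K * M ^ 2)
    (hMA : M ^ 2 ≤ K * (1 + Real.log n) * ((n : ℝ) ^ 2 * Mₚ ^ 2))
    (hNA : 4400000 * K ^ 3 * (1 + Real.log n) ^ 2 * (Mₚ ^ 2 * R ^ 2 * (n : ℝ) ^ 2 / ε ^ 2) ≤ N)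
    (h : G.IsMirrorDescent d (G.twoPoint μ) (fun _ => R / M * √(2 / N)) x₁ x) :
    G.ConvexConclusion d x₁ R x N ε := by
  have hn' : (0 : ℝ) < n := by exact_mod_cast hn
  have hl := one_le_one_add_log n
  have hN0 : 0 < N := by
    have : (0 : ℝ) < N := lt_of_lt_of_le (by positivity) hNA
    exact_mod_cast this
  have hW := sphereGauge_dualBound hn hp hp2
  have hF := isFeedback_twoScalar hn hG hN hμ hμ₀
  have hδ' := delta_le_of_le_half hn hε hμ hD0 hδ
  have hFs := fun k ω y (hy : y ∈ G.Q) =>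
    moment_twoScalar_of_lipschitz hn hG hN hμ hμ₀ hW hp hp2 hL k ω hy
  -- No hypothesis compares `δ` with `Mₚ` directly. If the losses vary by at most `ε` on `Q`, every
  -- sequence in `Q` has small regret, and the oracle is needed only for measurability. Otherwise `ε
  -- ≤ 2 √2 D Mₚ`, and `sq_noise_div_le` makes the noise harmless.
  rcases le_total (2 * (√2 * D) * Mₚ) ε with hc | hc
  · obtain ⟨β, -, ho⟩ := goodOracle_of_isFeedback hn hG hN hμ hμ₀ hp hp2 hd hD0 hD hε hδ' le_rfl
      hG.stronglyConvex_zero hs hW hF hFs h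
    exact convexConclusion_of_small_variation hG hN (hμ.trans_le hμ₀) hp hp2 hd hD0.le hD hMₚ.le
      hL hc hN0 ho h
  · refine convexConclusion_of_isFeedback hn hG hN hμ hμ₀ hp hp2 hd hD0 hD hε hδ' hs hF hFs
      hK hR hM (by positivity) hAM hMA (twoPoint_moment_le_of_lipschitz hn hp hp2 hl hμ
      (sq_noise_div_le hn (hN.nonneg hG h.start_mem) hμ hD0 hδ hc)) (le_trans ?_ hNA) h
    have hKK : K ≤ K ^ 3 := le_self_pow₀ hK (by norm_num)
    calc 1100000 * K * (1 + Real.log n) ^ 2 * ((n : ℝ) ^ 2 * Mₚ ^ 2 * R ^ 2 / ε ^ 2) ≤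
        4400000 * K ^ 3 * (1 + Real.log n) ^ 2 * ((n : ℝ) ^ 2 * Mₚ ^ 2 * R ^ 2 / ε ^ 2) := by
          gcongr
          norm_num
      _ = _ := by ring

theorem convexConclusion_twoPoint_of_smooth (hn : 1 ≤ n) (hG : G.Valid)
    (hN : G.NoiseBound δ B) (hμ : 0 < μ) (hμ₀ : μ ≤ G.μ₀) (hp : 1 ≤ p)
    (hp2 : p ≤ 2) (hd : IsProx p G.Q d) (hD0 : 0 < D) (hD : ∀ y ∈ G.Q, bregman d x₁ y ≤ D ^ 2)
    (hε : 0 < ε) (hδ : δ ≤ ε * μ / (16 * D * √n)) (hs : G.Smoothable μ (ε / 2)) (hK : 1 ≤ K)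
    (hR : 0 < R) (hM : 0 < M) {M₂ L₂ : ℝ} (hM₂ : 0 < M₂) (hL₂ : 0 < L₂)
    (hL : G.LipschitzLoss 2 M₂) (hS : G.SmoothLoss L₂)
    (hAM : (n : ℝ) ^ twoDivQ p * M₂ ^ 2 ≤ K * M ^ 2)
    (hMA : M ^ 2 ≤ K * (1 + Real.log n) * ((n : ℝ) ^ twoDivQ p * M₂ ^ 2))
    (hμL : μ ≤ M₂ / L₂ * √(4 / (3 * n))) (hδM : δ ≤ M₂ * μ / √(12 * n))
    (hNA : 4400000 * K ^ 3 * (1 + Real.log n) ^ 2 *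
      (M₂ ^ 2 * R ^ 2 * (n : ℝ) ^ twoDivQ p / ε ^ 2) ≤ N)
    (h : G.IsMirrorDescent d (G.twoPoint μ) (fun _ => R / M * √(2 / N)) x₁ x) :
    G.ConvexConclusion d x₁ R x N ε := by
  have hn' : (0 : ℝ) < n := by exact_mod_cast hn
  have hl := one_le_one_add_log n
  have hW := sphereGauge_dualBound hn hp hp2
  have hbr := twoPoint_bracket_le_of_smooth hn hμ hM₂ hL₂ (hN.nonneg hG h.start_mem) hμL hδM
  refine convexConclusion_of_isFeedback (F := G.twoScalar μ) hn hG hN hμ hμ₀ hp hp2 hd hD0 hD hε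
    (delta_le_of_le_half hn hε hμ hD0 hδ) hs (isFeedback_twoScalar hn hG hN hμ hμ₀)
    (fun k ω y hy => (moment_twoScalar_of_smooth hn hG hN hμ hμ₀ hW hL hS k ω hy).trans
      (mul_le_mul_of_nonneg_right hbr (by positivity)))
    hK hR hM (by positivity) hAM hMA (le_of_eq ?_) (le_trans ?_ hNA) h
  · field_simp
    ring
  · have hKK : K ≤ K ^ 3 := le_self_pow₀ hK (by norm_num)
    calc 1100000 * K * (1 + Real.log n) ^ 2 * ((n : ℝ) ^ twoDivQ p * M₂ ^ 2 * R ^ 2 / ε ^ 2) ≤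
        4400000 * K ^ 3 * (1 + Real.log n) ^ 2 *
          ((n : ℝ) ^ twoDivQ p * M₂ ^ 2 * R ^ 2 / ε ^ 2) := by
          gcongr
          norm_num
      _ = _ := by ring

end Convex

/-! ### Strongly convex losses -/

section StronglyConvex

variable {K γ : ℝ} {c : Vec n}

theorem pos_of_mul_log_le {C T : ℝ} (hC : 0 < C) (hT : 0 < T)
    (h : C * (1 + Real.log N) * T ≤ N) : 0 < N := by
  have hl := one_le_one_add_log N
  have : (0 : ℝ) < N := lt_of_lt_of_le (by positivity) h
  exact_mod_cast this

theorem stronglyConvexConclusion_onePoint (hn : 1 ≤ n) (hG : G.Valid) (hN : G.NoiseBound δ B)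
    (hB : 0 < B) (hμ : 0 < μ) (hμ₀ : μ ≤ G.μ₀) (hD0 : 0 < D)
    (hD : ∀ y ∈ G.Q, bregman (euclideanProx c) x₁ y ≤ D ^ 2) (hε : 0 < ε)
    (hδ : δ ≤ ε * μ / (8 * D * √n)) (hs : G.Smoothable μ (ε / 2)) (hK : 1 ≤ K) (hγ : 0 < γ)
    (hsc : G.StronglyConvex γ) {a : ℝ} (ha : 0 < a) (hμa : 1 / μ ^ 2 ≤ 4 * K ^ 2 * a)
    (hNA : 4400000 * K ^ 3 * (1 + Real.log N) * (a * (B ^ 2 * (n : ℝ) ^ 2 / (γ * ε))) ≤ N)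
    (h : G.IsMirrorDescent (euclideanProx c) (G.onePoint μ)
      (fun k => 1 / (γ * ((k : ℝ) + 1))) x₁ x) : G.StronglyConvexConclusion x N ε := by
  have hn' : (0 : ℝ) < n := by exact_mod_cast hn
  have hl := one_le_one_add_log N
  refine stronglyConvexConclusion_of_isFeedback (F := G.oneScalar μ) hn hG hN hμ hμ₀ hD0 hD hε hδ
    hs (isFeedback_oneScalar hn hG hN hμ hμ₀)
    (fun k ω _ hx => moment_oneScalar hn hG hN hμ hμ₀ (sphereGauge_norm hn) k ω hx)
    hγ hsc (pos_of_mul_log_le (by positivity) (by positivity) hNA) (le_trans ?_ hNA) h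
  have hKK : K ^ 2 ≤ K ^ 3 := pow_le_pow_right₀ hK (by norm_num)
  calc _ = 4 * (1 + Real.log N) * (1 / μ ^ 2 * (B ^ 2 * (n : ℝ) ^ 2 / (γ * ε))) := by ring
    _ ≤ 4 * (1 + Real.log N) * (4 * K ^ 2 * a * (B ^ 2 * (n : ℝ) ^ 2 / (γ * ε))) := by gcongr
    _ = 16 * K ^ 2 * (1 + Real.log N) * (a * (B ^ 2 * (n : ℝ) ^ 2 / (γ * ε))) := by ring
    _ ≤ _ := by
      gcongr
      norm_num

theorem stronglyConvexConclusion_twoPoint_of_lipschitz (hn : 1 ≤ n) (hG : G.Valid)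
    (hN : G.NoiseBound δ B) (hμ : 0 < μ) (hμ₀ : μ ≤ G.μ₀) (hD0 : 0 < D)
    (hD : ∀ y ∈ G.Q, bregman (euclideanProx c) x₁ y ≤ D ^ 2) (hε : 0 < ε)
    (hδ : δ ≤ ε * μ / (16 * D * √n)) (hs : G.Smoothable μ (ε / 2)) (hK : 1 ≤ K) (hγ : 0 < γ)
    (hsc : G.StronglyConvex γ) {M₂ : ℝ} (hM₂ : 0 < M₂) (hL : G.LipschitzLoss 2 M₂)
    (hNA : 4400000 * K ^ 3 * (1 + Real.log N) * (M₂ ^ 2 * (n : ℝ) ^ 2 / (γ * ε)) ≤ N)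
    (h : G.IsMirrorDescent (euclideanProx c) (G.twoPoint μ)
      (fun k => 1 / (γ * ((k : ℝ) + 1))) x₁ x) : G.StronglyConvexConclusion x N ε := by
  have hn1 : (1 : ℝ) ≤ n := by exact_mod_cast hn
  have hn' : (0 : ℝ) < n := by linarith
  have hl := one_le_one_add_log N
  have hN0 : 0 < N := pos_of_mul_log_le (by positivity) (by positivity) hNA
  have hW := sphereGauge_norm hn
  have hF := isFeedback_twoScalar hn hG hN hμ hμ₀
  have hδ' := delta_le_of_le_half hn hε hμ hD0 hδ
  have hFs := fun k ω y (hy : y ∈ G.Q) =>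
    moment_twoScalar_of_lipschitz hn hG hN hμ hμ₀ hW one_le_two le_rfl hL k ω hy
  rcases le_total (2 * (√2 * D) * M₂) ε with hc | hc
  · obtain ⟨β, -, ho⟩ := goodOracle_of_isFeedback hn hG hN hμ hμ₀ one_le_two le_rfl
      (isProx_euclideanProx c G.Q) hD0 hD hε hδ' hγ.le hsc hs hW hF hFs h
    exact stronglyConvexConclusion_of_small_variation hG hN hD0.le hD hM₂.le hL hc hN0 ho h
  · refine stronglyConvexConclusion_of_isFeedback hn hG hN hμ hμ₀ hD0 hD hε hδ' hs hF hFs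
      hγ hsc hN0 (le_trans ?_ hNA) h
    have hsq := sq_noise_div_le hn (hN.nonneg hG h.start_mem) hμ hD0 hδ hc
    have h1 : (δ / μ) ^ 2 ≤ M₂ ^ 2 / 8 := hsq.trans (by gcongr; linarith)
    have h2 : (n / μ) ^ 2 * ((2 * (μ ^ 2 * (n : ℝ) ^ ((2 : ℝ) / 2 - 1) * M₂ ^ 2) + 8 * δ ^ 2) * 1)
        ≤ 3 * (M₂ ^ 2 * (n : ℝ) ^ 2) := by
      rw [show (2 : ℝ) / 2 - 1 = 0 by norm_num, Real.rpow_zero]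
      calc _ = (n : ℝ) ^ 2 * (2 * M₂ ^ 2 + 8 * (δ / μ) ^ 2) := by field_simp
        _ ≤ (n : ℝ) ^ 2 * (2 * M₂ ^ 2 + 8 * (M₂ ^ 2 / 8)) := by gcongr
        _ = _ := by ring
    have hKK : 1 ≤ K ^ 3 := one_le_pow₀ hK
    calc _ ≤ 4 * (1 + Real.log N) * (3 * (M₂ ^ 2 * (n : ℝ) ^ 2) / (γ * ε)) := by gcongr
      _ = 12 * 1 * (1 + Real.log N) * (M₂ ^ 2 * (n : ℝ) ^ 2 / (γ * ε)) := by ring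
      _ ≤ _ := by
        gcongr
        norm_num

theorem stronglyConvexConclusion_twoPoint_of_smooth (hn : 1 ≤ n) (hG : G.Valid)
    (hN : G.NoiseBound δ B) (hμ : 0 < μ) (hμ₀ : μ ≤ G.μ₀) (hD0 : 0 < D)
    (hD : ∀ y ∈ G.Q, bregman (euclideanProx c) x₁ y ≤ D ^ 2) (hε : 0 < ε)
    (hδ : δ ≤ ε * μ / (16 * D * √n)) (hs : G.Smoothable μ (ε / 2)) (hK : 1 ≤ K) (hγ : 0 < γ)
    (hsc : G.StronglyConvex γ) {M₂ L₂ : ℝ} (hM₂ : 0 < M₂) (hL₂ : 0 < L₂)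
    (hL : G.LipschitzLoss 2 M₂) (hS : G.SmoothLoss L₂)
    (hμL : μ ≤ M₂ / L₂ * √(4 / (3 * n))) (hδM : δ ≤ M₂ * μ / √(12 * n))
    (hNA : 4400000 * K ^ 3 * (1 + Real.log N) * (M₂ ^ 2 * (n : ℝ) / (γ * ε)) ≤ N)
    (h : G.IsMirrorDescent (euclideanProx c) (G.twoPoint μ)
      (fun k => 1 / (γ * ((k : ℝ) + 1))) x₁ x) : G.StronglyConvexConclusion x N ε := by
  have hn' : (0 : ℝ) < n := by exact_mod_cast hn
  have hl := one_le_one_add_log N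
  have hbr := twoPoint_bracket_le_of_smooth hn hμ hM₂ hL₂ (hN.nonneg hG h.start_mem) hμL hδM
  refine stronglyConvexConclusion_of_isFeedback (F := G.twoScalar μ) hn hG hN hμ hμ₀ hD0 hD hε
    (delta_le_of_le_half hn hε hμ hD0 hδ) hs (isFeedback_twoScalar hn hG hN hμ hμ₀)
    (fun k ω y hy => (moment_twoScalar_of_smooth hn hG hN hμ hμ₀ (sphereGauge_norm hn) hL hS k ω
      hy).trans (mul_le_mul_of_nonneg_right hbr zero_le_one))
    hγ hsc (pos_of_mul_log_le (by positivity) (by positivity) hNA) (le_trans ?_ hNA) h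
  have hKK : 1 ≤ K ^ 3 := one_le_pow₀ hK
  calc _ = 20 * 1 * (1 + Real.log N) * (M₂ ^ 2 * (n : ℝ) / (γ * ε)) := by field_simp; ring
    _ ≤ _ := by
      gcongr
      norm_num

end StronglyConvex

end Game

/-! ### Lower bounds for the smoothing radius and assembly of the cases -/

theorem one_div_sq_le_of_lipschitz {K M ε μ : ℝ} (hμ : 0 < μ) (hε : 0 < ε) (hM : 0 < M)
    (h : ε / (2 * M) ≤ K * μ) : 1 / μ ^ 2 ≤ 4 * K ^ 2 * (M ^ 2 / ε ^ 2) := by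
  rw [div_le_iff₀ (by positivity)] at h
  have h2 : ε ^ 2 ≤ (K * μ * (2 * M)) ^ 2 := by gcongr
  rw [div_le_iff₀ (by positivity)]
  calc 1 = ε ^ 2 / ε ^ 2 := by field_simp
    _ ≤ (K * μ * (2 * M)) ^ 2 / ε ^ 2 := by gcongr
    _ = _ := by ring

theorem one_div_sq_le_of_smooth {K L ε μ : ℝ} (hμ : 0 < μ) (hε : 0 < ε) (hL : 0 < L)
    (h : √(ε / L) ≤ K * μ) : 1 / μ ^ 2 ≤ 4 * K ^ 2 * (L / ε) := by
  have h1 : ε / L ≤ (K * μ) ^ 2 := by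
    rw [← Real.sq_sqrt (div_pos hε hL).le]
    gcongr
  rw [div_le_iff₀ (by positivity)]
  calc 1 = L / ε * (ε / L) := by field_simp
    _ ≤ L / ε * (K * μ) ^ 2 := by gcongr
    -- The factor `4` is given away, for a common form with the Lipschitz case.
    _ ≤ 4 * (L / ε * (K * μ) ^ 2) := le_mul_of_one_le_left (by positivity) (by norm_num)
    _ = _ := by ring

end BanditMD

end

theorem mainTheorem1 (K : ℝ) (hK : 1 ≤ K) :
    ∃ C : ℝ, 0 < C ∧
    ∀ (n : ℕ) (Ω Ξ : Type*) [MeasurableSpace Ω] [MeasurableSpace Ξ] (G : Game n Ω Ξ)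
      (ε δ B μ D : ℝ) (x₁ : Vec n) (N : ℕ) (x : ℕ → Ω → Vec n),
    1 ≤ n → G.Valid → 0 < ε → 0 < B → 0 < D → 0 < μ → μ ≤ G.μ₀ → G.NoiseBound δ B →
    -- convex losses, `l_p` prox-structure
    (∀ (p R M : ℝ) (d : Vec n → ℝ),
      1 ≤ p → p ≤ 2 → IsProx p G.Q d → (∀ y ∈ G.Q, bregman d x₁ y ≤ D ^ 2) → 0 < R → 0 < M →
      -- one-point feedback
      ((G.IsMirrorDescent d (G.onePoint μ) (fun _ => R / M * √(2 / N)) x₁ x →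
          δ ≤ ε * μ / (8 * D * √n) →
          (n : ℝ) ^ (1 + twoDivQ p) * B ^ 2 / μ ^ 2 ≤ K * M ^ 2 →
          M ^ 2 ≤ K * (1 + Real.log n) * ((n : ℝ) ^ (1 + twoDivQ p) * B ^ 2 / μ ^ 2) →
          (∀ M₂ : ℝ, 0 < M₂ → G.LipschitzLoss 2 M₂ →
            μ ≤ ε / (2 * M₂) → ε / (2 * M₂) ≤ K * μ →
            C * (1 + Real.log n) ^ 2 *
              (B ^ 2 * M₂ ^ 2 * R ^ 2 * (n : ℝ) ^ (1 + twoDivQ p) / ε ^ 4) ≤ N →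
            G.ConvexConclusion d x₁ R x N ε) ∧
          (∀ L₂ : ℝ, 0 < L₂ → G.SmoothLoss L₂ →
            μ ≤ √(ε / L₂) → √(ε / L₂) ≤ K * μ →
            C * (1 + Real.log n) ^ 2 *
              (B ^ 2 * L₂ * R ^ 2 * (n : ℝ) ^ (1 + twoDivQ p) / ε ^ 3) ≤ N →
            G.ConvexConclusion d x₁ R x N ε)) ∧
      -- two-point feedback
        (G.IsMirrorDescent d (G.twoPoint μ) (fun _ => R / M * √(2 / N)) x₁ x →
          δ ≤ ε * μ / (16 * D * √n) →
          (∀ M₂ Mₚ : ℝ, 0 < M₂ → 0 < Mₚ → G.LipschitzLoss 2 M₂ → G.LipschitzLoss p Mₚ →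
            (n : ℝ) ^ 2 * Mₚ ^ 2 ≤ K * M ^ 2 →
            M ^ 2 ≤ K * (1 + Real.log n) * ((n : ℝ) ^ 2 * Mₚ ^ 2) →
            μ ≤ ε / (2 * M₂) →
            C * (1 + Real.log n) ^ 2 * (Mₚ ^ 2 * R ^ 2 * (n : ℝ) ^ 2 / ε ^ 2) ≤ N →
            G.ConvexConclusion d x₁ R x N ε) ∧
          (∀ M₂ L₂ : ℝ, 0 < M₂ → 0 < L₂ → G.LipschitzLoss 2 M₂ → G.SmoothLoss L₂ →
            (n : ℝ) ^ twoDivQ p * M₂ ^ 2 ≤ K * M ^ 2 →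
            M ^ 2 ≤ K * (1 + Real.log n) * ((n : ℝ) ^ twoDivQ p * M₂ ^ 2) →
            μ ≤ min (max (ε / (2 * M₂)) √(ε / L₂)) (M₂ / L₂ * √(4 / (3 * n))) →
            δ ≤ M₂ * μ / √(12 * n) →
            C * (1 + Real.log n) ^ 2 *
              (M₂ ^ 2 * R ^ 2 * (n : ℝ) ^ twoDivQ p / ε ^ 2) ≤ N →
            G.ConvexConclusion d x₁ R x N ε)))) ∧
    -- strongly convex losses, Euclidean prox-structure (`p = 2`)
    (∀ (γ : ℝ) (c : Vec n),
      0 < γ → G.StronglyConvex γ → (∀ y ∈ G.Q, bregman (euclideanProx c) x₁ y ≤ D ^ 2) →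
      -- one-point feedback
      ((G.IsMirrorDescent (euclideanProx c) (G.onePoint μ)
            (fun k => 1 / (γ * ((k : ℝ) + 1))) x₁ x →
          δ ≤ ε * μ / (8 * D * √n) →
          (∀ M₂ : ℝ, 0 < M₂ → G.LipschitzLoss 2 M₂ →
            μ ≤ ε / (2 * M₂) → ε / (2 * M₂) ≤ K * μ →
            C * (1 + Real.log N) * (B ^ 2 * M₂ ^ 2 * (n : ℝ) ^ 2 / (γ * ε ^ 3)) ≤ N →
            G.StronglyConvexConclusion x N ε) ∧
          (∀ L₂ : ℝ, 0 < L₂ → G.SmoothLoss L₂ →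
            μ ≤ √(ε / L₂) → √(ε / L₂) ≤ K * μ →
            C * (1 + Real.log N) * (B ^ 2 * L₂ * (n : ℝ) ^ 2 / (γ * ε ^ 2)) ≤ N →
            G.StronglyConvexConclusion x N ε)) ∧
      -- two-point feedback
        (G.IsMirrorDescent (euclideanProx c) (G.twoPoint μ)
            (fun k => 1 / (γ * ((k : ℝ) + 1))) x₁ x →
          δ ≤ ε * μ / (16 * D * √n) →
          (∀ M₂ : ℝ, 0 < M₂ → G.LipschitzLoss 2 M₂ →
            μ ≤ ε / (2 * M₂) →
            C * (1 + Real.log N) * (M₂ ^ 2 * (n : ℝ) ^ 2 / (γ * ε)) ≤ N →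
            G.StronglyConvexConclusion x N ε) ∧
          (∀ M₂ L₂ : ℝ, 0 < M₂ → 0 < L₂ → G.LipschitzLoss 2 M₂ → G.SmoothLoss L₂ →
            μ ≤ min (max (ε / (2 * M₂)) √(ε / L₂)) (M₂ / L₂ * √(4 / (3 * n))) →
            δ ≤ M₂ * μ / √(12 * n) →
            C * (1 + Real.log N) * (M₂ ^ 2 * (n : ℝ) / (γ * ε)) ≤ N →
            G.StronglyConvexConclusion x N ε)))) := by
  -- `1100000 K` from the constant-step estimate, times `4 K²` from the lower bound on `μ`. The
  -- strongly convex cases need much less.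
  refine ⟨4400000 * K ^ 3, by positivity, ?_⟩
  intro n Ω Ξ _ _ G ε δ B μ D x₁ N x hn hG hε hB hD0 hμ hμ₀ hN
  refine ⟨fun p R M d hp hp2 hd hD hR hM => ⟨fun h hδ hAM hMA => ⟨?_, ?_⟩, fun h hδ => ⟨?_, ?_⟩⟩,
    fun γ c hγ hsc hD => ⟨fun h hδ => ⟨?_, ?_⟩, fun h hδ => ⟨?_, ?_⟩⟩⟩
  · intro M₂ hM₂ hL hμ1 hμ2 hNT
    exact Game.convexConclusion_onePoint hn hG hN hB hμ hμ₀ hp hp2 hd hD0 hD hε hδ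
      (Game.smoothable_of_lipschitz hG hN hμ hμ₀ hM₂ hL hμ1) hK hR hM hAM hMA
      (one_div_sq_le_of_lipschitz hμ hε hM₂ hμ2) (le_of_eq_of_le (by ring) hNT) h
  · intro L₂ hL₂ hS hμ1 hμ2 hNT
    exact Game.convexConclusion_onePoint hn hG hN hB hμ hμ₀ hp hp2 hd hD0 hD hε hδ
      (Game.smoothable_of_smooth hG hN hμ hμ₀ hε hL₂ hS hμ1) hK hR hM hAM hMA
      (one_div_sq_le_of_smooth hμ hε hL₂ hμ2) (le_of_eq_of_le (by ring) hNT) h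
  · intro M₂ Mₚ hM₂ hMₚ hL hLp hAM hMA hμ1 hNT
    exact Game.convexConclusion_twoPoint_of_lipschitz hn hG hN hμ hμ₀ hp hp2 hd hD0 hD hε hδ
      (Game.smoothable_of_lipschitz hG hN hμ hμ₀ hM₂ hL hμ1) hK hR hM hMₚ hLp hAM hMA hNT h
  · intro M₂ L₂ hM₂ hL₂ hL hS hAM hMA hμ1 hδM hNT
    rw [le_min_iff] at hμ1
    exact Game.convexConclusion_twoPoint_of_smooth hn hG hN hμ hμ₀ hp hp2 hd hD0 hD hε hδ
      (Game.smoothable_of_lipschitz_of_smooth hG hN hμ hμ₀ hε hM₂ hL₂ hL hS hμ1.1) hK hR hM hM₂ hL₂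
      hL hS hAM hMA hμ1.2 hδM hNT h
  · intro M₂ hM₂ hL hμ1 hμ2 hNT
    exact Game.stronglyConvexConclusion_onePoint hn hG hN hB hμ hμ₀ hD0 hD hε hδ
      (Game.smoothable_of_lipschitz hG hN hμ hμ₀ hM₂ hL hμ1) hK hγ hsc (by positivity)
      (one_div_sq_le_of_lipschitz hμ hε hM₂ hμ2) (le_of_eq_of_le (by ring) hNT) h
  · intro L₂ hL₂ hS hμ1 hμ2 hNT
    exact Game.stronglyConvexConclusion_onePoint hn hG hN hB hμ hμ₀ hD0 hD hε hδ
      (Game.smoothable_of_smooth hG hN hμ hμ₀ hε hL₂ hS hμ1) hK hγ hsc (by positivity)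
      (one_div_sq_le_of_smooth hμ hε hL₂ hμ2) (le_of_eq_of_le (by ring) hNT) h
  · intro M₂ hM₂ hL hμ1 hNT
    exact Game.stronglyConvexConclusion_twoPoint_of_lipschitz hn hG hN hμ hμ₀ hD0 hD hε hδ
      (Game.smoothable_of_lipschitz hG hN hμ hμ₀ hM₂ hL hμ1) hK hγ hsc hM₂ hL hNT h
  · intro M₂ L₂ hM₂ hL₂ hL hS hμ1 hδM hNT
    rw [le_min_iff] at hμ1
    exact Game.stronglyConvexConclusion_twoPoint_of_smooth hn hG hN hμ hμ₀ hD0 hD hε hδ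
      (Game.smoothable_of_lipschitz_of_smooth hG hN hμ hμ₀ hε hM₂ hL₂ hL hS hμ1.1) hK hγ hsc hM₂
      hL₂ hL hS hμ1.2 hδM hNT h
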